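/- **Proposition (boundary-bulk Carleman estimate).** Let $n\ge 1$ and $s\in[1/2,1)$. Write points of $\mathbb R^{n+1}_+=\mathbb R^n\times(0,\infty)$ as $x=(x',x_{n+1})$, write $\nabla=(\nabla',\partial_{n+1})$, and let $$\phi(x',x_{n+1}) = -\frac{|x'|^2}{4} + 2\left[-\frac{1}{2-2s}\,x_{n+1}^{2-2s}+\frac12 x_{n+1}^2\right].$$ There is a constant $C=C(n,s)>0$ with the following property. Let $w\in H^1(\mathbb R^{n+1}_+,x_{n+1}^{1-2s}dx)$ (real- or complex-valued), that is, $x_{n+1}^{\frac{1-2s}{2}}w$ and $x_{n+1}^{\frac{1-2s}{2}}\nabla w$ belong to $L^2(\mathbb R^{n+1}_+)$ with $\nabla w$ the weak gradient. Suppose that $\operatorname{supp}(w)\subset \{x: x_{n+1}\ge 0,\ |x|\le 1/2\}$, that $$\nabla\cdot x_{n+1}^{1-2s}\nabla w=f \quad\text{in } \mathbb R^{n+1}_+$$ in the sense of distributions, and that $w=0$ on $\mathbb R^n\times\{0\}$ in the sense of traces, i.e. $w(\cdot,x_{n+1})\to0$ in $L^2(\mathbb R^n)$ as $x_{n+1}\to0$.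 Assume in addition that $x_{n+1}^{\frac{2s-1}{2}}f\in L^2(\mathbb R^{n+1}_+)$ and $$\limsup_{x_{n+1}\to0}\|x_{n+1}^{1-2s}\partial_{n+1}w(\cdot,x_{n+1})\|_{L^2(\mathbb R^n)}<\infty,\qquad \limsup_{x_{n+1}\to0}\|\nabla'w(\cdot,x_{n+1})\|_{L^2(\mathbb R^n)}<\infty .$$ Then for every $\tau\ge4$ the limits $$N_\tau=\lim_{x_{n+1}\to0}\|e^{\tau\phi}x_{n+1}^{1-2s}\partial_{n+1}w(\cdot,x_{n+1})\|_{L^2(\mathbb R^n)},\qquad T_\tau=\lim_{x_{n+1}\to0}\|e^{\tau\phi}x'\cdot\nabla'w(\cdot,x_{n+1})\|_{L^2(\mathbb R^n)}$$ exist and are finite, and $$\tau^{3/2}\|e^{\tau\phi}x_{n+1}^{\frac{1-2s}{2}}w\|_{L^2(\mathbb R^{n+1}_+)}+\tau^{1/2}\|e^{\tau\phi}x_{n+1}^{\frac{1-2s}{2}}\nabla w\|_{L^2(\mathbb R^{n+1}_+)}\le C\left(\|e^{\tau\phi}x_{n+1}^{\frac{2s-1}{2}}f\|_{L^2(\mathbb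 R^{n+1}_+)}+\tau N_\tau+\tau T_\tau\right).$$ All limits superior and limits as $x_{n+1}\to0$ are taken along almost every $x_{n+1}>0$. -/

import Mathlib

open MeasureTheory Filter Topology
open scoped ENNReal NNReal ContDiff

noncomputable section

namespace Carleman

/-- Points `(x', x_{n+1})` of `ℝⁿ × ℝ = ℝ^{n+1}`. The sup norm of the product type is used nowhere:
only its topology, its Lebesgue measure and its smooth structure matter. -/
abbrev Pt (n : ℕ) : Type := EuclideanSpace ℝ (Fin n) × ℝ

/-- The open upper half-space `ℝ^{n+1}_+`. -/
def upperHalfSpace (n : ℕ) : Set (Pt n) := {p | 0 < p.2}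

/-- The closed half-ball `B_r^+ = {x : x_{n+1} ≥ 0, |x| ≤ r}` with the Euclidean norm. -/
def halfBall (n : ℕ) (r : ℝ) : Set (Pt n) := {p | 0 ≤ p.2 ∧ √(‖p.1‖ ^ 2 + p.2 ^ 2) ≤ r}

/-- Lebesgue measure on the upper half-space. -/
def halfSpaceMeasure (n : ℕ) : Measure (Pt n) := volume.restrict (upperHalfSpace n)

/-- The Carleman weight
`φ(x', y) = -|x'|²/4 + 2 (-y^{2-2s}/(2-2s) + y²/2)`. -/
def weight {n : ℕ} (s : ℝ) (p : Pt n) : ℝ :=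
  -(‖p.1‖ ^ 2 / 4) + 2 * (-(1 / (2 - 2 * s)) * p.2 ^ (2 - 2 * s) + 1 / 2 * p.2 ^ 2)

/-- `ψ ∈ C_c^∞(ℝ^{n+1}_+)`, the support being a compact subset of the open half-space. -/
structure IsTestFunction {n : ℕ} (ψ : Pt n → ℝ) : Prop where
  smooth : ContDiff ℝ ∞ ψ
  compact : HasCompactSupport ψ
  support : tsupport ψ ⊆ upperHalfSpace n

/-- The tangential partial derivative `∂_i ψ`, `1 ≤ i ≤ n`, of a differentiable function. -/
def tangentialDeriv {n : ℕ} (ψ : Pt n → ℝ) (i : Fin n) (p : Pt n) : ℝ :=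
  fderiv ℝ ψ p (EuclideanSpace.single i 1, 0)

/-- The normal derivative `∂_{n+1} ψ` of a differentiable function. -/
def normalDeriv {n : ℕ} (ψ : Pt n → ℝ) (p : Pt n) : ℝ :=
  fderiv ℝ ψ p (0, 1)

variable {𝕜 : Type*} [RCLike 𝕜] {n : ℕ}

/-- `(gx, gy)` is the weak gradient `(∇'w, ∂_{n+1}w)` of `w` in the open half-space. -/
structure IsWeakGradient (w : Pt n → 𝕜) (gx : Pt n → EuclideanSpace 𝕜 (Fin n))
    (gy : Pt n → 𝕜) : Prop where
  locallyIntegrable : LocallyIntegrableOn w (upperHalfSpace n)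
  locallyIntegrable_tangential : LocallyIntegrableOn gx (upperHalfSpace n)
  locallyIntegrable_normal : LocallyIntegrableOn gy (upperHalfSpace n)
  tangential : ∀ ψ : Pt n → ℝ, IsTestFunction ψ → ∀ i : Fin n,
    ∫ p, tangentialDeriv ψ i p • w p ∂halfSpaceMeasure n = -∫ p, ψ p • gx p i ∂halfSpaceMeasure n
  normal : ∀ ψ : Pt n → ℝ, IsTestFunction ψ →
    ∫ p, normalDeriv ψ p • w p ∂halfSpaceMeasure n = -∫ p, ψ p • gy p ∂halfSpaceMeasure n

/-- `w ∈ H¹(ℝ^{n+1}_+, x_{n+1}^{1-2s} dx)` with weak gradient `(gx, gy)`. -/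
structure MemWeightedH1 (s : ℝ) (w : Pt n → 𝕜) (gx : Pt n → EuclideanSpace 𝕜 (Fin n))
    (gy : Pt n → 𝕜) : Prop where
  weakGradient : IsWeakGradient w gx gy
  memLp : MemLp (fun p => p.2 ^ ((1 - 2 * s) / 2) • w p) 2 (halfSpaceMeasure n)
  memLp_tangential : MemLp (fun p => p.2 ^ ((1 - 2 * s) / 2) • gx p) 2 (halfSpaceMeasure n)
  memLp_normal : MemLp (fun p => p.2 ^ ((1 - 2 * s) / 2) • gy p) 2 (halfSpaceMeasure n)

/-- `∇ · x_{n+1}^{1-2s} ∇w = f` in `ℝ^{n+1}_+` in the sense of distributions, where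
`(gx, gy)` is the weak gradient of `w`. -/
def IsWeakSolution (s : ℝ) (gx : Pt n → EuclideanSpace 𝕜 (Fin n)) (gy f : Pt n → 𝕜) : Prop :=
  ∀ ψ : Pt n → ℝ, IsTestFunction ψ →
    ∫ p, p.2 ^ (1 - 2 * s) • ((∑ i, tangentialDeriv ψ i p • gx p i) + normalDeriv ψ p • gy p)
        ∂halfSpaceMeasure n
      = -∫ p, ψ p • f p ∂halfSpaceMeasure n

/-- The filter of the limits `y → 0`, `y > 0`. Elements of `L²` or `H¹` are defined only almost
everywhere, hence their slices `{x_{n+1} = y}` only for almost every `y`, so null sets of `y` are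
discarded. For a function of `y` that agrees almost everywhere with a continuous function on
`(0, ∞)`, limits along this filter are the ordinary limits of that continuous function. -/
def boundaryFilter : Filter ℝ := 𝓝[>] (0 : ℝ) ⊓ ae (volume : Measure ℝ)

/-- The norm `‖u(·, y)‖_{L²(ℝⁿ)}` of the slice at height `y`. -/
def sliceNorm {F : Type*} [NormedAddCommGroup F] (u : Pt n → F) (y : ℝ) : ℝ≥0∞ :=
  eLpNorm (fun x : EuclideanSpace ℝ (Fin n) => u (x, y)) 2 volume

/-- The norm `‖u‖_{L²(ℝ^{n+1}_+)}`. -/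
def bulkNorm {F : Type*} [NormedAddCommGroup F] (u : Pt n → F) : ℝ≥0∞ :=
  eLpNorm u 2 (halfSpaceMeasure n)

/-- `w = 0` on `ℝⁿ × {0}`: the trace, which is the `L²(ℝⁿ)`-limit of the slices `w(·, y)` as
`y → 0`, vanishes. -/
def HasZeroTrace (w : Pt n → 𝕜) : Prop :=
  Tendsto (sliceNorm w) boundaryFilter (𝓝 0)

/-- The pointwise length `|∇w|` of the full gradient `(gx, gy)`. -/
def gradLength (gx : Pt n → EuclideanSpace 𝕜 (Fin n)) (gy : Pt n → 𝕜) (p : Pt n) : ℝ :=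
  √(‖gx p‖ ^ 2 + ‖gy p‖ ^ 2)

/-- `x' · ∇'w`. -/
def radialDeriv (gx : Pt n → EuclideanSpace 𝕜 (Fin n)) (p : Pt n) : 𝕜 :=
  ∑ i, p.1 i • gx p i

end Carleman

end

/-!
Put `a = 1 - 2s ∈ (-1, 0]`, `y = x_{n+1}` and let `p = y^a ∂_y w` be the conormal derivative. The
estimate holds with `C = 10`, and the tangential limit `T` vanishes: zero trace and the equation
force `∇'w → 0` in `L²` at the boundary. So the proof bounds the left-hand side by the right-hand
side `f` and the Neumann data alone.

**Smooth case.** Suppose that `w` is smooth in the tangential variables, with all quantities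
continuous up to `y = 0` (`IsTangentiallySmooth`). The function `v = e^{τφ} w` satisfies the
conjugated equation, whose operator is the sum of a symmetric part `S` and an antisymmetric part.
Let `B` be the antisymmetric part minus `3/2 τ v`. The product `2 y^a S B` is a positive bulk form
of size `τ³ y^a v² + τ y^a |∇v|²`, plus the `y`-derivative of an explicit flux, plus terms that
integrate to zero over every slice by tangential integration by parts (`carleman_identity`,
`carleman_bulk_lower_bound`, `pointwise_carleman`, `integral_sliceNull`). The bulk form is
positive since `∂_y φ = 2 (y - y^a) ≤ -1` for `y ≤ 1/2`. Integration over `{b < y ≤ 1/2}` gives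
`IsTangentiallySmooth.carleman_slab`, with the flux at height `b` as boundary term. Negative
powers of `y` occur in this flux; but `w(·, 0) = 0` makes `w` and `∇'w` of order `y^{1-a}`, so
that the flux is continuous up to `y = 0`, where it is a multiple of the squared Neumann data
(`exists_tendsto_integral_carlemanFlux`). Letting `b → 0` yields `IsTangentiallySmooth.carleman`.

**Regularity at the boundary.** Testing the equation with the tangential Laplacian of `w` bounds
`y^{-a/2} ∂_y p` and `y^{-a/2} ∇'p` in `L²` by `y^{-a/2} f`
(`IsTangentiallySmooth.lintegral_sq_le`). Since `y^a` and `y^{-a}` are integrable at `0`, the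
Cauchy-Schwarz inequality in `y` shows that `p` is uniformly continuous in `y` with values in
`L²(ℝⁿ)` and that `∇'w → 0` in `L²(ℝⁿ)` (`lintegral_sq_sub_p_le`, `lintegral_sq_pd_u_le`), both
with rates that depend on `f` only. In particular the Neumann data may be taken at a small
positive height (`carleman_of_height`).

**General case.** Real and imaginary parts of `w` are treated separately, after a choice of
representatives that vanish off the half-ball (`exists_isWeakData`). Convolution with a mollifier
`θ` in the tangential variables turns the equation into `∂_y (θ * p) = θ * f - Δ'θ * y^a w`, which
only involves `w` and `f` on the right. Hence `θ * p` and `θ * w` agree almost everywhere with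
iterated integrals in `y` of these data (`mollConormal`, `mollSolution`), which are tangentially
smooth, and zero trace of `w` becomes a pointwise condition (`exists_isTangentiallySmooth`). The
regularity estimates pass to the limit in `θ`; they give the existence of `N` and `T = 0`
(`exists_tendsto_lintegral_sq_conormal`, `tendsto_lintegral_sq_tangential`). In the Carleman
inequality at a fixed height, Fatou's lemma handles the left-hand side and Jensen's inequality the
right-hand side; then the height tends to zero (`IsWeakData.carleman`).
-/

namespace Carleman

/-! ### Calculus on the slices `ℝⁿ × {y}` -/

section Slices

variable {n : ℕ}

/-- The `i`-th partial derivative of a function on `ℝⁿ`. -/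
noncomputable def pd (i : Fin n) (g : EuclideanSpace ℝ (Fin n) → ℝ)
    (x : EuclideanSpace ℝ (Fin n)) : ℝ :=
  fderiv ℝ g x (EuclideanSpace.single i 1)

/-- The Laplacian on `ℝⁿ`, as the sum of the second partial derivatives. -/
noncomputable def lap (g : EuclideanSpace ℝ (Fin n) → ℝ) (x : EuclideanSpace ℝ (Fin n)) : ℝ :=
  ∑ i, pd i (pd i g) x

/-- The radial derivative `x · ∇g` on `ℝⁿ`. -/
noncomputable def rad (g : EuclideanSpace ℝ (Fin n) → ℝ) (x : EuclideanSpace ℝ (Fin n)) : ℝ :=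
  ∑ i, x i * pd i g x

variable {f g v q : EuclideanSpace ℝ (Fin n) → ℝ} {x : EuclideanSpace ℝ (Fin n)} {R : ℝ}

lemma contDiff_pd {k m : WithTop ℕ∞} (hg : ContDiff ℝ k g) (h : m + 1 ≤ k) (i : Fin n) :
    ContDiff ℝ m (pd i g) :=
  (hg.fderiv_right h).clm_apply contDiff_const

lemma continuous_pd (hg : ContDiff ℝ 1 g) (i : Fin n) : Continuous (pd i g) :=
  (contDiff_pd (m := 0) hg (by norm_num) i).continuous

lemma contDiff_pd_one (hg : ContDiff ℝ 2 g) (i : Fin n) : ContDiff ℝ 1 (pd i g) :=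
  contDiff_pd hg (by norm_num [one_add_one_eq_two]) i

lemma continuous_pd_pd (hg : ContDiff ℝ 2 g) (i j : Fin n) : Continuous (pd i (pd j g)) :=
  continuous_pd (contDiff_pd_one hg j) i

lemma continuous_lap (hg : ContDiff ℝ 2 g) : Continuous (lap g) :=
  continuous_finsetSum _ fun i _ => continuous_pd_pd hg i i

lemma continuous_rad (hg : ContDiff ℝ 1 g) : Continuous (rad g) :=
  continuous_finsetSum _ fun i _ => by
    have := continuous_pd hg i
    fun_prop

lemma pd_mul (hf : DifferentiableAt ℝ f x) (hg : DifferentiableAt ℝ g x) (i : Fin n) :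
    pd i (fun z => f z * g z) x = f x * pd i g x + pd i f x * g x := by
  have := congrArg (fun L => L (EuclideanSpace.single i 1)) (fderiv_fun_mul hf hg)
  simpa [pd, mul_comm] using this

lemma pd_add (hf : DifferentiableAt ℝ f x) (hg : DifferentiableAt ℝ g x) (i : Fin n) :
    pd i (fun z => f z + g z) x = pd i f x + pd i g x := by
  simp [pd, fderiv_fun_add hf hg]

lemma pd_const_mul (hf : DifferentiableAt ℝ f x) (c : ℝ) (i : Fin n) :
    pd i (fun z => c * f z) x = c * pd i f x := by
  simp [pd, fderiv_const_mul hf c]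

lemma pd_sum {ι : Type*} (s : Finset ι) {F : ι → EuclideanSpace ℝ (Fin n) → ℝ}
    (hF : ∀ j ∈ s, DifferentiableAt ℝ (F j) x) (i : Fin n) :
    pd i (fun z => ∑ j ∈ s, F j z) x = ∑ j ∈ s, pd i (F j) x := by
  simp [pd, fderiv_fun_sum hF]

lemma pd_coord (i j : Fin n) : pd i (fun z : EuclideanSpace ℝ (Fin n) => z j) x
    = if i = j then 1 else 0 := by
  have : HasFDerivAt (fun z : EuclideanSpace ℝ (Fin n) => z j)
      (EuclideanSpace.proj (𝕜 := ℝ) j) x := (EuclideanSpace.proj (𝕜 := ℝ) j).hasFDerivAt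
  rw [pd, this.fderiv]
  simp [eq_comm]

lemma pd_norm_sq (i : Fin n) : pd i (fun z : EuclideanSpace ℝ (Fin n) => ‖z‖ ^ 2) x
    = 2 * x i := by
  have h := (hasStrictFDerivAt_norm_sq x).hasFDerivAt
  rw [pd, h.fderiv]
  simp [PiLp.inner_apply]

lemma pd_eq_zero_of_eq_zero (hg : ∀ z, R < ‖z‖ → g z = 0) (i : Fin n) (hx : R < ‖x‖) :
    pd i g x = 0 := by
  have h : g =ᶠ[𝓝 x] fun _ => 0 := by
    filter_upwards [(isOpen_lt continuous_const continuous_norm).mem_nhds hx] with z hz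
    exact hg z hz
  simp [pd, h.fderiv_eq]

lemma lap_eq_zero_of_eq_zero (hg : ∀ z, R < ‖z‖ → g z = 0) (hx : R < ‖x‖) : lap g x = 0 :=
  Finset.sum_eq_zero fun i _ =>
    pd_eq_zero_of_eq_zero (fun _ hz => pd_eq_zero_of_eq_zero hg i hz) i hx

lemma rad_eq_zero_of_eq_zero (hg : ∀ z, R < ‖z‖ → g z = 0) (hx : R < ‖x‖) : rad g x = 0 :=
  Finset.sum_eq_zero fun i _ => by rw [pd_eq_zero_of_eq_zero hg i hx, mul_zero]

lemma pd_pd_comm (hg : ContDiff ℝ 2 g) (i j : Fin n) : pd i (pd j g) x = pd j (pd i g) x := by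
  have hd : DifferentiableAt ℝ (fderiv ℝ g) x :=
    ((hg.fderiv_right (m := 1) (by norm_num [one_add_one_eq_two])).differentiable
      one_ne_zero).differentiableAt
  have key : ∀ a b : Fin n, pd a (pd b g) x
      = fderiv ℝ (fderiv ℝ g) x (EuclideanSpace.single a 1) (EuclideanSpace.single b 1) := by
    intro a b
    have : pd b g = fun z => fderiv ℝ g z (EuclideanSpace.single b 1) := rfl
    rw [pd, this, fderiv_clm_apply hd (differentiableAt_const _)]
    simp
  have hs : IsSymmSndFDerivAt ℝ g x := hg.contDiffAt.isSymmSndFDerivAt (by simp)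
  rw [key, key, hs.eq]

lemma integrable_of_continuous_of_eq_zero (hf : Continuous f) (h0 : ∀ z, R < ‖z‖ → f z = 0) :
    Integrable f :=
  hf.integrable_of_hasCompactSupport <|
    HasCompactSupport.intro (isCompact_closedBall 0 R) fun z hz => h0 z (by simpa using hz)

lemma integral_mul_pd (hf : ContDiff ℝ 1 f) (hg : ContDiff ℝ 1 g)
    (hg0 : ∀ z, R < ‖z‖ → g z = 0) (i : Fin n) :
    ∫ z, f z * pd i g z = -∫ z, pd i f z * g z := by
  refine integral_mul_fderiv_eq_neg_fderiv_mul_of_integrable (f := f) (g := g)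
    (v := EuclideanSpace.single i 1) ?_ ?_ ?_
    (fun x _ => (hf.differentiable one_ne_zero).differentiableAt)
    (fun x _ => (hg.differentiable one_ne_zero).differentiableAt)
  · exact integrable_of_continuous_of_eq_zero (R := R) ((continuous_pd hf i).mul hg.continuous)
      fun z hz => by simp [hg0 z hz]
  · exact integrable_of_continuous_of_eq_zero (R := R) (hf.continuous.mul (continuous_pd hg i))
      fun z hz => by
        have := pd_eq_zero_of_eq_zero hg0 i hz
        rw [pd] at this
        simp [this]
  · exact integrable_of_continuous_of_eq_zero (R := R) (hf.continuous.mul hg.continuous)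
      fun z hz => by simp [hg0 z hz]

/-- The divergence of `f(x) x` has integral zero. -/
lemma integral_rad_add (hf : ContDiff ℝ 1 f) (hf0 : ∀ z, R < ‖z‖ → f z = 0) :
    ∫ z, (rad f z + n * f z) = 0 := by
  have hc : ∀ i : Fin n, ContDiff ℝ 1 fun z : EuclideanSpace ℝ (Fin n) => z i :=
    fun i => by fun_prop
  have h1 : ∀ i : Fin n, Integrable fun z : EuclideanSpace ℝ (Fin n) => z i * pd i f z :=
    fun i => integrable_of_continuous_of_eq_zero (R := R)
      ((hc i).continuous.mul (continuous_pd hf i))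
      fun z hz => by rw [pd_eq_zero_of_eq_zero hf0 i hz, mul_zero]
  have h2 : Integrable f := integrable_of_continuous_of_eq_zero hf.continuous hf0
  have h3 : ∀ i : Fin n, ∫ z : EuclideanSpace ℝ (Fin n), z i * pd i f z = -∫ z, f z := by
    intro i
    rw [integral_mul_pd (hc i) hf hf0]
    simp [pd_coord]
  simp only [rad]
  rw [integral_add (integrable_finsetSum _ fun i _ => h1 i) (h2.const_mul _),
    integral_finsetSum _ fun i _ => h1 i, integral_const_mul]
  simp [h3]

lemma rad_mul (hf : DifferentiableAt ℝ f x) (hg : DifferentiableAt ℝ g x) :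
    rad (fun z => f z * g z) x = f x * rad g x + rad f x * g x := by
  simp only [rad, pd_mul hf hg, Finset.mul_sum, Finset.sum_mul, ← Finset.sum_add_distrib]
  exact Finset.sum_congr rfl fun i _ => by ring

lemma rad_norm_sq : rad (fun z : EuclideanSpace ℝ (Fin n) => ‖z‖ ^ 2) x = 2 * ‖x‖ ^ 2 := by
  simp only [rad, pd_norm_sq]
  rw [EuclideanSpace.real_norm_sq_eq, Finset.mul_sum]
  exact Finset.sum_congr rfl fun i _ => by ring

/-- The operator `x · ∇ + n / 2` is antisymmetric. -/
lemma integral_mul_rad (hq : ContDiff ℝ 1 q) (hq0 : ∀ z, R < ‖z‖ → q z = 0) :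
    ∫ z, q z * (rad q z + n / 2 * q z) = 0 := by
  have h := integral_rad_add (R := R) (hq.mul hq) fun z hz => by simp [hq0 z hz]
  have h2 : ∀ z, rad (fun z => q z * q z) z + n * (q z * q z)
      = 2 * (q z * (rad q z + n / 2 * q z)) := fun z => by
    rw [rad_mul (hq.differentiable one_ne_zero).differentiableAt
      (hq.differentiable one_ne_zero).differentiableAt]
    ring
  simp only [h2, integral_const_mul] at h
  linarith

lemma integral_lap_mul (hv : ContDiff ℝ 2 v) (hq : ContDiff ℝ 1 q)
    (hq0 : ∀ z, R < ‖z‖ → q z = 0) :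
    ∫ z, (lap v z * q z + ∑ i, pd i v z * pd i q z) = 0 := by
  have e : ∀ z, lap v z * q z + ∑ i, pd i v z * pd i q z
      = ∑ i, (pd i (pd i v) z * q z + pd i v z * pd i q z) := fun z => by
    rw [lap, Finset.sum_mul, Finset.sum_add_distrib]
  have i1 : ∀ i, Integrable fun z => pd i (pd i v) z * q z := fun i =>
    integrable_of_continuous_of_eq_zero (R := R)
      ((continuous_pd_pd hv i i).mul hq.continuous) fun z hz => by simp [hq0 z hz]
  have i2 : ∀ i, Integrable fun z => pd i v z * pd i q z := fun i =>
    integrable_of_continuous_of_eq_zero (R := R)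
      ((contDiff_pd_one hv i).continuous.mul (continuous_pd hq i))
      fun z hz => by simp [pd_eq_zero_of_eq_zero hq0 i hz]
  simp only [e]
  rw [integral_finsetSum _ fun i _ => (i1 i).fun_add (i2 i)]
  refine Finset.sum_eq_zero fun i _ => ?_
  rw [integral_add (i1 i) (i2 i), integral_mul_pd (contDiff_pd_one hv i) hq hq0]
  ring

/-- The commutator of `Δ + c |x|²` with `x · ∇ + n / 2`, as a quadratic form. -/
lemma integral_lap_mul_rad (hv : ContDiff ℝ 2 v) (hv0 : ∀ z, R < ‖z‖ → v z = 0) (c : ℝ) :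
    ∫ z, ((lap v z + c * ‖z‖ ^ 2 * v z) * (rad v z + n / 2 * v z)
      + ∑ i, pd i v z ^ 2 + c * ‖z‖ ^ 2 * v z ^ 2) = 0 := by
  have hv1 : ContDiff ℝ 1 v := hv.of_le (by norm_num)
  have hd : ∀ z, DifferentiableAt ℝ v z :=
    fun z => (hv1.differentiable one_ne_zero).differentiableAt
  have hvi : ∀ i, ContDiff ℝ 1 (pd i v) := contDiff_pd_one hv
  have hdi : ∀ i z, DifferentiableAt ℝ (pd i v) z :=
    fun i z => ((hvi i).differentiable one_ne_zero).differentiableAt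
  have hn : ContDiff ℝ 1 fun z : EuclideanSpace ℝ (Fin n) => ‖z‖ ^ 2 := contDiff_norm_sq ℝ
  have hnd : ∀ z, DifferentiableAt ℝ (fun z : EuclideanSpace ℝ (Fin n) => ‖z‖ ^ 2) z :=
    fun z => (hn.differentiable one_ne_zero).differentiableAt
  have hr : ContDiff ℝ 1 (rad v) := ContDiff.sum fun i _ => by
    have := hvi i
    exact ContDiff.mul (by fun_prop) this
  have hr0 : ∀ z, R < ‖z‖ → rad v z = 0 := fun z hz => rad_eq_zero_of_eq_zero hv0 hz
  have hG : ContDiff ℝ 1 fun z => ∑ i, pd i v z * pd i v z :=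
    ContDiff.sum fun i _ => (hvi i).mul (hvi i)
  have hG0 : ∀ z, R < ‖z‖ → ∑ i, pd i v z * pd i v z = 0 := fun z hz =>
    Finset.sum_eq_zero fun i _ => by simp [pd_eq_zero_of_eq_zero hv0 i hz]
  have e1 := integral_lap_mul (R := R) hv hr hr0
  have e2 := integral_lap_mul (R := R) hv hv1 hv0
  have e3 := integral_rad_add (R := R) hG hG0
  have e4 := integral_rad_add (R := R) (hn.mul (hv1.mul hv1)) fun z hz => by simp [hv0 z hz]
  have pr : ∀ i z, pd i (rad v) z = pd i v z + ∑ j, z j * pd j (pd i v) z := by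
    intro i z
    have : rad v = fun z => ∑ j, z j * pd j v z := rfl
    rw [this, pd_sum _ (F := fun j z => z j * pd j v z)
      (fun j _ => DifferentiableAt.fun_mul (by fun_prop) (hdi j z))]
    have hm : ∀ j, pd i (fun z => z j * pd j v z) z
        = z j * pd i (pd j v) z + (if i = j then 1 else 0) * pd j v z := fun j => by
      rw [pd_mul (f := fun z : EuclideanSpace ℝ (Fin n) => z j) (by fun_prop) (hdi j z), pd_coord]
    simp only [hm, Finset.sum_add_distrib]
    rw [add_comm]
    congr 1
    · simp
    · exact Finset.sum_congr rfl fun j _ => by rw [pd_pd_comm hv]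
  have rG : ∀ z, rad (fun z => ∑ i, pd i v z * pd i v z) z
      = 2 * ∑ i, pd i v z * ∑ j, z j * pd j (pd i v) z := by
    intro z
    simp only [rad]
    rw [Finset.sum_congr rfl fun j _ => by
      rw [pd_sum _ (F := fun i z => pd i v z * pd i v z)
        (fun i _ => (hdi i z).fun_mul (hdi i z))]]
    simp only [pd_mul (hdi _ z) (hdi _ z), Finset.mul_sum]
    rw [Finset.sum_comm]
    exact Finset.sum_congr rfl fun i _ => Finset.sum_congr rfl fun j _ => by ring
  have I1 : Integrable fun z => lap v z * rad v z + ∑ i, pd i v z * pd i (rad v) z :=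
    integrable_of_continuous_of_eq_zero (R := R)
      (((continuous_lap hv).mul hr.continuous).add
        (continuous_finsetSum _ fun i _ => (hvi i).continuous.mul (continuous_pd hr i)))
      fun z hz => by simp [hr0 z hz, pd_eq_zero_of_eq_zero hv0 _ hz]
  have I2 : Integrable fun z => lap v z * v z + ∑ i, pd i v z * pd i v z :=
    integrable_of_continuous_of_eq_zero (R := R)
      (((continuous_lap hv).mul hv.continuous).add hG.continuous)
      fun z hz => by simp [hv0 z hz, pd_eq_zero_of_eq_zero hv0 _ hz]
  have I3 : Integrable fun z => rad (fun z => ∑ i, pd i v z * pd i v z) z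
      + n * ∑ i, pd i v z * pd i v z :=
    integrable_of_continuous_of_eq_zero (R := R)
      ((continuous_rad hG).add (continuous_const.mul hG.continuous))
      fun z hz => by rw [rad_eq_zero_of_eq_zero hG0 hz, hG0 z hz]; simp
  have I4 : Integrable fun z => rad (fun z => ‖z‖ ^ 2 * (v z * v z)) z
      + n * (‖z‖ ^ 2 * (v z * v z)) :=
    integrable_of_continuous_of_eq_zero (R := R)
      ((continuous_rad (hn.mul (hv1.mul hv1))).add
        (continuous_const.mul (hn.mul (hv1.mul hv1)).continuous))
      fun z hz => by
        rw [rad_eq_zero_of_eq_zero (R := R) (fun w hw => by simp [hv0 w hw]) hz]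
        simp [hv0 z hz]
  have key : ∀ z, (lap v z + c * ‖z‖ ^ 2 * v z) * (rad v z + n / 2 * v z)
      + ∑ i, pd i v z ^ 2 + c * ‖z‖ ^ 2 * v z ^ 2
      = ((lap v z * rad v z + ∑ i, pd i v z * pd i (rad v) z)
        + (n / 2) * (lap v z * v z + ∑ i, pd i v z * pd i v z))
        + ((-1 / 2) * (rad (fun z => ∑ i, pd i v z * pd i v z) z
          + n * ∑ i, pd i v z * pd i v z)
        + (c / 2) * (rad (fun z => ‖z‖ ^ 2 * (v z * v z)) z + n * (‖z‖ ^ 2 * (v z * v z)))) := by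
    intro z
    rw [rG, rad_mul (hnd z) ((hd z).fun_mul (hd z)), rad_mul (hd z) (hd z), rad_norm_sq]
    simp only [pr, mul_add, Finset.sum_add_distrib, pow_two (pd _ v z)]
    ring
  simp only [key]
  rw [integral_add (I1.fun_add (I2.const_mul _)) ((I3.const_mul _).fun_add (I4.const_mul _)),
    integral_add I1 (I2.const_mul _), integral_add (I3.const_mul _) (I4.const_mul _)]
  simp only [integral_const_mul]
  rw [e1, e2, e3, e4]
  simp

end Slices

/-! ### The pointwise Carleman identity -/

section Pointwise

/-- The flux of the Carleman identity through the slice at height `y`. Here `a = 1 - 2s`, the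
conjugated function is `v = e^{τφ} u`, `Q = y^a ∂_y v` is its conormal derivative, `A` stands for
`τ (x · ∇' v + n v / 2)`, `G` for `|∇' v|²` and `X` for `|x|²`. -/
noncomputable def flux (a τ X y Q v A G : ℝ) : ℝ :=
  -4 * τ * (y / y ^ a - 1) * Q ^ 2
    - 2 * τ * (2 * (1 + a) + 3 / 2 - 4 * a * (y ^ a / y)) * (Q * v)
    + 4 * τ * (-a) * (1 - a) * (y ^ a / y) ^ 2 * v ^ 2
    + 2 * Q * A - 2 * τ ^ 3 * (y ^ a * (2 * (y - y ^ a)) ^ 3) * v ^ 2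
    + 2 * τ * (y ^ a * (2 * (y - y ^ a))) * (G - τ ^ 2 / 4 * X * v ^ 2)

/-- The normal derivative of `flux`, where `D = ∂_y Q`, `q = ∂_y v`, `B = ∂_y A` and
`2 g = ∂_y G`. -/
noncomputable def fluxDeriv (a τ X y Q v A G D q B g : ℝ) : ℝ :=
  -4 * τ * ((1 - a) / y ^ a * Q ^ 2 + (y / y ^ a - 1) * (2 * Q * D))
    - 2 * τ * (-4 * a * (a - 1) * (y ^ a / y ^ 2) * (Q * v)
      + (2 * (1 + a) + 3 / 2 - 4 * a * (y ^ a / y)) * (D * v + Q * q))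
    + 4 * τ * (-a) * (1 - a) * (2 * (y ^ a / y) * ((a - 1) * (y ^ a / y ^ 2)) * v ^ 2
      + (y ^ a / y) ^ 2 * (2 * v * q))
    + 2 * (D * A + Q * B)
    - 2 * τ ^ 3 * ((a * (y ^ a / y) * (2 * (y - y ^ a)) ^ 3
        + y ^ a * (3 * (2 * (y - y ^ a)) ^ 2 * (2 * (1 - a * (y ^ a / y))))) * v ^ 2
      + y ^ a * (2 * (y - y ^ a)) ^ 3 * (2 * v * q))
    + 2 * τ * ((a * (y ^ a / y) * (2 * (y - y ^ a)) + y ^ a * (2 * (1 - a * (y ^ a / y))))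
        * (G - τ ^ 2 / 4 * X * v ^ 2)
      + y ^ a * (2 * (y - y ^ a)) * (2 * g - τ ^ 2 / 4 * X * (2 * v * q)))

lemma hasDerivAt_rpow_left {a y : ℝ} (hy : 0 < y) :
    HasDerivAt (fun t : ℝ => t ^ a) (a * (y ^ a / y)) y := by
  have := Real.hasDerivAt_rpow_const (x := y) (p := a) (Or.inl hy.ne')
  rwa [Real.rpow_sub_one hy.ne'] at this

lemma hasDerivAt_flux {a τ X y D q B g : ℝ} {Q v A G : ℝ → ℝ} (hy : 0 < y)
    (hQ : HasDerivAt Q D y) (hv : HasDerivAt v q y) (hA : HasDerivAt A B y)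
    (hG : HasDerivAt G (2 * g) y) :
    HasDerivAt (fun t => flux a τ X t (Q t) (v t) (A t) (G t))
      (fluxDeriv a τ X y (Q y) (v y) (A y) (G y) D q B g) y := by
  have hY : HasDerivAt (fun t : ℝ => t ^ a) (a * (y ^ a / y)) y := hasDerivAt_rpow_left hy
  have hY0 : y ^ a ≠ 0 := (Real.rpow_pos_of_pos hy a).ne'
  have h1 := (((hasDerivAt_id y).fun_div hY hY0).sub_const 1).const_mul (-4 * τ)
    |>.fun_mul (hQ.fun_pow 2)
  have h2 := (((hY.fun_div (hasDerivAt_id y) hy.ne').const_mul (4 * a)).const_sub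
    (2 * (1 + a) + 3 / 2)).const_mul (2 * τ) |>.fun_mul (hQ.fun_mul hv)
  have h3 := (((hY.fun_div (hasDerivAt_id y) hy.ne').fun_pow 2).const_mul
    (4 * τ * (-a) * (1 - a))).fun_mul (hv.fun_pow 2)
  have h4 := (hQ.const_mul 2).fun_mul hA
  have hh := ((hasDerivAt_id y).fun_sub hY).const_mul 2
  have h5 := ((hY.fun_mul (hh.fun_pow 3)).const_mul (2 * τ ^ 3)).fun_mul (hv.fun_pow 2)
  have h6 := ((hY.fun_mul hh).const_mul (2 * τ)).fun_mul
    (hG.fun_sub ((hv.fun_pow 2).const_mul (τ ^ 2 / 4 * X)))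
  have h := ((((h1.fun_sub h2).fun_add h3).fun_add h4).fun_sub h5).fun_add h6
  unfold flux
  refine h.congr_deriv ?_
  unfold fluxDeriv
  simp only [id, Nat.add_one_sub_one, pow_one, Nat.cast_ofNat]
  generalize y ^ a = Y at hY0
  have hy0 := hy.ne'
  field_simp
  ring

lemma absolutelyContinuousOnInterval_flux {a τ X b c : ℝ} {Q v A G : ℝ → ℝ} (hb : 0 < b)
    (hbc : b ≤ c)
    (hQ : AbsolutelyContinuousOnInterval Q b c) (hv : AbsolutelyContinuousOnInterval v b c)
    (hA : AbsolutelyContinuousOnInterval A b c) (hG : AbsolutelyContinuousOnInterval G b c) :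
    AbsolutelyContinuousOnInterval (fun t => flux a τ X t (Q t) (v t) (A t) (G t)) b c := by
  have hpos : ∀ t ∈ Set.uIcc b c, t ≠ 0 := fun t ht => by
    rw [Set.uIcc_of_le hbc] at ht
    exact (hb.trans_le ht.1).ne'
  have hY : ContDiffOn ℝ 1 (fun t : ℝ => t ^ a) (Set.uIcc b c) := fun t ht =>
    (Real.contDiffAt_rpow_const_of_ne (hpos t ht)).contDiffWithinAt
  have hY0 : ∀ t ∈ Set.uIcc b c, t ^ a ≠ 0 := fun t ht => by
    rw [Set.uIcc_of_le hbc] at ht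
    exact (Real.rpow_pos_of_pos (hb.trans_le ht.1) a).ne'
  have c1 : ContDiffOn ℝ 1 (fun t : ℝ => -4 * τ * (t / t ^ a - 1)) (Set.uIcc b c) :=
    contDiffOn_const.mul ((contDiffOn_id.div hY hY0).sub contDiffOn_const)
  have c2 : ContDiffOn ℝ 1 (fun t : ℝ => 2 * τ * (2 * (1 + a) + 3 / 2 - 4 * a * (t ^ a / t)))
      (Set.uIcc b c) :=
    contDiffOn_const.mul (contDiffOn_const.sub (contDiffOn_const.mul
      (hY.div contDiffOn_id hpos)))
  have c3 : ContDiffOn ℝ 1 (fun t : ℝ => 4 * τ * (-a) * (1 - a) * (t ^ a / t) ^ 2)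
      (Set.uIcc b c) :=
    contDiffOn_const.mul ((hY.div contDiffOn_id hpos).pow 2)
  have ch : ContDiffOn ℝ 1 (fun t : ℝ => 2 * (t - t ^ a)) (Set.uIcc b c) :=
    contDiffOn_const.mul (contDiffOn_id.sub hY)
  have c5 : ContDiffOn ℝ 1 (fun t : ℝ => 2 * τ ^ 3 * (t ^ a * (2 * (t - t ^ a)) ^ 3))
      (Set.uIcc b c) := contDiffOn_const.mul (hY.mul (ch.pow 3))
  have c6 : ContDiffOn ℝ 1 (fun t : ℝ => 2 * τ * (t ^ a * (2 * (t - t ^ a))))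
      (Set.uIcc b c) := contDiffOn_const.mul (hY.mul ch)
  have h := (((((c1.absolutelyContinuousOnInterval.fun_mul (hQ.fun_mul hQ)).fun_sub
    (c2.absolutelyContinuousOnInterval.fun_mul (hQ.fun_mul hv))).fun_add
    (c3.absolutelyContinuousOnInterval.fun_mul (hv.fun_mul hv))).fun_add
    ((hQ.const_mul 2).fun_mul hA)).fun_sub
    (c5.absolutelyContinuousOnInterval.fun_mul (hv.fun_mul hv))).fun_add
    (c6.absolutelyContinuousOnInterval.fun_mul
      (hG.fun_sub ((hv.fun_mul hv).const_mul (τ ^ 2 / 4 * X))))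
  refine (congrArg (AbsolutelyContinuousOnInterval · b c) (funext fun t => ?_)).mp h
  unfold flux
  ring

/-- The pointwise Carleman identity. Here `Y` stands for `y^a`, `h = 2 (y - Y)` is `∂_y φ`, `q` is
`∂_y v` and `D` is `∂_y (y^a ∂_y v)`. The product `2 y^a S B` of the symmetric part `S` of the
conjugated operator (first factor) with the multiplier `B` (second factor) is the sum of a bulk
quadratic form, of `∂_y` of the flux, and of terms with zero integral over each slice. All
derivatives of `v` are independent variables here, so that the identity is one of rational
functions. -/
lemma carleman_identity (a τ X y v q D Hv Av Aq G g : ℝ) {Y : ℝ} (hy : y ≠ 0) (hY : Y ≠ 0) :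
    Y * (2 * ((D / Y + τ ^ 2 * (2 * (y - Y)) ^ 2 * v + Hv) *
      (-2 * τ * (2 * (y - Y)) * q - τ * (2 * (1 + a) + 3 / 2 - 4 * a * (Y / y)) * v + Av)))
      = Y * (11 * τ * q ^ 2 + 2 * τ ^ 3 * (2 * (y - Y)) ^ 2
        * (2 * (2 * (1 - a * (Y / y))) - 3 / 2) * v ^ 2 + τ * G - 5 / 4 * τ ^ 3 * X * v ^ 2)
        + 8 * (-a) * τ * (Y ^ 2 / y) * (q - (1 - a) * v / y) ^ 2
        + (-4 * τ * ((1 - a) / Y * (Y * q) ^ 2 + (y / Y - 1) * (2 * (Y * q) * D))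
    - 2 * τ * (-4 * a * (a - 1) * (Y / y ^ 2) * ((Y * q) * v)
      + (2 * (1 + a) + 3 / 2 - 4 * a * (Y / y)) * (D * v + (Y * q) * q))
    + 4 * τ * (-a) * (1 - a) * (2 * (Y / y) * ((a - 1) * (Y / y ^ 2)) * v ^ 2
      + (Y / y) ^ 2 * (2 * v * q))
    + 2 * (D * Av + (Y * q) * Aq)
    - 2 * τ ^ 3 * ((a * (Y / y) * (2 * (y - Y)) ^ 3
        + Y * (3 * (2 * (y - Y)) ^ 2 * (2 * (1 - a * (Y / y))))) * v ^ 2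
      + Y * (2 * (y - Y)) ^ 3 * (2 * v * q))
    + 2 * τ * ((a * (Y / y) * (2 * (y - Y)) + Y * (2 * (1 - a * (Y / y))))
        * (G - τ ^ 2 / 4 * X * v ^ 2)
      + Y * (2 * (y - Y)) * (2 * g - τ ^ 2 / 4 * X * (2 * v * q))))
        + (-2 * Y * (q * Aq) + 2 * Y * τ ^ 2 * (2 * (y - Y)) ^ 2 * (v * Av)
          - 4 * τ * Y * (2 * (y - Y)) * (Hv * q + g - τ ^ 2 / 4 * X * (v * q))
          - 2 * τ * (2 * (1 + a) + 3 / 2 - 4 * a * (Y / y)) * Y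
            * (Hv * v + G - τ ^ 2 / 4 * X * v ^ 2)
          + 2 * Y * (Hv * Av + τ * G + τ ^ 3 / 4 * X * v ^ 2)) := by
  obtain ⟨d, rfl⟩ : ∃ d, D = Y * d := ⟨D / Y, by field_simp⟩
  have e1 : (1 - a) / Y * (Y * q) ^ 2 = (1 - a) * Y * q ^ 2 := by field_simp
  have e2 : (y / Y - 1) * (2 * (Y * q) * (Y * d)) = (y - Y) * (2 * Y * q * d) := by field_simp
  have e3 : Y * d / Y = d := by field_simp
  rw [e1, e2, e3]
  field_simp
  ring

/-- Positivity of the bulk form in the Carleman identity, for `h = ∂_y φ`. The term with the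
factor `-a` is nonnegative, the coefficient of `v²` is at least `5 τ³ h²`, and `h² ≥ 1` lets it
absorb the only negative term `-5/4 τ³ |x|² v²` when `|x| ≤ 5/8`. The last term on the left pays for the
lower order correction in the multiplier. -/
lemma carleman_bulk_lower_bound {a τ X y v q G Y h : ℝ} (ha' : a ≤ 0) (hy : 0 < y) (hY : 0 < Y)
    (hτ : 4 ≤ τ) (hX : X ≤ 25 / 64) (hh1 : 1 ≤ h ^ 2) :
    11 * τ * Y * q ^ 2 + τ * Y * G + τ ^ 3 * Y * v ^ 2 * (1 + h ^ 2)
    + 9 / 4 * τ ^ 2 * Y * v ^ 2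
    ≤ Y * (11 * τ * q ^ 2 + 2 * τ ^ 3 * h ^ 2 * (2 * (2 * (1 - a * (Y / y))) - 3 / 2) * v ^ 2
      + τ * G - 5 / 4 * τ ^ 3 * X * v ^ 2)
      + 8 * (-a) * τ * (Y ^ 2 / y) * (q - (1 - a) * v / y) ^ 2 := by
  have t1 : 0 ≤ 8 * (-a) * τ * (Y ^ 2 / y) * (q - (1 - a) * v / y) ^ 2 := by
    have : 0 ≤ -a := by linarith
    positivity
  have t2 : 0 ≤ -a * (Y / y) := mul_nonneg (by linarith) (by positivity)
  have t3 : τ ^ 2 ≤ τ ^ 3 / 4 := by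
    have := mul_le_mul_of_nonneg_left hτ (sq_nonneg τ)
    linarith [pow_succ τ 2]
  have t4 : 0 < τ ^ 3 := by positivity
  have t5 : τ ^ 3 * (1 + h ^ 2) + 9 / 4 * τ ^ 2
      ≤ 2 * τ ^ 3 * h ^ 2 * (2 * (2 * (1 - a * (Y / y))) - 3 / 2) - 5 / 4 * τ ^ 3 * X := by
    have : τ ^ 3 * (1 + h ^ 2 + 9 / 16 + 5 / 4 * X)
        ≤ τ ^ 3 * (2 * h ^ 2 * (2 * (2 * (1 - a * (Y / y))) - 3 / 2)) :=
      mul_le_mul_of_nonneg_left (by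
        have e1 := mul_nonneg (sq_nonneg h) t2
        have e2 : 2 * h ^ 2 * (2 * (2 * (1 - a * (Y / y))) - 3 / 2)
          = 5 * h ^ 2 + 8 * (h ^ 2 * (-a * (Y / y))) := by ring
        linarith) t4.le
    linarith
  have t6 := mul_le_mul_of_nonneg_left t5 (mul_nonneg hY.le (sq_nonneg v))
  linarith

/-- The Carleman identity at a point, turned into an inequality. The hypothesis `hD` is the
conjugated equation, `Hv = Δ'v + τ²|x|²v/4` and `Av`, `Aq` are the values of the antisymmetric
tangential operator. Writing `S`, `B` for the symmetric part and for the multiplier, it comes from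
inserting `carleman_identity` into `2 y^a S B ≤ y^a (S + B)² / 2`, where `S + B` is the right-hand
side of the equation up to the lower order correction of `B`; the terms subtracted after
`fluxDeriv` have zero integral over each slice. -/
lemma pointwise_carleman {a τ X y v q D Hv Av Aq G g W : ℝ} (ha' : a ≤ 0) (hy : 0 < y)
    (hy2 : y ≤ 1 / 2) (hτ : 4 ≤ τ) (hX : X ≤ 25 / 64)
    (hD : D = W + y ^ a * (2 * τ * (2 * (y - y ^ a)) * q - Hv - Av
      - (τ ^ 2 * (2 * (y - y ^ a)) ^ 2 - τ * (2 * (1 + a) - 4 * a * (y ^ a / y))) * v)) :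
    τ ^ 3 * y ^ a * v ^ 2 * (1 + (2 * (y - y ^ a)) ^ 2) + 11 * τ * y ^ a * q ^ 2 + τ * y ^ a * G
      ≤ W ^ 2 / y ^ a - fluxDeriv a τ X y (y ^ a * q) v Av G D q Aq g
        - (-2 * (y ^ a) * (q * Aq) + 2 * y ^ a * τ ^ 2 * (2 * (y - y ^ a)) ^ 2 * (v * Av)
          - 4 * τ * y ^ a * (2 * (y - y ^ a)) * (Hv * q + g - τ ^ 2 / 4 * X * (v * q))
          - 2 * τ * (2 * (1 + a) + 3 / 2 - 4 * a * (y ^ a / y)) * y ^ a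
            * (Hv * v + G - τ ^ 2 / 4 * X * v ^ 2)
          + 2 * y ^ a * (Hv * Av + τ * G + τ ^ 3 / 4 * X * v ^ 2)) := by
  have hy0 := hy.ne'
  have hY1 : 1 ≤ y ^ a := Real.one_le_rpow_of_pos_of_le_one_of_nonpos hy (by linarith) ha'
  unfold fluxDeriv
  generalize y ^ a = Y at *
  have hY : 0 < Y := by linarith
  have hY0 := hY.ne'
  set h := 2 * (y - Y) with hh
  -- `h = 2 (y - y^a) ≤ -1`, because `y ≤ 1/2` and `1 ≤ y^a`
  have hh1 : 1 ≤ h ^ 2 := by nlinarith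
  set S := D / Y + τ ^ 2 * h ^ 2 * v + Hv with hS
  set B := -2 * τ * h * q - τ * (2 * (1 + a) + 3 / 2 - 4 * a * (Y / y)) * v + Av with hB
  -- `B` is the antisymmetric part minus `3/2 τ v`. This correction turns the coefficient `-2 τ` of
  -- `|∇'v|²`, negative because `φ` is concave in `x'`, into `τ`, at the expense of `v²`.
  have hSB : S + B = W / Y - 3 / 2 * τ * v := by
    rw [hS, hB, hD]
    field_simp
    ring
  have hsq : 2 * (S * B) ≤ W ^ 2 / Y ^ 2 + 9 / 4 * τ ^ 2 * v ^ 2 := by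
    have e1 : (S + B) ^ 2 ≤ 2 * (W / Y) ^ 2 + 2 * (3 / 2 * τ * v) ^ 2 := by
      rw [hSB]
      nlinarith [sq_nonneg (W / Y + 3 / 2 * τ * v)]
    rw [div_pow] at e1
    nlinarith [sq_nonneg (S - B)]
  have hsq' : Y * (2 * (S * B)) ≤ W ^ 2 / Y + 9 / 4 * τ ^ 2 * Y * v ^ 2 := by
    calc Y * (2 * (S * B)) ≤ Y * (W ^ 2 / Y ^ 2 + 9 / 4 * τ ^ 2 * v ^ 2) :=
          mul_le_mul_of_nonneg_left hsq hY.le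
      _ = _ := by field_simp
  have bulk := carleman_bulk_lower_bound (q := q) (v := v) (G := G) ha' hy hY hτ hX hh1
  have ident := carleman_identity a τ X y v q D Hv Av Aq G g hy0 hY0
  rw [← hh, ← hS, ← hB] at ident
  linarith

end Pointwise

/-! ### Integration of fluxes -/

section Flux

variable {n : ℕ}

/-- The measure on the slab `{b < y ≤ 1/2}`, which contains the part above height `b` of the
supports of all functions considered. -/
noncomputable def slab (n : ℕ) (b : ℝ) : Measure (EuclideanSpace ℝ (Fin n) × ℝ) :=
  (volume : Measure (EuclideanSpace ℝ (Fin n))).prod (volume.restrict (Set.Ioc b (1 / 2)))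

lemma slab_eq_restrict (b : ℝ) :
    slab n b = volume.restrict (Set.univ ×ˢ Set.Ioc b (1 / 2)) := by
  rw [slab, Measure.volume_eq_prod, ← Measure.prod_restrict, Measure.restrict_univ]

lemma ae_slab_mem (b : ℝ) : ∀ᵐ q ∂slab n b, q.2 ∈ Set.Ioc b (1 / 2) := by
  rw [slab_eq_restrict]
  filter_upwards [ae_restrict_mem (MeasurableSet.univ.prod measurableSet_Ioc)] with q hq
  exact hq.2

lemma absolutelyContinuousOnInterval_of_hasDerivAt {f f' : ℝ → ℝ} {b c : ℝ}
    (hf : ∀ t ∈ Set.uIcc b c, HasDerivAt f (f' t) t) (hf' : ContinuousOn f' (Set.uIcc b c)) :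
    AbsolutelyContinuousOnInterval f b c := by
  obtain ⟨C, hC⟩ := isCompact_uIcc.exists_bound_of_continuousOn hf'
  refine LipschitzOnWith.absolutelyContinuousOnInterval (K := C.toNNReal) ?_
  refine (convex_uIcc b c).lipschitzOnWith_of_nnnorm_hasDerivWithin_le
    (fun t ht => (hf t ht).hasDerivWithinAt) fun t ht => ?_
  rw [← NNReal.coe_le_coe, coe_nnnorm]
  exact (hC t ht).trans (Real.le_coe_toNNReal C)

/-- The fundamental theorem of calculus in the normal variable, integrated over the slices. -/
lemma integral_flux_deriv {j j' : EuclideanSpace ℝ (Fin n) → ℝ → ℝ} {b : ℝ} (hb : b ≤ 1 / 2)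
    (hac : ∀ z, AbsolutelyContinuousOnInterval (j z) b (1 / 2))
    (hder : ∀ z, ∀ᵐ y, y ∈ Set.uIcc b (1 / 2) → HasDerivAt (j z) (j' z y) y)
    (hint : Integrable (fun q : EuclideanSpace ℝ (Fin n) × ℝ => j' q.1 q.2) (slab n b)) :
    ∫ q, j' q.1 q.2 ∂slab n b = ∫ z, (j z (1 / 2) - j z b) := by
  rw [slab, integral_prod _ hint]
  refine integral_congr_ae (Eventually.of_forall fun z => ?_)
  show ∫ y in Set.Ioc b (1 / 2), j' z y = j z (1 / 2) - j z b
  rw [← intervalIntegral.integral_of_le hb, ← (hac z).integral_deriv_eq_sub]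
  refine intervalIntegral.integral_congr_ae ?_
  filter_upwards [hder z] with y hy hy'
  exact (hy (Set.uIoc_subset_uIcc hy')).deriv.symm

variable {R : ℝ} {G F : EuclideanSpace ℝ (Fin n) → ℝ → ℝ} {k : ℝ → ℝ} {b : ℝ}

lemma bounded_of_continuousOn_slab (hb : 0 < b)
    (hG : ContinuousOn (fun q : EuclideanSpace ℝ (Fin n) × ℝ => G q.1 q.2) {q | 0 < q.2})
    (hG0 : ∀ z y, R < ‖z‖ → G z y = 0) :
    ∃ C, ∀ z, ∀ y ∈ Set.Icc b (1 / 2), |G z y| ≤ C := by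
  have hK : IsCompact (Metric.closedBall (0 : EuclideanSpace ℝ (Fin n)) R
      ×ˢ Set.Icc b (1 / 2)) := (isCompact_closedBall 0 R).prod isCompact_Icc
  obtain ⟨C, hC⟩ := hK.exists_bound_of_continuousOn
    (hG.mono fun q hq => hb.trans_le hq.2.1)
  refine ⟨max C 0, fun z y hy => ?_⟩
  by_cases hz : R < ‖z‖
  · simp [hG0 z y hz]
  · exact (hC (z, y) ⟨by simpa using hz, hy⟩).trans (le_max_left _ _)

lemma aestronglyMeasurable_slab (hb : 0 < b)
    (hG : ContinuousOn (fun q : EuclideanSpace ℝ (Fin n) × ℝ => G q.1 q.2) {q | 0 < q.2}) :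
    AEStronglyMeasurable (fun q : EuclideanSpace ℝ (Fin n) × ℝ => G q.1 q.2) (slab n b) := by
  rw [slab_eq_restrict]
  exact (hG.mono fun q hq => hb.trans hq.2.1).aestronglyMeasurable
    (MeasurableSet.univ.prod measurableSet_Ioc)

/-- The product of a function continuous in the open half-space with a function dominated by an
integrable function of the height is integrable on slabs, if its support is bounded. -/
lemma integrable_slab_mul (hb : 0 < b)
    (hG : ContinuousOn (fun q : EuclideanSpace ℝ (Fin n) × ℝ => G q.1 q.2) {q | 0 < q.2})
    (hG0 : ∀ z y, R < ‖z‖ → G z y = 0)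
    (hF : Measurable fun q : EuclideanSpace ℝ (Fin n) × ℝ => F q.1 q.2)
    (hk : IntegrableOn k (Set.Ioc b (1 / 2)))
    (hFk : ∀ z, ∀ y ∈ Set.Ioc b (1 / 2), |F z y| ≤ k y) :
    Integrable (fun q : EuclideanSpace ℝ (Fin n) × ℝ => G q.1 q.2 * F q.1 q.2) (slab n b) := by
  obtain ⟨C, hC⟩ := bounded_of_continuousOn_slab hb hG hG0
  have hdom : Integrable (fun q : EuclideanSpace ℝ (Fin n) × ℝ =>
      (Metric.closedBall (0 : EuclideanSpace ℝ (Fin n)) R).indicator (fun _ => C) q.1 * k q.2)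
      (slab n b) := by
    refine Integrable.mul_prod ?_ hk
    exact (integrable_indicator_iff measurableSet_closedBall).2
      (integrableOn_const measure_closedBall_lt_top.ne)
  refine hdom.mono' ((aestronglyMeasurable_slab hb hG).mul hF.aestronglyMeasurable) ?_
  filter_upwards [ae_slab_mem b] with q hq
  rw [norm_mul, Real.norm_eq_abs, Real.norm_eq_abs]
  by_cases hz : R < ‖q.1‖
  · rw [hG0 _ _ hz, abs_zero, zero_mul]
    simp [hz]
  · rw [Set.indicator_of_mem (by simpa using hz)]
    exact mul_le_mul (hC _ _ (Set.Ioc_subset_Icc_self hq)) (hFk _ _ hq) (abs_nonneg _)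
      ((abs_nonneg _).trans (hC q.1 _ (Set.Ioc_subset_Icc_self hq)))

lemma integrable_slab (hb : 0 < b)
    (hG : ContinuousOn (fun q : EuclideanSpace ℝ (Fin n) × ℝ => G q.1 q.2) {q | 0 < q.2})
    (hG0 : ∀ z y, R < ‖z‖ → G z y = 0) :
    Integrable (fun q : EuclideanSpace ℝ (Fin n) × ℝ => G q.1 q.2) (slab n b) := by
  simpa using integrable_slab_mul (F := fun _ _ => 1) (k := fun _ => 1) hb hG hG0
    measurable_const (integrableOn_const (by simp)) (by simp)

end Flux

/-! ### Solutions that are smooth in the tangential variables -/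

/-- A solution of `∂_y p + y^a Δ'u = F`, `p = y^a ∂_y u`, `u(·, 0) = 0` in `ℝⁿ × (0, ∞)` that is
smooth in the tangential variables and supported in `{|z| ≤ 5/8, y ≤ 1/2}`. All functions but the
right-hand side `F` are continuous up to the boundary, the conormal derivative `p` is absolutely
continuous in `y`, and `F` is dominated by a function `k` of the height alone. -/
structure IsTangentiallySmooth {n : ℕ} (a : ℝ) (u p F : EuclideanSpace ℝ (Fin n) → ℝ → ℝ)
    (k : ℝ → ℝ) : Prop where
  contDiff_u : ∀ y, ContDiff ℝ 2 fun z => u z y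
  contDiff_p : ∀ y, ContDiff ℝ 2 fun z => p z y
  u_eq_zero : ∀ z y, 5 / 8 < ‖z‖ → u z y = 0
  p_eq_zero : ∀ z y, 5 / 8 < ‖z‖ → p z y = 0
  F_eq_zero : ∀ z y, 5 / 8 < ‖z‖ → F z y = 0
  u_eq_zero_of_le : ∀ z y, 1 / 2 ≤ y → u z y = 0
  p_eq_zero_of_le : ∀ z y, 1 / 2 ≤ y → p z y = 0
  u_zero : ∀ z, u z 0 = 0
  continuous_u : Continuous fun q : EuclideanSpace ℝ (Fin n) × ℝ => u q.1 q.2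
  continuous_pd_u : ∀ i, Continuous fun q : EuclideanSpace ℝ (Fin n) × ℝ =>
    pd i (fun z => u z q.2) q.1
  continuous_lap_u : Continuous fun q : EuclideanSpace ℝ (Fin n) × ℝ =>
    lap (fun z => u z q.2) q.1
  continuous_p : Continuous fun q : EuclideanSpace ℝ (Fin n) × ℝ => p q.1 q.2
  continuous_pd_p : ∀ i, Continuous fun q : EuclideanSpace ℝ (Fin n) × ℝ =>
    pd i (fun z => p z q.2) q.1
  continuous_lap_p : Continuous fun q : EuclideanSpace ℝ (Fin n) × ℝ =>
    lap (fun z => p z q.2) q.1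
  hasDerivAt_u : ∀ z y, 0 < y → HasDerivAt (u z) (p z y / y ^ a) y
  hasDerivAt_pd_u : ∀ i z y, 0 < y →
    HasDerivAt (fun t => pd i (fun z => u z t) z) (pd i (fun z => p z y) z / y ^ a) y
  hasDerivAt_lap_u : ∀ z y, 0 < y →
    HasDerivAt (fun t => lap (fun z => u z t) z) (lap (fun z => p z y) z / y ^ a) y
  measurable_F : Measurable fun q : EuclideanSpace ℝ (Fin n) × ℝ => F q.1 q.2
  abs_F_le : ∀ z, ∀ y ∈ Set.Ioc (0 : ℝ) (1 / 2), |F z y| ≤ k y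
  integrableOn_k : IntegrableOn k (Set.Ioc 0 (1 / 2))
  integrableOn_sq_k : IntegrableOn (fun y => k y ^ 2 / y ^ a) (Set.Ioc 0 (1 / 2))
  p_sub : ∀ z, ∃ h : ℝ → ℝ, Integrable h ∧ (∀ b c, p z c - p z b = ∫ t in b..c, h t) ∧
    ∀ᵐ t, 0 < t → h t = F z t - t ^ a * lap (fun z => u z t) z

namespace IsTangentiallySmooth

variable {n : ℕ} {a : ℝ} {u p F : EuclideanSpace ℝ (Fin n) → ℝ → ℝ} {k : ℝ → ℝ}

lemma ae_hasDerivAt_p (h : IsTangentiallySmooth a u p F k) (z : EuclideanSpace ℝ (Fin n)) :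
    ∀ᵐ y, 0 < y → HasDerivAt (p z) (F z y - y ^ a * lap (fun z => u z y) z) y := by
  obtain ⟨g, hg, hpg, hg'⟩ := h.p_sub z
  filter_upwards [hg', LocallyIntegrable.ae_hasDerivAt_integral hg.locallyIntegrable]
    with y hy hy' hy0
  rw [← hy hy0]
  have : p z = fun t => p z 0 + ∫ s in (0 : ℝ)..t, g s := by
    funext t
    rw [← hpg]
    ring
  rw [this]
  exact (hy' 0).const_add _

lemma absolutelyContinuousOnInterval_p (h : IsTangentiallySmooth a u p F k)
    (z : EuclideanSpace ℝ (Fin n)) (b c : ℝ) : AbsolutelyContinuousOnInterval (p z) b c := by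
  obtain ⟨g, hg, hpg, -⟩ := h.p_sub z
  have : p z = fun t => p z b + ∫ s in b..t, g s := by
    funext t
    rw [← hpg]
    ring
  rw [this]
  have h1 : AbsolutelyContinuousOnInterval (fun _ : ℝ => p z b) b c :=
    contDiffOn_const.absolutelyContinuousOnInterval
  exact h1.fun_add
    (hg.intervalIntegrable.absolutelyContinuousOnInterval_intervalIntegral Set.left_mem_uIcc)

end IsTangentiallySmooth

/-! ### Conjugation with the Carleman weight -/

section Conjugation

variable {n : ℕ}

/-- The exponential `e^{τφ}` of the Carleman weight. -/
noncomputable def expWeight (τ s : ℝ) (z : EuclideanSpace ℝ (Fin n)) (y : ℝ) : ℝ :=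
  Real.exp (τ * weight s (z, y))

/-- The conjugated function `v = e^{τφ} u`. -/
noncomputable def conj (τ s : ℝ) (u : EuclideanSpace ℝ (Fin n) → ℝ → ℝ)
    (z : EuclideanSpace ℝ (Fin n)) (y : ℝ) : ℝ :=
  expWeight τ s z y * u z y

/-- The normal derivative of `conj τ s u`, where `p = y^{1-2s} ∂_y u`. -/
noncomputable def conjDeriv (τ s : ℝ) (u p : EuclideanSpace ℝ (Fin n) → ℝ → ℝ)
    (z : EuclideanSpace ℝ (Fin n)) (y : ℝ) : ℝ :=
  expWeight τ s z y * (p z y / y ^ (1 - 2 * s) + τ * (2 * (y - y ^ (1 - 2 * s))) * u z y)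

variable {τ s : ℝ} {u p F : EuclideanSpace ℝ (Fin n) → ℝ → ℝ} {k : ℝ → ℝ}

lemma expWeight_pos (z : EuclideanSpace ℝ (Fin n)) (y : ℝ) : 0 < expWeight τ s z y :=
  Real.exp_pos _

lemma continuous_expWeight (hs : s < 1) :
    Continuous fun q : EuclideanSpace ℝ (Fin n) × ℝ => expWeight τ s q.1 q.2 := by
  have : Continuous fun q : EuclideanSpace ℝ (Fin n) × ℝ => q.2 ^ (2 - 2 * s) :=
    continuous_snd.rpow_const fun _ => Or.inr (by linarith)
  unfold expWeight weight
  fun_prop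

lemma contDiff_expWeight (y : ℝ) :
    ContDiff ℝ 2 fun z : EuclideanSpace ℝ (Fin n) => expWeight τ s z y := by
  have : ContDiff ℝ 2 fun z : EuclideanSpace ℝ (Fin n) => ‖z‖ ^ 2 := contDiff_norm_sq ℝ
  exact (contDiff_const.mul ((this.div_const 4).neg.add
    (contDiff_const (c := 2 * (-(1 / (2 - 2 * s)) * y ^ (2 - 2 * s) + 1 / 2 * y ^ 2))))).exp

lemma pd_expWeight (i : Fin n) (z : EuclideanSpace ℝ (Fin n)) (y : ℝ) :
    pd i (fun z => expWeight τ s z y) z = -(τ / 2 * z i) * expWeight τ s z y := by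
  have h := (hasStrictFDerivAt_norm_sq z).hasFDerivAt
  have h1 := (((h.const_mul (-(1 / 4) : ℝ)).add_const
    (2 * (-(1 / (2 - 2 * s)) * y ^ (2 - 2 * s) + 1 / 2 * y ^ 2))).const_mul τ).exp
  have e : (fun z : EuclideanSpace ℝ (Fin n) => expWeight τ s z y) = fun z =>
      Real.exp (τ * (-(1 / 4) * ‖z‖ ^ 2
        + 2 * (-(1 / (2 - 2 * s)) * y ^ (2 - 2 * s) + 1 / 2 * y ^ 2))) := by
    funext x
    simp only [expWeight, weight]
    ring_nf
  rw [congrFun e z, pd, e, h1.fderiv]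
  simp [PiLp.inner_apply]
  ring

lemma hasDerivAt_expWeight (hs : s < 1) (z : EuclideanSpace ℝ (Fin n)) {y : ℝ} (hy : 0 < y) :
    HasDerivAt (expWeight τ s z) (τ * (2 * (y - y ^ (1 - 2 * s))) * expWeight τ s z y) y := by
  have h1 : HasDerivAt (fun t : ℝ => t ^ (2 - 2 * s)) ((2 - 2 * s) * y ^ (1 - 2 * s)) y := by
    have := Real.hasDerivAt_rpow_const (x := y) (p := 2 - 2 * s) (Or.inl hy.ne')
    rwa [show 2 - 2 * s - 1 = 1 - 2 * s by ring] at this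
  have h2 := ((((h1.const_mul (-(1 / (2 - 2 * s)))).fun_add
    ((hasDerivAt_pow 2 y).const_mul (1 / 2))).const_mul 2).const_add (-(‖z‖ ^ 2 / 4))).const_mul τ
  have h3 := h2.exp
  refine h3.congr_deriv ?_
  have : 2 - 2 * s ≠ 0 := by linarith
  have e : -(1 / (2 - 2 * s)) * ((2 - 2 * s) * y ^ (1 - 2 * s)) = -y ^ (1 - 2 * s) := by
    rw [← mul_assoc, neg_mul, one_div_mul_cancel this, neg_one_mul]
  rw [e]
  simp only [expWeight, weight]
  norm_num
  ring

namespace IsTangentiallySmooth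

variable (h : IsTangentiallySmooth (1 - 2 * s) u p F k)
include h

lemma contDiff_conj (y : ℝ) : ContDiff ℝ 2 fun z => conj τ s u z y :=
  (contDiff_expWeight y).mul (h.contDiff_u y)

lemma contDiff_conjDeriv (y : ℝ) : ContDiff ℝ 2 fun z => conjDeriv τ s u p z y := by
  have := h.contDiff_u y
  have := h.contDiff_p y
  have := contDiff_expWeight (n := n) (τ := τ) (s := s) y
  unfold conjDeriv
  fun_prop

lemma conj_eq_zero (z : EuclideanSpace ℝ (Fin n)) (y : ℝ) (hz : 5 / 8 < ‖z‖) :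
    conj τ s u z y = 0 := by
  simp [conj, h.u_eq_zero z y hz]

lemma conjDeriv_eq_zero (z : EuclideanSpace ℝ (Fin n)) (y : ℝ) (hz : 5 / 8 < ‖z‖) :
    conjDeriv τ s u p z y = 0 := by
  simp [conjDeriv, h.u_eq_zero z y hz, h.p_eq_zero z y hz]

lemma pd_conj (i : Fin n) (z : EuclideanSpace ℝ (Fin n)) (y : ℝ) :
    pd i (fun z => conj τ s u z y) z
      = expWeight τ s z y * (pd i (fun z => u z y) z - τ / 2 * z i * u z y) := by
  unfold conj
  rw [pd_mul ((contDiff_expWeight y).differentiable two_ne_zero).differentiableAt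
    ((h.contDiff_u y).differentiable two_ne_zero).differentiableAt, pd_expWeight]
  ring

lemma pd_conjDeriv (i : Fin n) (z : EuclideanSpace ℝ (Fin n)) (y : ℝ) :
    pd i (fun z => conjDeriv τ s u p z y) z
      = expWeight τ s z y * (pd i (fun z => p z y) z / y ^ (1 - 2 * s)
        + τ * (2 * (y - y ^ (1 - 2 * s))) * pd i (fun z => u z y) z)
        - τ / 2 * z i * conjDeriv τ s u p z y := by
  have du : DifferentiableAt ℝ (fun z => u z y) z :=
    ((h.contDiff_u y).differentiable two_ne_zero).differentiableAt
  have dp : DifferentiableAt ℝ (fun z => p z y) z :=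
    ((h.contDiff_p y).differentiable two_ne_zero).differentiableAt
  unfold conjDeriv
  simp only [div_eq_inv_mul]
  rw [pd_mul ((contDiff_expWeight y).differentiable two_ne_zero).differentiableAt
    (by fun_prop), pd_expWeight, pd_add (by fun_prop) (by fun_prop), pd_const_mul dp,
    pd_const_mul du]
  ring

/-- The tangential Laplacian after conjugation, split into its symmetric and antisymmetric
parts. -/
lemma expWeight_mul_lap (z : EuclideanSpace ℝ (Fin n)) (y : ℝ) :
    expWeight τ s z y * lap (fun z => u z y) z
      = (lap (fun z => conj τ s u z y) z + τ ^ 2 / 4 * ‖z‖ ^ 2 * conj τ s u z y)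
        + τ * (rad (fun z => conj τ s u z y) z + n / 2 * conj τ s u z y) := by
  have du : ∀ z, DifferentiableAt ℝ (fun z => u z y) z := fun z =>
    ((h.contDiff_u y).differentiable two_ne_zero).differentiableAt
  have dpu : ∀ i z, DifferentiableAt ℝ (pd i fun z => u z y) z := fun i z =>
    ((contDiff_pd_one (h.contDiff_u y) i).differentiable one_ne_zero).differentiableAt
  have dE : DifferentiableAt ℝ (fun z => expWeight τ s z y) z :=
    ((contDiff_expWeight y).differentiable two_ne_zero).differentiableAt
  have e : ∀ i, pd i (pd i fun z => conj τ s u z y) z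
      = expWeight τ s z y * pd i (pd i fun z => u z y) z
        - τ * (z i * pd i (fun z => conj τ s u z y) z) - τ / 2 * conj τ s u z y
        - τ ^ 2 / 4 * conj τ s u z y * z i ^ 2 := by
    intro i
    have e1 : pd i (fun z => conj τ s u z y) = fun z =>
        expWeight τ s z y * (pd i (fun z => u z y) z + (-(τ / 2)) * (z i * u z y)) := by
      funext w
      rw [h.pd_conj]
      ring
    have d1 : DifferentiableAt ℝ (fun z : EuclideanSpace ℝ (Fin n) => z i * u z y) z :=
      DifferentiableAt.fun_mul (by fun_prop) (du z)
    rw [e1, pd_mul dE ((dpu i z).fun_add (d1.const_mul _)), pd_add (dpu i z) (d1.const_mul _),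
      pd_const_mul d1, pd_mul (f := fun z : EuclideanSpace ℝ (Fin n) => z i) (by fun_prop) (du z),
      pd_coord, pd_expWeight]
    simp only [if_true, conj]
    ring
  have e2 : lap (fun z => conj τ s u z y) z = expWeight τ s z y * lap (fun z => u z y) z
      - τ * rad (fun z => conj τ s u z y) z - n * (τ / 2 * conj τ s u z y)
      - τ ^ 2 / 4 * conj τ s u z y * ‖z‖ ^ 2 := by
    rw [EuclideanSpace.real_norm_sq_eq]
    simp only [lap, rad, e, Finset.sum_sub_distrib, Finset.mul_sum]
    simp
  rw [e2]
  ring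

lemma hasDerivAt_conj (hs : s < 1) (z : EuclideanSpace ℝ (Fin n)) {y : ℝ} (hy : 0 < y) :
    HasDerivAt (conj τ s u z) (conjDeriv τ s u p z y) y := by
  refine ((hasDerivAt_expWeight hs z hy).fun_mul (h.hasDerivAt_u z y hy)).congr_deriv ?_
  unfold conjDeriv
  ring

lemma hasDerivAt_pd_conj (hs : s < 1) (i : Fin n) (z : EuclideanSpace ℝ (Fin n)) {y : ℝ}
    (hy : 0 < y) : HasDerivAt (fun t => pd i (fun z => conj τ s u z t) z)
      (pd i (fun z => conjDeriv τ s u p z y) z) y := by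
  simp only [h.pd_conj, h.pd_conjDeriv]
  refine ((hasDerivAt_expWeight hs z hy).fun_mul ((h.hasDerivAt_pd_u i z y hy).fun_sub
    ((h.hasDerivAt_u z y hy).const_mul (τ / 2 * z i)))).congr_deriv ?_
  unfold conjDeriv
  ring

lemma hasDerivAt_rad_conj (hs : s < 1) (z : EuclideanSpace ℝ (Fin n)) {y : ℝ} (hy : 0 < y) :
    HasDerivAt (fun t => rad (fun z => conj τ s u z t) z)
      (rad (fun z => conjDeriv τ s u p z y) z) y :=
  HasDerivAt.fun_sum fun i _ => (h.hasDerivAt_pd_conj hs i z hy).const_mul (z i)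

lemma hasDerivAt_grad_sq_conj (hs : s < 1) (z : EuclideanSpace ℝ (Fin n)) {y : ℝ} (hy : 0 < y) :
    HasDerivAt (fun t => ∑ i, pd i (fun z => conj τ s u z t) z ^ 2)
      (2 * ∑ i, pd i (fun z => conj τ s u z y) z * pd i (fun z => conjDeriv τ s u p z y) z) y := by
  have := HasDerivAt.fun_sum (u := Finset.univ) fun i _ =>
    (h.hasDerivAt_pd_conj (τ := τ) hs i z hy).fun_pow 2
  refine this.congr_deriv ?_
  rw [Finset.mul_sum]
  exact Finset.sum_congr rfl fun i _ => by
    norm_num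
    ring

/-- The conjugated equation, for the conormal derivative `y^{1-2s} ∂_y v`. -/
lemma ae_hasDerivAt_conormal (hs : s < 1) (z : EuclideanSpace ℝ (Fin n)) :
    ∀ᵐ y, 0 < y → HasDerivAt (fun t => t ^ (1 - 2 * s) * conjDeriv τ s u p z t)
      (expWeight τ s z y * F z y + y ^ (1 - 2 * s) * (2 * τ * (2 * (y - y ^ (1 - 2 * s)))
        * conjDeriv τ s u p z y
        - (lap (fun z => conj τ s u z y) z + τ ^ 2 / 4 * ‖z‖ ^ 2 * conj τ s u z y)
        - τ * (rad (fun z => conj τ s u z y) z + n / 2 * conj τ s u z y)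
        - (τ ^ 2 * (2 * (y - y ^ (1 - 2 * s))) ^ 2
          - τ * (2 * (1 + (1 - 2 * s)) - 4 * (1 - 2 * s) * (y ^ (1 - 2 * s) / y)))
          * conj τ s u z y)) y := by
  filter_upwards [h.ae_hasDerivAt_p z] with y hpy hy
  have hY := hasDerivAt_rpow_left (a := 1 - 2 * s) hy
  have hE := hasDerivAt_expWeight (τ := τ) hs z hy
  have hu := h.hasDerivAt_u z y hy
  have hY0 : y ^ (1 - 2 * s) ≠ 0 := (Real.rpow_pos_of_pos hy _).ne'
  have h1 := hE.fun_mul ((hpy hy).fun_add (((hY.fun_mul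
    (((hasDerivAt_id y).fun_sub hY).const_mul 2)).const_mul τ).fun_mul hu))
  have h2 : (fun t => t ^ (1 - 2 * s) * conjDeriv τ s u p z t) =ᶠ[𝓝 y] fun t =>
      expWeight τ s z t * (p z t + τ * (t ^ (1 - 2 * s) * (2 * (id t - t ^ (1 - 2 * s))))
        * u z t) := by
    filter_upwards [lt_mem_nhds hy] with t ht
    have : t ^ (1 - 2 * s) ≠ 0 := (Real.rpow_pos_of_pos ht _).ne'
    simp only [conjDeriv, id]
    field_simp
  refine (h1.congr_of_eventuallyEq h2).congr_deriv ?_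
  have e := h.expWeight_mul_lap (τ := τ) z y
  have e3 : lap (fun z => conj τ s u z y) z + τ ^ 2 / 4 * ‖z‖ ^ 2 * conj τ s u z y
      = expWeight τ s z y * lap (fun z => u z y) z
        - τ * (rad (fun z => conj τ s u z y) z + n / 2 * conj τ s u z y) := by
    linarith
  rw [e3]
  generalize rad (fun z => conj τ s u z y) z = r
  simp only [conj, conjDeriv, id]
  generalize lap (fun z => u z y) z = l
  generalize y ^ (1 - 2 * s) = Y at hY0
  generalize 1 - 2 * s = a
  have := hy.ne'
  field_simp
  ring

end IsTangentiallySmooth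

end Conjugation

/-! ### The Carleman inequality on slabs -/

section CarlemanSlab

/-- The terms of the pointwise Carleman inequality whose integral over each slice vanishes. -/
noncomputable def sliceNull {n : ℕ} (a τ y : ℝ) (v q : EuclideanSpace ℝ (Fin n) → ℝ)
    (z : EuclideanSpace ℝ (Fin n)) : ℝ :=
  -2 * (y ^ a) * (q z * (τ * (rad q z + n / 2 * q z)))
    + 2 * y ^ a * τ ^ 2 * (2 * (y - y ^ a)) ^ 2 * (v z * (τ * (rad v z + n / 2 * v z)))
    - 4 * τ * y ^ a * (2 * (y - y ^ a)) * ((lap v z + τ ^ 2 / 4 * ‖z‖ ^ 2 * v z) * q z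
      + ∑ i, pd i v z * pd i q z - τ ^ 2 / 4 * ‖z‖ ^ 2 * (v z * q z))
    - 2 * τ * (2 * (1 + a) + 3 / 2 - 4 * a * (y ^ a / y)) * y ^ a
      * ((lap v z + τ ^ 2 / 4 * ‖z‖ ^ 2 * v z) * v z + ∑ i, pd i v z ^ 2
        - τ ^ 2 / 4 * ‖z‖ ^ 2 * v z ^ 2)
    + 2 * y ^ a * ((lap v z + τ ^ 2 / 4 * ‖z‖ ^ 2 * v z) * (τ * (rad v z + n / 2 * v z))
      + τ * ∑ i, pd i v z ^ 2 + τ ^ 3 / 4 * ‖z‖ ^ 2 * v z ^ 2)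

lemma integral_sliceNull {n : ℕ} {R : ℝ} (a τ y : ℝ) {v q : EuclideanSpace ℝ (Fin n) → ℝ}
    (hv : ContDiff ℝ 2 v) (hq : ContDiff ℝ 2 q) (hv0 : ∀ z, R < ‖z‖ → v z = 0)
    (hq0 : ∀ z, R < ‖z‖ → q z = 0) : ∫ z, sliceNull a τ y v q z = 0 := by
  have hv1 : ContDiff ℝ 1 v := hv.of_le (by norm_num)
  have hq1 : ContDiff ℝ 1 q := hq.of_le (by norm_num)
  have cv := hv.continuous
  have cq := hq.continuous
  have cpv := fun i => continuous_pd hv1 i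
  have cpq := fun i => continuous_pd hq1 i
  have cl := continuous_lap hv
  have cr := continuous_rad hv1
  have crq := continuous_rad hq1
  have e1 := integral_mul_rad hq1 hq0
  have e2 := integral_mul_rad hv1 hv0
  have e3 := integral_lap_mul hv hq1 hq0
  have e4 := integral_lap_mul hv hv1 hv0
  have e5 := integral_lap_mul_rad hv hv0 (τ ^ 2 / 4)
  have I1 : Integrable fun z => q z * (rad q z + n / 2 * q z) :=
    integrable_of_continuous_of_eq_zero (R := R) (by fun_prop) fun z hz => by simp [hq0 z hz]
  have I2 : Integrable fun z => v z * (rad v z + n / 2 * v z) :=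
    integrable_of_continuous_of_eq_zero (R := R) (by fun_prop) fun z hz => by simp [hv0 z hz]
  have I3 : Integrable fun z => lap v z * q z + ∑ i, pd i v z * pd i q z :=
    integrable_of_continuous_of_eq_zero (R := R) (by fun_prop) fun z hz => by
      simp [hq0 z hz, pd_eq_zero_of_eq_zero hv0 _ hz]
  have I4 : Integrable fun z => lap v z * v z + ∑ i, pd i v z * pd i v z :=
    integrable_of_continuous_of_eq_zero (R := R) (by fun_prop) fun z hz => by
      simp [hv0 z hz, pd_eq_zero_of_eq_zero hv0 _ hz]
  have I5 : Integrable fun z => (lap v z + τ ^ 2 / 4 * ‖z‖ ^ 2 * v z) * (rad v z + n / 2 * v z)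
      + ∑ i, pd i v z ^ 2 + τ ^ 2 / 4 * ‖z‖ ^ 2 * v z ^ 2 :=
    integrable_of_continuous_of_eq_zero (R := R) (by fun_prop) fun z hz => by
      simp [hv0 z hz, pd_eq_zero_of_eq_zero hv0 _ hz, rad_eq_zero_of_eq_zero hv0 hz]
  have key : ∀ z, sliceNull a τ y v q z
      = ((-2 * y ^ a * τ) * (q z * (rad q z + n / 2 * q z))
        + (2 * y ^ a * τ ^ 3 * (2 * (y - y ^ a)) ^ 2) * (v z * (rad v z + n / 2 * v z)))
        + (((-4 * τ * y ^ a * (2 * (y - y ^ a))) * (lap v z * q z + ∑ i, pd i v z * pd i q z)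
          + (-2 * τ * (2 * (1 + a) + 3 / 2 - 4 * a * (y ^ a / y)) * y ^ a)
            * (lap v z * v z + ∑ i, pd i v z * pd i v z))
        + (2 * y ^ a * τ) * ((lap v z + τ ^ 2 / 4 * ‖z‖ ^ 2 * v z) * (rad v z + n / 2 * v z)
          + ∑ i, pd i v z ^ 2 + τ ^ 2 / 4 * ‖z‖ ^ 2 * v z ^ 2)) := by
    intro z
    simp only [← pow_two]
    unfold sliceNull
    ring
  simp only [key]
  rw [integral_add ((I1.const_mul _).fun_add (I2.const_mul _))
      (((I3.const_mul _).fun_add (I4.const_mul _)).fun_add (I5.const_mul _)),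
    integral_add (I1.const_mul _) (I2.const_mul _),
    integral_add ((I3.const_mul _).fun_add (I4.const_mul _)) (I5.const_mul _),
    integral_add (I3.const_mul _) (I4.const_mul _)]
  simp only [integral_const_mul]
  rw [e1, e2, e3, e4, e5]
  simp

lemma continuousOn_fluxDeriv {α : Type*} [TopologicalSpace α] {S : Set α} {a τ : ℝ}
    {X y Q v A G D q B g : α → ℝ} (hy : ∀ x ∈ S, 0 < y x)
    (hX : ContinuousOn X S) (hyc : ContinuousOn y S) (hQ : ContinuousOn Q S)
    (hv : ContinuousOn v S) (hA : ContinuousOn A S) (hG : ContinuousOn G S)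
    (hD : ContinuousOn D S) (hq : ContinuousOn q S) (hB : ContinuousOn B S)
    (hg : ContinuousOn g S) :
    ContinuousOn (fun x => fluxDeriv a τ (X x) (y x) (Q x) (v x) (A x) (G x) (D x) (q x) (B x)
      (g x)) S := by
  have h1 : ∀ x ∈ S, y x ≠ 0 := fun x hx => (hy x hx).ne'
  have h2 : ∀ x ∈ S, y x ^ a ≠ 0 := fun x hx => (Real.rpow_pos_of_pos (hy x hx) a).ne'
  have h3 : ∀ x ∈ S, y x ^ 2 ≠ 0 := fun x hx => pow_ne_zero 2 (h1 x hx)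
  have h4 : ContinuousOn (fun x => y x ^ a) S := hyc.rpow_const fun x hx => Or.inl (h1 x hx)
  have h5 : ContinuousOn (fun x => y x ^ a / y x) S := h4.div hyc h1
  have h6 : ContinuousOn (fun x => y x / y x ^ a) S := hyc.div h4 h2
  have h7 : ContinuousOn (fun x => y x ^ a / y x ^ 2) S := h4.div (hyc.pow 2) h3
  have h8 : ContinuousOn (fun x => (1 - a) / y x ^ a) S := continuousOn_const.div h4 h2
  obtain ⟨f4, e4⟩ : ∃ f : α → ℝ, ∀ x, y x ^ a = f x := ⟨_, fun _ => rfl⟩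
  obtain ⟨f5, e5⟩ : ∃ f : α → ℝ, ∀ x, f4 x / y x = f x := ⟨_, fun _ => rfl⟩
  obtain ⟨f6, e6⟩ : ∃ f : α → ℝ, ∀ x, y x / f4 x = f x := ⟨_, fun _ => rfl⟩
  obtain ⟨f7, e7⟩ : ∃ f : α → ℝ, ∀ x, f4 x / y x ^ 2 = f x := ⟨_, fun _ => rfl⟩
  obtain ⟨f8, e8⟩ : ∃ f : α → ℝ, ∀ x, (1 - a) / f4 x = f x := ⟨_, fun _ => rfl⟩
  unfold fluxDeriv
  simp only [e4, e5, e6, e7, e8] at h4 h5 h6 h7 h8 ⊢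
  fun_prop

namespace IsTangentiallySmooth

variable {n : ℕ} {τ s b : ℝ} {u p F : EuclideanSpace ℝ (Fin n) → ℝ → ℝ} {k : ℝ → ℝ}

lemma continuousOn_rpow_snd (a : ℝ) :
    ContinuousOn (fun q : EuclideanSpace ℝ (Fin n) × ℝ => q.2 ^ a) {q | 0 < q.2} :=
  continuousOn_snd.rpow_const fun _ hq => Or.inl (ne_of_gt hq)

lemma rpow_snd_ne_zero (a : ℝ) :
    ∀ q ∈ {q : EuclideanSpace ℝ (Fin n) × ℝ | 0 < q.2}, q.2 ^ a ≠ 0 :=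
  fun _ hq => (Real.rpow_pos_of_pos hq a).ne'

lemma continuous_conj (h : IsTangentiallySmooth (1 - 2 * s) u p F k) (hs : s < 1) :
    Continuous fun q : EuclideanSpace ℝ (Fin n) × ℝ => conj τ s u q.1 q.2 :=
  (continuous_expWeight hs).mul h.continuous_u

lemma continuousOn_conjDeriv (h : IsTangentiallySmooth (1 - 2 * s) u p F k) (hs : s < 1) :
    ContinuousOn (fun q : EuclideanSpace ℝ (Fin n) × ℝ => conjDeriv τ s u p q.1 q.2)
      {q | 0 < q.2} :=
  (continuous_expWeight hs).continuousOn.mul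
    ((h.continuous_p.continuousOn.div (continuousOn_rpow_snd _) (rpow_snd_ne_zero _)).add
      ((continuousOn_const.mul (continuousOn_const.mul
        (continuousOn_snd.sub (continuousOn_rpow_snd _)))).mul h.continuous_u.continuousOn))

lemma continuous_coord_fst (i : Fin n) :
    Continuous fun q : EuclideanSpace ℝ (Fin n) × ℝ => q.1 i := by
  fun_prop

lemma continuous_pd_conj (h : IsTangentiallySmooth (1 - 2 * s) u p F k) (hs : s < 1)
    (i : Fin n) : Continuous fun q : EuclideanSpace ℝ (Fin n) × ℝ =>
      pd i (fun z => conj τ s u z q.2) q.1 := by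
  simp only [h.pd_conj]
  exact (continuous_expWeight hs).mul ((h.continuous_pd_u i).sub
    ((continuous_const.mul (continuous_coord_fst i)).mul h.continuous_u))

lemma continuousOn_pd_conjDeriv (h : IsTangentiallySmooth (1 - 2 * s) u p F k) (hs : s < 1)
    (i : Fin n) : ContinuousOn (fun q : EuclideanSpace ℝ (Fin n) × ℝ =>
      pd i (fun z => conjDeriv τ s u p z q.2) q.1) {q | 0 < q.2} := by
  simp only [h.pd_conjDeriv]
  exact ((continuous_expWeight hs).continuousOn.mul
    (((h.continuous_pd_p i).continuousOn.div (continuousOn_rpow_snd _) (rpow_snd_ne_zero _)).add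
      ((continuousOn_const.mul (continuousOn_const.mul
        (continuousOn_snd.sub (continuousOn_rpow_snd _)))).mul
        (h.continuous_pd_u i).continuousOn))).sub
    ((continuousOn_const.mul (continuous_coord_fst i).continuousOn).mul
      (h.continuousOn_conjDeriv hs))

lemma continuous_rad_conj (h : IsTangentiallySmooth (1 - 2 * s) u p F k) (hs : s < 1) :
    Continuous fun q : EuclideanSpace ℝ (Fin n) × ℝ => rad (fun z => conj τ s u z q.2) q.1 :=
  continuous_finsetSum _ fun i _ => (continuous_coord_fst i).mul (h.continuous_pd_conj hs i)

lemma continuousOn_rad_conjDeriv (h : IsTangentiallySmooth (1 - 2 * s) u p F k) (hs : s < 1) :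
    ContinuousOn (fun q : EuclideanSpace ℝ (Fin n) × ℝ =>
      rad (fun z => conjDeriv τ s u p z q.2) q.1) {q | 0 < q.2} :=
  continuousOn_finsetSum _ fun i _ =>
    (continuous_coord_fst i).continuousOn.mul (h.continuousOn_pd_conjDeriv hs i)

lemma continuous_lap_conj (h : IsTangentiallySmooth (1 - 2 * s) u p F k) (hs : s < 1) :
    Continuous fun q : EuclideanSpace ℝ (Fin n) × ℝ => lap (fun z => conj τ s u z q.2) q.1 := by
  have e : ∀ q : EuclideanSpace ℝ (Fin n) × ℝ, lap (fun z => conj τ s u z q.2) q.1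
      = expWeight τ s q.1 q.2 * lap (fun z => u z q.2) q.1
        - τ ^ 2 / 4 * ‖q.1‖ ^ 2 * conj τ s u q.1 q.2
        - τ * (rad (fun z => conj τ s u z q.2) q.1 + n / 2 * conj τ s u q.1 q.2) := fun q => by
    rw [h.expWeight_mul_lap]
    ring
  simp only [e]
  have := h.continuous_lap_u
  have := h.continuous_conj (τ := τ) hs
  have := h.continuous_rad_conj (τ := τ) hs
  have := continuous_expWeight (n := n) (τ := τ) hs
  fun_prop

lemma continuousOn_Icc_slice {f : EuclideanSpace ℝ (Fin n) × ℝ → ℝ}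
    (hf : ContinuousOn f {q | 0 < q.2}) (hb : 0 < b) (hb' : b ≤ 1 / 2)
    (z : EuclideanSpace ℝ (Fin n)) :
    ContinuousOn (fun t => f (z, t)) (Set.uIcc b (1 / 2)) :=
  hf.comp (by fun_prop) fun t ht => by
    rw [Set.uIcc_of_le hb'] at ht
    exact hb.trans_le ht.1

/-- The flux of the Carleman identity for a tangentially smooth solution. -/
noncomputable def _root_.Carleman.carlemanFlux (τ s : ℝ)
    (u p : EuclideanSpace ℝ (Fin n) → ℝ → ℝ) (z : EuclideanSpace ℝ (Fin n)) (y : ℝ) : ℝ :=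
  flux (1 - 2 * s) τ (‖z‖ ^ 2) y (y ^ (1 - 2 * s) * conjDeriv τ s u p z y) (conj τ s u z y)
    (τ * (rad (fun z => conj τ s u z y) z + n / 2 * conj τ s u z y))
    (∑ i, pd i (fun z => conj τ s u z y) z ^ 2)

lemma absolutelyContinuousOnInterval_carlemanFlux
    (h : IsTangentiallySmooth (1 - 2 * s) u p F k) (hs : s < 1) (hb : 0 < b) (hb' : b ≤ 1 / 2)
    (z : EuclideanSpace ℝ (Fin n)) :
    AbsolutelyContinuousOnInterval (carlemanFlux τ s u p z) b (1 / 2) := by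
  have hpos : ∀ t ∈ Set.uIcc b (1 / 2), 0 < t := fun t ht => by
    rw [Set.uIcc_of_le hb'] at ht
    exact hb.trans_le ht.1
  have hY : ContDiffOn ℝ 1 (fun t : ℝ => t ^ (1 - 2 * s)) (Set.uIcc b (1 / 2)) := fun t ht =>
    (Real.contDiffAt_rpow_const_of_ne (hpos t ht).ne').contDiffWithinAt
  have hYi : ContDiffOn ℝ 1 (fun t : ℝ => (t ^ (1 - 2 * s))⁻¹) (Set.uIcc b (1 / 2)) :=
    hY.inv fun t ht => (Real.rpow_pos_of_pos (hpos t ht) _).ne'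
  have hcont : ∀ {f : EuclideanSpace ℝ (Fin n) × ℝ → ℝ} (_ : ContinuousOn f {q | 0 < q.2}),
      ContinuousOn (fun t => f (z, t)) (Set.uIcc b (1 / 2)) :=
    fun hf => continuousOn_Icc_slice hf hb hb' z
  have hu : AbsolutelyContinuousOnInterval (u z) b (1 / 2) :=
    absolutelyContinuousOnInterval_of_hasDerivAt (fun t ht => h.hasDerivAt_u z t (hpos t ht))
      (hcont (f := fun q => p q.1 q.2 / q.2 ^ (1 - 2 * s)) (h.continuous_p.continuousOn.div
        (continuousOn_rpow_snd _) (rpow_snd_ne_zero _)))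
  have hE : AbsolutelyContinuousOnInterval (expWeight τ s z) b (1 / 2) :=
    absolutelyContinuousOnInterval_of_hasDerivAt
      (fun t ht => hasDerivAt_expWeight hs z (hpos t ht))
      (hcont (f := fun q => τ * (2 * (q.2 - q.2 ^ (1 - 2 * s))) * expWeight τ s q.1 q.2)
        ((continuousOn_const.mul (continuousOn_const.mul (continuousOn_snd.sub
          (continuousOn_rpow_snd _)))).mul (continuous_expWeight hs).continuousOn))
  have hp := h.absolutelyContinuousOnInterval_p z b (1 / 2)
  have hQ : AbsolutelyContinuousOnInterval
      (fun t => t ^ (1 - 2 * s) * conjDeriv τ s u p z t) b (1 / 2) := by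
    have hc : ContDiffOn ℝ 1 (fun t : ℝ => τ * (2 * (t - t ^ (1 - 2 * s))))
        (Set.uIcc b (1 / 2)) :=
      contDiffOn_const.mul (contDiffOn_const.mul (contDiffOn_id.sub hY))
    have := hY.absolutelyContinuousOnInterval.fun_mul (hE.fun_mul
      ((hp.fun_mul hYi.absolutelyContinuousOnInterval).fun_add
        (hc.absolutelyContinuousOnInterval.fun_mul hu)))
    exact this
  have hv : AbsolutelyContinuousOnInterval (conj τ s u z) b (1 / 2) := hE.fun_mul hu
  have hr : AbsolutelyContinuousOnInterval (fun t => rad (fun z => conj τ s u z t) z)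
      b (1 / 2) :=
    absolutelyContinuousOnInterval_of_hasDerivAt
      (fun t ht => h.hasDerivAt_rad_conj hs z (hpos t ht))
      (hcont (h.continuousOn_rad_conjDeriv hs))
  have hG : AbsolutelyContinuousOnInterval
      (fun t => ∑ i, pd i (fun z => conj τ s u z t) z ^ 2) b (1 / 2) :=
    absolutelyContinuousOnInterval_of_hasDerivAt
      (fun t ht => h.hasDerivAt_grad_sq_conj hs z (hpos t ht))
      (hcont (f := fun q => 2 * ∑ i, pd i (fun z => conj τ s u z q.2) q.1
          * pd i (fun z => conjDeriv τ s u p z q.2) q.1)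
        (continuousOn_const.mul (continuousOn_finsetSum _ fun i _ =>
          (h.continuous_pd_conj hs i).continuousOn.mul (h.continuousOn_pd_conjDeriv hs i))))
  exact absolutelyContinuousOnInterval_flux hb hb' hQ hv
    ((hr.fun_add (hv.const_mul _)).const_mul τ) hG

/-- The part of `∂_y (y^a ∂_y v)` that is continuous in the open half-space. -/
noncomputable def _root_.Carleman.conormalDerivCont (τ s : ℝ)
    (u p : EuclideanSpace ℝ (Fin n) → ℝ → ℝ) (z : EuclideanSpace ℝ (Fin n)) (y : ℝ) : ℝ :=
  y ^ (1 - 2 * s) * (2 * τ * (2 * (y - y ^ (1 - 2 * s))) * conjDeriv τ s u p z y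
    - (lap (fun z => conj τ s u z y) z + τ ^ 2 / 4 * ‖z‖ ^ 2 * conj τ s u z y)
    - τ * (rad (fun z => conj τ s u z y) z + n / 2 * conj τ s u z y)
    - (τ ^ 2 * (2 * (y - y ^ (1 - 2 * s))) ^ 2
      - τ * (2 * (1 + (1 - 2 * s)) - 4 * (1 - 2 * s) * (y ^ (1 - 2 * s) / y)))
      * conj τ s u z y)

end IsTangentiallySmooth

end CarlemanSlab

section CarlemanIntegrated

namespace IsTangentiallySmooth

variable {n : ℕ} {τ s b : ℝ} {u p F : EuclideanSpace ℝ (Fin n) → ℝ → ℝ} {k : ℝ → ℝ}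

/-- The normal derivative of `carlemanFlux`, once `∂_y (y^a ∂_y v)` is replaced by
`D` through the equation. -/
noncomputable def _root_.Carleman.carlemanFluxDeriv (τ s : ℝ)
    (u p : EuclideanSpace ℝ (Fin n) → ℝ → ℝ) (D : ℝ) (z : EuclideanSpace ℝ (Fin n)) (y : ℝ) : ℝ :=
  fluxDeriv (1 - 2 * s) τ (‖z‖ ^ 2) y (y ^ (1 - 2 * s) * conjDeriv τ s u p z y) (conj τ s u z y)
    (τ * (rad (fun z => conj τ s u z y) z + n / 2 * conj τ s u z y))
    (∑ i, pd i (fun z => conj τ s u z y) z ^ 2) D (conjDeriv τ s u p z y)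
    (τ * (rad (fun z => conjDeriv τ s u p z y) z + n / 2 * conjDeriv τ s u p z y))
    (∑ i, pd i (fun z => conj τ s u z y) z * pd i (fun z => conjDeriv τ s u p z y) z)

lemma ae_hasDerivAt_carlemanFlux (h : IsTangentiallySmooth (1 - 2 * s) u p F k) (hs : s < 1)
    (z : EuclideanSpace ℝ (Fin n)) :
    ∀ᵐ y, 0 < y → HasDerivAt (carlemanFlux τ s u p z) (carlemanFluxDeriv τ s u p
      (expWeight τ s z y * F z y + conormalDerivCont τ s u p z y) z y) y := by
  filter_upwards [h.ae_hasDerivAt_conormal (τ := τ) hs z] with y hy hy0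
  exact hasDerivAt_flux hy0 (hy hy0) (h.hasDerivAt_conj hs z hy0)
    (((h.hasDerivAt_rad_conj hs z hy0).fun_add
      ((h.hasDerivAt_conj hs z hy0).const_mul _)).const_mul τ)
    (h.hasDerivAt_grad_sq_conj hs z hy0)

lemma continuousOn_conormalDerivCont (h : IsTangentiallySmooth (1 - 2 * s) u p F k)
    (hs : s < 1) : ContinuousOn (fun q : EuclideanSpace ℝ (Fin n) × ℝ =>
      conormalDerivCont τ s u p q.1 q.2) {q | 0 < q.2} := by
  have h1 := (h.continuous_conj (τ := τ) hs).continuousOn (s := {q | 0 < q.2})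
  have h2 := h.continuousOn_conjDeriv (τ := τ) hs
  have h3 := (h.continuous_lap_conj (τ := τ) hs).continuousOn (s := {q | 0 < q.2})
  have h4 := (h.continuous_rad_conj (τ := τ) hs).continuousOn (s := {q | 0 < q.2})
  have h5 := continuousOn_rpow_snd (n := n) (1 - 2 * s)
  have h6 : ContinuousOn (fun q : EuclideanSpace ℝ (Fin n) × ℝ => q.2 ^ (1 - 2 * s) / q.2)
      {q | 0 < q.2} := h5.div continuousOn_snd fun q hq => ne_of_gt hq
  obtain ⟨f5, e5⟩ : ∃ f : EuclideanSpace ℝ (Fin n) × ℝ → ℝ, ∀ q, q.2 ^ (1 - 2 * s) = f q :=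
    ⟨fun q => q.2 ^ (1 - 2 * s), fun _ => rfl⟩
  simp only [e5] at h5 h6
  obtain ⟨f6, e6⟩ : ∃ f : EuclideanSpace ℝ (Fin n) × ℝ → ℝ, ∀ q, f5 q / q.2 = f q :=
    ⟨_, fun _ => rfl⟩
  unfold conormalDerivCont
  simp only [e5, e6] at h6 ⊢
  fun_prop

lemma slices_eq_zero (h : IsTangentiallySmooth (1 - 2 * s) u p F k)
    (z : EuclideanSpace ℝ (Fin n)) (y : ℝ) (hz : 5 / 8 < ‖z‖) :
    rad (fun z => conj τ s u z y) z = 0 ∧ lap (fun z => conj τ s u z y) z = 0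
      ∧ rad (fun z => conjDeriv τ s u p z y) z = 0
      ∧ (∀ i, pd i (fun z => conj τ s u z y) z = 0)
      ∧ (∀ i, pd i (fun z => u z y) z = 0) :=
  ⟨rad_eq_zero_of_eq_zero (fun w hw => h.conj_eq_zero w y hw) hz,
    lap_eq_zero_of_eq_zero (fun w hw => h.conj_eq_zero w y hw) hz,
    rad_eq_zero_of_eq_zero (fun w hw => h.conjDeriv_eq_zero w y hw) hz,
    fun i => pd_eq_zero_of_eq_zero (fun w hw => h.conj_eq_zero w y hw) i hz,
    fun i => pd_eq_zero_of_eq_zero (fun w hw => h.u_eq_zero w y hw) i hz⟩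

lemma carlemanFlux_half (h : IsTangentiallySmooth (1 - 2 * s) u p F k)
    (z : EuclideanSpace ℝ (Fin n)) : carlemanFlux τ s u p z (1 / 2) = 0 := by
  have e1 : (fun z => conj τ s u z (1 / 2)) = fun _ => 0 := by
    funext w
    simp only [conj, h.u_eq_zero_of_le w _ le_rfl, mul_zero]
  have e2 : conjDeriv τ s u p z (1 / 2) = 0 := by
    simp only [conjDeriv, h.u_eq_zero_of_le z _ le_rfl, h.p_eq_zero_of_le z _ le_rfl, mul_zero,
      zero_div, add_zero]
  have e3 := congrFun e1 z
  have e4 : ∀ i, pd i (fun _ : EuclideanSpace ℝ (Fin n) => (0 : ℝ)) z = 0 := fun i => by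
    simp [pd]
  have e5 : rad (fun _ : EuclideanSpace ℝ (Fin n) => (0 : ℝ)) z = 0 := by simp [rad, e4]
  simp only [carlemanFlux, flux, e1, e2, e3, e4, e5]
  simp

lemma integrable_carlemanFluxDeriv (h : IsTangentiallySmooth (1 - 2 * s) u p F k) (hs : s < 1)
    (hb : 0 < b) : Integrable (fun q : EuclideanSpace ℝ (Fin n) × ℝ =>
      carlemanFluxDeriv τ s u p (expWeight τ s q.1 q.2 * F q.1 q.2
        + conormalDerivCont τ s u p q.1 q.2) q.1 q.2) (slab n b) := by
  have c1 := (h.continuous_conj (τ := τ) hs).continuousOn (s := {q | 0 < q.2})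
  have c2 := h.continuousOn_conjDeriv (τ := τ) hs
  have c4 := (h.continuous_rad_conj (τ := τ) hs).continuousOn (s := {q | 0 < q.2})
  have c4' := h.continuousOn_rad_conjDeriv (τ := τ) hs
  have c5 := continuousOn_rpow_snd (n := n) (1 - 2 * s)
  have c6 : ContinuousOn (fun q : EuclideanSpace ℝ (Fin n) × ℝ => q.2 ^ (1 - 2 * s) / q.2)
      {q | 0 < q.2} := c5.div continuousOn_snd fun q hq => ne_of_gt hq
  have c6' : ContinuousOn (fun q : EuclideanSpace ℝ (Fin n) × ℝ => q.2 / q.2 ^ (1 - 2 * s))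
      {q | 0 < q.2} := continuousOn_snd.div c5 (rpow_snd_ne_zero _)
  have c7 := (continuous_expWeight (n := n) (τ := τ) hs).continuousOn (s := {q | 0 < q.2})
  have c8 := fun i => (h.continuous_pd_conj (τ := τ) hs i).continuousOn (s := {q | 0 < q.2})
  have c9 := fun i => h.continuousOn_pd_conjDeriv (τ := τ) hs i
  have cA : ContinuousOn (fun q : EuclideanSpace ℝ (Fin n) × ℝ =>
      τ * (rad (fun z => conj τ s u z q.2) q.1 + n / 2 * conj τ s u q.1 q.2)) {q | 0 < q.2} := by
    fun_prop
  have cB : ContinuousOn (fun q : EuclideanSpace ℝ (Fin n) × ℝ =>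
      τ * (rad (fun z => conjDeriv τ s u p z q.2) q.1 + n / 2 * conjDeriv τ s u p q.1 q.2))
      {q | 0 < q.2} := by
    fun_prop
  have cG : ContinuousOn (fun q : EuclideanSpace ℝ (Fin n) × ℝ =>
      ∑ i, pd i (fun z => conj τ s u z q.2) q.1 ^ 2) {q | 0 < q.2} :=
    continuousOn_finsetSum _ fun i _ => (c8 i).pow 2
  have cg : ContinuousOn (fun q : EuclideanSpace ℝ (Fin n) × ℝ =>
      ∑ i, pd i (fun z => conj τ s u z q.2) q.1
        * pd i (fun z => conjDeriv τ s u p z q.2) q.1) {q | 0 < q.2} :=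
    continuousOn_finsetSum _ fun i _ => (c8 i).mul (c9 i)
  have cont1 : ContinuousOn (fun q : EuclideanSpace ℝ (Fin n) × ℝ =>
      carlemanFluxDeriv τ s u p (conormalDerivCont τ s u p q.1 q.2) q.1 q.2) {q | 0 < q.2} :=
    continuousOn_fluxDeriv (fun q hq => hq) (by fun_prop) continuousOn_snd (c5.mul c2) c1 cA cG
      (h.continuousOn_conormalDerivCont hs) c2 cB cg
  have i1 := integrable_slab (R := 5 / 8)
    (G := fun z y => carlemanFluxDeriv τ s u p (conormalDerivCont τ s u p z y) z y) hb cont1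
    fun z y hz => by
      obtain ⟨h1, h2, h3, h4, -⟩ := h.slices_eq_zero (τ := τ) z y hz
      simp [carlemanFluxDeriv, fluxDeriv, conormalDerivCont, h1, h2, h3, h4,
        h.conj_eq_zero z y hz, h.conjDeriv_eq_zero z y hz]
  have cont2 : ContinuousOn (fun q : EuclideanSpace ℝ (Fin n) × ℝ =>
      (-8 * τ * (q.2 / q.2 ^ (1 - 2 * s) - 1) * (q.2 ^ (1 - 2 * s) * conjDeriv τ s u p q.1 q.2)
        - 2 * τ * (2 * (1 + (1 - 2 * s)) + 3 / 2 - 4 * (1 - 2 * s) * (q.2 ^ (1 - 2 * s) / q.2))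
          * conj τ s u q.1 q.2
        + 2 * (τ * (rad (fun z => conj τ s u z q.2) q.1 + n / 2 * conj τ s u q.1 q.2)))
        * expWeight τ s q.1 q.2) {q | 0 < q.2} := by
    exact ((((continuousOn_const.mul (c6'.sub continuousOn_const)).mul (c5.mul c2)).sub
      ((continuousOn_const.mul (continuousOn_const.sub (continuousOn_const.mul c6))).mul c1)).add
      (continuousOn_const.mul cA)).mul c7
  have i2 := integrable_slab_mul (R := 5 / 8) (F := F) (k := k)
    (G := fun z y =>
      (-8 * τ * (y / y ^ (1 - 2 * s) - 1) * (y ^ (1 - 2 * s) * conjDeriv τ s u p z y)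
        - 2 * τ * (2 * (1 + (1 - 2 * s)) + 3 / 2 - 4 * (1 - 2 * s) * (y ^ (1 - 2 * s) / y))
          * conj τ s u z y
        + 2 * (τ * (rad (fun z => conj τ s u z y) z + n / 2 * conj τ s u z y)))
        * expWeight τ s z y) hb cont2
    (fun z y hz => by
      obtain ⟨h1, -⟩ := h.slices_eq_zero (τ := τ) z y hz
      simp [h1, h.conj_eq_zero z y hz, h.conjDeriv_eq_zero z y hz])
    h.measurable_F (h.integrableOn_k.mono_set (Set.Ioc_subset_Ioc_left hb.le))
    fun z y hy => h.abs_F_le z y ⟨hb.trans hy.1, hy.2⟩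
  refine (i1.add i2).congr (Eventually.of_forall fun q => ?_)
  simp only [carlemanFluxDeriv, fluxDeriv, Pi.add_apply]
  ring

/-- A bounded continuous function times `F² / y^a` is integrable up to the boundary. -/
lemma integrable_mul_sq_F {a : ℝ} (h : IsTangentiallySmooth a u p F k)
    {G : EuclideanSpace ℝ (Fin n) → ℝ → ℝ}
    (hG : Continuous fun q : EuclideanSpace ℝ (Fin n) × ℝ => G q.1 q.2) :
    Integrable (fun q : EuclideanSpace ℝ (Fin n) × ℝ => G q.1 q.2 * (F q.1 q.2 ^ 2 / q.2 ^ a))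
      (slab n 0) := by
  have hK : IsCompact (Metric.closedBall (0 : EuclideanSpace ℝ (Fin n)) (5 / 8)
      ×ˢ Set.Icc (0 : ℝ) (1 / 2)) := (isCompact_closedBall _ _).prod isCompact_Icc
  obtain ⟨C, hC⟩ := hK.exists_bound_of_continuousOn hG.continuousOn
  have hdom : Integrable (fun q : EuclideanSpace ℝ (Fin n) × ℝ =>
      (Metric.closedBall (0 : EuclideanSpace ℝ (Fin n)) (5 / 8)).indicator (fun _ => C) q.1
        * (k q.2 ^ 2 / q.2 ^ a)) (slab n 0) := by
    refine Integrable.mul_prod ?_ h.integrableOn_sq_k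
    exact (integrable_indicator_iff measurableSet_closedBall).2
      (integrableOn_const measure_closedBall_lt_top.ne)
  refine hdom.mono' ?_ ?_
  · exact (hG.measurable.mul ((h.measurable_F.pow_const 2).div
      (measurable_snd.pow_const a))).aestronglyMeasurable
  filter_upwards [ae_slab_mem 0] with q hq
  have hY : 0 < q.2 ^ a := Real.rpow_pos_of_pos hq.1 a
  rw [norm_mul, Real.norm_eq_abs, Real.norm_eq_abs, abs_of_nonneg (by positivity :
    0 ≤ F q.1 q.2 ^ 2 / q.2 ^ a)]
  by_cases hz : 5 / 8 < ‖q.1‖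
  · rw [h.F_eq_zero _ _ hz]
    simp [hz]
  · rw [Set.indicator_of_mem (by simpa using hz)]
    have h1 : |G q.1 q.2| ≤ C := hC q ⟨by simpa using hz, Set.Ioc_subset_Icc_self hq⟩
    have h2 : F q.1 q.2 ^ 2 ≤ k q.2 ^ 2 := by
      rw [← sq_abs (F _ _)]
      exact pow_le_pow_left₀ (abs_nonneg _) (h.abs_F_le _ _ hq) 2
    exact mul_le_mul h1 (by gcongr) (by positivity) ((abs_nonneg _).trans h1)

lemma _root_.Carleman.slab_mono {b c : ℝ} (h : b ≤ c) : slab n c ≤ slab n b := by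
  rw [slab_eq_restrict, slab_eq_restrict]
  exact Measure.restrict_mono
    (Set.prod_mono_right (Set.Ioc_subset_Ioc_left h)) le_rfl

/-- The density controlled by the Carleman inequality. -/
noncomputable def _root_.Carleman.energy (τ s : ℝ)
    (u p : EuclideanSpace ℝ (Fin n) → ℝ → ℝ) (z : EuclideanSpace ℝ (Fin n)) (y : ℝ) : ℝ :=
  y ^ (1 - 2 * s) * expWeight τ s z y ^ 2 * (τ ^ 3 * u z y ^ 2
    + τ * (∑ i, pd i (fun z => u z y) z ^ 2 + (p z y / y ^ (1 - 2 * s)) ^ 2))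

/-- The energy density of `u` in terms of that of the conjugated function `v = e^{τφ} u`:
undoing the conjugation costs `τ² |∇φ|² v²`, where `|∇φ|² = |z|²/4 + (2 (y - y^{1-2s}))²`. -/
lemma energy_le (h : IsTangentiallySmooth (1 - 2 * s) u p F k) (hτ : 0 ≤ τ)
    {z : EuclideanSpace ℝ (Fin n)} {y : ℝ} (hy : 0 < y) (hz : ‖z‖ ^ 2 ≤ 1) :
    energy τ s u p z y ≤ 3 * (τ ^ 3 * y ^ (1 - 2 * s) * conj τ s u z y ^ 2
        * (1 + (2 * (y - y ^ (1 - 2 * s))) ^ 2)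
      + 11 * τ * y ^ (1 - 2 * s) * conjDeriv τ s u p z y ^ 2
      + τ * y ^ (1 - 2 * s) * ∑ i, pd i (fun z => conj τ s u z y) z ^ 2) := by
  have hG : expWeight τ s z y ^ 2 * ∑ i, pd i (fun z => u z y) z ^ 2
      ≤ 2 * ∑ i, pd i (fun z => conj τ s u z y) z ^ 2 + τ ^ 2 / 2 * conj τ s u z y ^ 2 := by
    have e1 : ∀ i, expWeight τ s z y ^ 2 * pd i (fun z => u z y) z ^ 2
        ≤ 2 * pd i (fun z => conj τ s u z y) z ^ 2
          + τ ^ 2 / 2 * conj τ s u z y ^ 2 * z i ^ 2 := fun i => by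
      have e2 : expWeight τ s z y * pd i (fun z => u z y) z
          = pd i (fun z => conj τ s u z y) z + τ / 2 * z i * conj τ s u z y := by
        rw [h.pd_conj, conj]
        ring
      rw [← mul_pow, e2]
      nlinarith [sq_nonneg (pd i (fun z => conj τ s u z y) z - τ / 2 * z i * conj τ s u z y)]
    calc _ = ∑ i, expWeight τ s z y ^ 2 * pd i (fun z => u z y) z ^ 2 := Finset.mul_sum _ _ _
      _ ≤ ∑ i, (2 * pd i (fun z => conj τ s u z y) z ^ 2
          + τ ^ 2 / 2 * conj τ s u z y ^ 2 * z i ^ 2) := Finset.sum_le_sum fun i _ => e1 i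
      _ = 2 * ∑ i, pd i (fun z => conj τ s u z y) z ^ 2
          + τ ^ 2 / 2 * conj τ s u z y ^ 2 * ‖z‖ ^ 2 := by
        rw [Finset.sum_add_distrib, ← Finset.mul_sum, ← Finset.mul_sum,
          EuclideanSpace.real_norm_sq_eq]
      _ ≤ _ := by
        have : τ ^ 2 / 2 * conj τ s u z y ^ 2 * ‖z‖ ^ 2 ≤ τ ^ 2 / 2 * conj τ s u z y ^ 2 * 1 :=
          mul_le_mul_of_nonneg_left hz (by positivity)
        linarith
  have hq : expWeight τ s z y ^ 2 * (p z y / y ^ (1 - 2 * s)) ^ 2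
      ≤ 2 * conjDeriv τ s u p z y ^ 2
        + 2 * τ ^ 2 * (2 * (y - y ^ (1 - 2 * s))) ^ 2 * conj τ s u z y ^ 2 := by
    have e2 : expWeight τ s z y * (p z y / y ^ (1 - 2 * s)) = conjDeriv τ s u p z y
        - τ * (2 * (y - y ^ (1 - 2 * s))) * conj τ s u z y := by
      unfold conj conjDeriv
      ring
    rw [← mul_pow, e2]
    nlinarith [sq_nonneg (conjDeriv τ s u p z y
      + τ * (2 * (y - y ^ (1 - 2 * s))) * conj τ s u z y)]
  have hu : expWeight τ s z y ^ 2 * u z y ^ 2 = conj τ s u z y ^ 2 := by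
    unfold conj
    ring
  have hY : 0 < y ^ (1 - 2 * s) := Real.rpow_pos_of_pos hy _
  have hGn : 0 ≤ ∑ i, pd i (fun z => conj τ s u z y) z ^ 2 :=
    Finset.sum_nonneg fun i _ => sq_nonneg _
  unfold energy
  generalize ∑ i, pd i (fun z => conj τ s u z y) z ^ 2 = G at *
  generalize ∑ i, pd i (fun z => u z y) z ^ 2 = Gu at *
  generalize conj τ s u z y = v at *
  generalize conjDeriv τ s u p z y = q at *
  generalize (2 * (y - y ^ (1 - 2 * s))) = w at *
  generalize y ^ (1 - 2 * s) = Y at *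
  have k1 := mul_le_mul_of_nonneg_left (add_le_add hG hq) (mul_nonneg hY.le hτ)
  calc _ = Y * τ ^ 3 * (expWeight τ s z y ^ 2 * u z y ^ 2)
        + Y * τ * (expWeight τ s z y ^ 2 * Gu + expWeight τ s z y ^ 2 * (p z y / Y) ^ 2) := by
        ring
    _ ≤ Y * τ ^ 3 * v ^ 2 + Y * τ * (2 * G + τ ^ 2 / 2 * v ^ 2
        + (2 * q ^ 2 + 2 * τ ^ 2 * w ^ 2 * v ^ 2)) := by
        rw [hu]
        linarith
    _ ≤ _ := by
        have m1 : 0 ≤ Y * τ ^ 3 * v ^ 2 := by positivity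
        have m2 : 0 ≤ Y * τ ^ 3 * v ^ 2 * w ^ 2 := by positivity
        have m3 : 0 ≤ Y * τ * G := by positivity
        have m4 : 0 ≤ Y * τ * q ^ 2 := by positivity
        nlinarith

/-- The Carleman inequality above height `b`, with a boundary term at height `b`. -/
theorem carleman_slab (h : IsTangentiallySmooth (1 - 2 * s) u p F k) (hs : 1 / 2 ≤ s)
    (hs' : s < 1) (hτ : 4 ≤ τ) (hb : 0 < b) (hb' : b ≤ 1 / 2) :
    Integrable (fun q : EuclideanSpace ℝ (Fin n) × ℝ => energy τ s u p q.1 q.2) (slab n b) ∧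
    ∫ q : EuclideanSpace ℝ (Fin n) × ℝ, energy τ s u p q.1 q.2 ∂slab n b
      ≤ 3 * (∫ q : EuclideanSpace ℝ (Fin n) × ℝ,
          expWeight τ s q.1 q.2 ^ 2 * (F q.1 q.2 ^ 2 / q.2 ^ (1 - 2 * s)) ∂slab n b
        + ∫ z, carlemanFlux τ s u p z b) := by
  have ha : 1 - 2 * s ≤ 0 := by linarith
  have c1 := (h.continuous_conj (τ := τ) hs').continuousOn (s := {q | 0 < q.2})
  have c2 := h.continuousOn_conjDeriv (τ := τ) hs'
  have c3 := (h.continuous_lap_conj (τ := τ) hs').continuousOn (s := {q | 0 < q.2})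
  have c4 := (h.continuous_rad_conj (τ := τ) hs').continuousOn (s := {q | 0 < q.2})
  have c4' := h.continuousOn_rad_conjDeriv (τ := τ) hs'
  have c5 := continuousOn_rpow_snd (n := n) (1 - 2 * s)
  have c6 : ContinuousOn (fun q : EuclideanSpace ℝ (Fin n) × ℝ => q.2 ^ (1 - 2 * s) / q.2)
      {q | 0 < q.2} := c5.div continuousOn_snd fun q hq => ne_of_gt hq
  have c7 := (continuous_expWeight (n := n) (τ := τ) hs').continuousOn (s := {q | 0 < q.2})
  have c8 := fun i => (h.continuous_pd_conj (τ := τ) hs' i).continuousOn (s := {q | 0 < q.2})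
  have c9 := fun i => h.continuousOn_pd_conjDeriv (τ := τ) hs' i
  have ienergy : Integrable (fun q : EuclideanSpace ℝ (Fin n) × ℝ => energy τ s u p q.1 q.2)
      (slab n b) := by
    refine integrable_slab (R := 5 / 8) (G := energy τ s u p) hb ?_ fun z y hz => by
      obtain ⟨-, -, -, -, h5⟩ := h.slices_eq_zero (τ := τ) z y hz
      simp [energy, h5, h.u_eq_zero z y hz, h.p_eq_zero z y hz]
    exact (c5.mul (c7.pow 2)).mul ((continuousOn_const.mul (h.continuous_u.continuousOn.pow 2)).add
      (continuousOn_const.mul ((continuousOn_finsetSum _ fun i _ =>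
        (h.continuous_pd_u i).continuousOn.pow 2).add
        ((h.continuous_p.continuousOn.div c5 (rpow_snd_ne_zero _)).pow 2))))
  have inull : Integrable (fun q : EuclideanSpace ℝ (Fin n) × ℝ => sliceNull (1 - 2 * s) τ q.2
      (fun z => conj τ s u z q.2) (fun z => conjDeriv τ s u p z q.2) q.1) (slab n b) := by
    refine integrable_slab (R := 5 / 8) (G := fun z y => sliceNull (1 - 2 * s) τ y
      (fun z => conj τ s u z y) (fun z => conjDeriv τ s u p z y) z) hb ?_ fun z y hz => by
      obtain ⟨h1, h2, h3, h4, -⟩ := h.slices_eq_zero (τ := τ) z y hz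
      simp [sliceNull, h1, h2, h3, h4, h.conj_eq_zero z y hz, h.conjDeriv_eq_zero z y hz]
    obtain ⟨f5, e5⟩ : ∃ f : EuclideanSpace ℝ (Fin n) × ℝ → ℝ, ∀ q, q.2 ^ (1 - 2 * s) = f q :=
      ⟨fun q => q.2 ^ (1 - 2 * s), fun _ => rfl⟩
    simp only [e5] at c5 c6
    obtain ⟨f6, e6⟩ : ∃ f : EuclideanSpace ℝ (Fin n) × ℝ → ℝ, ∀ q, f5 q / q.2 = f q :=
      ⟨_, fun _ => rfl⟩
    unfold sliceNull
    simp only [e5, e6] at c6 ⊢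
    fun_prop
  -- these terms integrate to zero on every slice, hence on the slab
  have null : ∫ q : EuclideanSpace ℝ (Fin n) × ℝ, sliceNull (1 - 2 * s) τ q.2
      (fun z => conj τ s u z q.2) (fun z => conjDeriv τ s u p z q.2) q.1 ∂slab n b = 0 := by
    rw [slab, integral_prod_symm _ inull]
    exact integral_eq_zero_of_ae (Eventually.of_forall fun y =>
      integral_sliceNull (R := 5 / 8) _ _ _ (h.contDiff_conj y) (h.contDiff_conjDeriv y)
        (fun z hz => h.conj_eq_zero z y hz) fun z hz => h.conjDeriv_eq_zero z y hz)
  have isq := (h.integrable_mul_sq_F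
    (G := fun z y => expWeight τ s z y ^ 2) ((continuous_expWeight hs').pow 2)).mono_measure
    (slab_mono hb.le)
  have iflux := h.integrable_carlemanFluxDeriv (τ := τ) hs' hb
  have hflux := integral_flux_deriv (j := carlemanFlux τ s u p) (j' := fun z y =>
      carlemanFluxDeriv τ s u p (expWeight τ s z y * F z y
        + conormalDerivCont τ s u p z y) z y) hb'
    (h.absolutelyContinuousOnInterval_carlemanFlux hs' hb hb')
    (fun z => by
      filter_upwards [h.ae_hasDerivAt_carlemanFlux (τ := τ) hs' z] with y hy hy'
      rw [Set.uIcc_of_le hb'] at hy'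
      exact hy (hb.trans_le hy'.1)) iflux
  -- no flux leaves through the top, since the solution vanishes there
  simp only [h.carlemanFlux_half, zero_sub, integral_neg] at hflux
  refine ⟨ienergy, ?_⟩
  have hle : ∫ q : EuclideanSpace ℝ (Fin n) × ℝ, energy τ s u p q.1 q.2 ∂slab n b
      ≤ ∫ q : EuclideanSpace ℝ (Fin n) × ℝ, 3 * (expWeight τ s q.1 q.2 ^ 2
        * (F q.1 q.2 ^ 2 / q.2 ^ (1 - 2 * s))
        - carlemanFluxDeriv τ s u p (expWeight τ s q.1 q.2 * F q.1 q.2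
          + conormalDerivCont τ s u p q.1 q.2) q.1 q.2
        - sliceNull (1 - 2 * s) τ q.2 (fun z => conj τ s u z q.2)
          (fun z => conjDeriv τ s u p z q.2) q.1) ∂slab n b := by
    refine integral_mono_ae ienergy (((isq.sub iflux).sub inull).const_mul 3) ?_
    filter_upwards [ae_slab_mem b] with q hq
    have hy : 0 < q.2 := hb.trans hq.1
    by_cases hz : 5 / 8 < ‖q.1‖
    · obtain ⟨h1, h2, h3, h4, h5⟩ := h.slices_eq_zero (τ := τ) q.1 q.2 hz
      simp [energy, h5, h.u_eq_zero _ q.2 hz, h.p_eq_zero _ q.2 hz, sliceNull, h1, h2, h3, h4,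
        h.conj_eq_zero _ q.2 hz, h.conjDeriv_eq_zero _ q.2 hz, h.F_eq_zero _ q.2 hz,
        carlemanFluxDeriv, fluxDeriv]
    · have hz2 : ‖q.1‖ ^ 2 ≤ 25 / 64 := by
        have := pow_le_pow_left₀ (norm_nonneg _) (not_lt.1 hz) 2
        norm_num at this ⊢
        exact this
      refine (h.energy_le (by linarith) hy (by linarith)).trans
        (mul_le_mul_of_nonneg_left ?_ (by norm_num))
      have := pointwise_carleman (a := 1 - 2 * s) (X := ‖q.1‖ ^ 2) (v := conj τ s u q.1 q.2)
        (q := conjDeriv τ s u p q.1 q.2)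
        (Hv := lap (fun z => conj τ s u z q.2) q.1
          + τ ^ 2 / 4 * ‖q.1‖ ^ 2 * conj τ s u q.1 q.2)
        (Av := τ * (rad (fun z => conj τ s u z q.2) q.1 + n / 2 * conj τ s u q.1 q.2))
        (Aq := τ * (rad (fun z => conjDeriv τ s u p z q.2) q.1
          + n / 2 * conjDeriv τ s u p q.1 q.2))
        (G := ∑ i, pd i (fun z => conj τ s u z q.2) q.1 ^ 2)
        (g := ∑ i, pd i (fun z => conj τ s u z q.2) q.1
          * pd i (fun z => conjDeriv τ s u p z q.2) q.1)
        (W := expWeight τ s q.1 q.2 * F q.1 q.2) ha hy hq.2 hτ hz2 rfl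
      refine this.trans (le_of_eq ?_)
      rw [mul_pow, mul_div_assoc]
      rfl
  refine hle.trans (le_of_eq ?_)
  have isub : Integrable (fun q : EuclideanSpace ℝ (Fin n) × ℝ => expWeight τ s q.1 q.2 ^ 2
      * (F q.1 q.2 ^ 2 / q.2 ^ (1 - 2 * s))
      - carlemanFluxDeriv τ s u p (expWeight τ s q.1 q.2 * F q.1 q.2
        + conormalDerivCont τ s u p q.1 q.2) q.1 q.2) (slab n b) := isq.sub iflux
  rw [integral_const_mul, integral_sub isub inull, null, sub_zero, integral_sub isq iflux, hflux]
  ring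

end IsTangentiallySmooth

end CarlemanIntegrated

/-! ### The boundary term of the Carleman inequality -/

section BoundaryFlux

variable {n : ℕ} {a τ s b : ℝ} {u p F : EuclideanSpace ℝ (Fin n) → ℝ → ℝ} {k : ℝ → ℝ}

/-- The quotient of `∫_0^y t^{-a} q(t) dt` by `y^{1-a}`, written so that it is visibly continuous
up to `y = 0`. -/
noncomputable def scaledPrimitive (a : ℝ) (q : ℝ → ℝ) (y : ℝ) : ℝ :=
  ∫ σ in (0 : ℝ)..1, σ ^ (-a) * q (σ * y)

lemma continuous_scaledPrimitive (ha : a ≤ 0) {q : EuclideanSpace ℝ (Fin n) → ℝ → ℝ}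
    (hq : Continuous fun x : EuclideanSpace ℝ (Fin n) × ℝ => q x.1 x.2) :
    Continuous fun x : EuclideanSpace ℝ (Fin n) × ℝ => scaledPrimitive a (q x.1) x.2 := by
  have h1 : Continuous fun t : (EuclideanSpace ℝ (Fin n) × ℝ) × ℝ => t.2 ^ (-a) :=
    continuous_snd.rpow_const fun _ => Or.inr (by linarith)
  have h2 : Continuous fun t : (EuclideanSpace ℝ (Fin n) × ℝ) × ℝ => q t.1.1 (t.2 * t.1.2) :=
    hq.comp (f := fun t : (EuclideanSpace ℝ (Fin n) × ℝ) × ℝ => (t.1.1, t.2 * t.1.2))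
      (by fun_prop)
  exact intervalIntegral.continuous_parametric_intervalIntegral_of_continuous' (h1.mul h2) 0 1

lemma scaledPrimitive_zero (ha : a ≤ 0) (q : ℝ → ℝ) :
    scaledPrimitive a q 0 = q 0 / (1 - a) := by
  simp only [scaledPrimitive, mul_zero]
  rw [intervalIntegral.integral_mul_const, integral_rpow (Or.inl (by linarith)),
    Real.zero_rpow (by linarith), Real.one_rpow]
  rw [show -a + 1 = 1 - a by ring]
  ring

lemma intervalIntegrable_rpow_neg_mul (ha : a ≤ 0) {q : ℝ → ℝ} (hq : Continuous q) (b c : ℝ) :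
    IntervalIntegrable (fun t => t ^ (-a) * q t) volume b c :=
  ((continuous_id.rpow_const fun _ => Or.inr (by linarith)).mul hq).intervalIntegrable _ _

/-- A function with `y^a ∂_y g = q` that vanishes at the boundary is `y^{1-a}` times a function
continuous up to the boundary. -/
lemma eq_rpow_mul_scaledPrimitive (ha : a ≤ 0) {g q : ℝ → ℝ} (hg : Continuous g)
    (hq : Continuous q) (h0 : g 0 = 0) (hd : ∀ t, 0 < t → HasDerivAt g (q t / t ^ a) t)
    {y : ℝ} (hy : 0 < y) : g y = y ^ (1 - a) * scaledPrimitive a q y := by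
  have h1 : ∫ t in (0 : ℝ)..y, t ^ (-a) * q t = g y - g 0 := by
    refine intervalIntegral.integral_eq_sub_of_hasDerivAt_of_le hy.le hg.continuousOn
      (fun t ht => ?_) (intervalIntegrable_rpow_neg_mul ha hq _ _)
    refine (hd t ht.1).congr_deriv ?_
    rw [Real.rpow_neg ht.1.le]
    ring
  have h2 := intervalIntegral.smul_integral_comp_mul_left (a := 0) (b := 1)
    (fun t : ℝ => t ^ (-a) * q t) y
  rw [mul_zero, mul_one, h1, h0, sub_zero] at h2
  rw [← h2, scaledPrimitive, smul_eq_mul, Real.rpow_sub hy, Real.rpow_one, div_eq_mul_inv,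
    ← Real.rpow_neg hy.le, mul_assoc]
  congr 1
  rw [← intervalIntegral.integral_const_mul]
  refine intervalIntegral.integral_congr fun σ hσ => ?_
  rw [Set.uIcc_of_le zero_le_one] at hσ
  rw [Real.mul_rpow hy.le hσ.1, mul_comm σ y]
  ring

/-- The flux as a polynomial in quantities that are continuous up to the boundary: `α = y^{1-a}`,
`β = y (y - y^a)`, `E = e^{τφ}`, `P = y^a ∂_y u`, `U = u / α`, while `A` and `D` replace
`x · ∇'v + n v / 2` and `|∇'v|²` after division by `E α` and `(E α)²`. -/
noncomputable def fluxPoly (a τ α β X E P U A D : ℝ) : ℝ :=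
  -4 * τ * (α - 1) * (E * (P + 2 * τ * β * U)) ^ 2
    - 2 * τ * (2 * (1 + a) + 3 / 2) * (E * (P + 2 * τ * β * U) * (E * α * U))
    + 8 * τ * a * (E * (P + 2 * τ * β * U) * (E * U))
    + 4 * τ * (-a) * (1 - a) * (E * U) ^ 2
    + 2 * (E * (P + 2 * τ * β * U)) * (τ * (E * α * A))
    - 16 * τ ^ 3 * β ^ 2 * (α - 1) * (E * U) ^ 2
    + 4 * τ * β * α * (E ^ 2 * D - τ ^ 2 / 4 * X * (E * U) ^ 2)

lemma flux_eq_fluxPoly {y Y X E P U A D : ℝ} (hy : y ≠ 0) (hY : Y ≠ 0) (hYy : y ^ a = Y) :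
    flux a τ X y (Y * (E * (P / Y + τ * (2 * (y - Y)) * (y / Y * U)))) (E * (y / Y * U))
      (τ * (E * (y / Y) * A)) (E ^ 2 * (y / Y) ^ 2 * D)
      = fluxPoly a τ (y / Y) (y * (y - Y)) X E P U A D := by
  unfold flux fluxPoly
  rw [hYy]
  field_simp
  ring

namespace IsTangentiallySmooth

/-- The Carleman flux, in terms of quantities that are continuous up to the boundary. -/
noncomputable def _root_.Carleman.carlemanFluxCont (τ s : ℝ)
    (p : EuclideanSpace ℝ (Fin n) → ℝ → ℝ) (z : EuclideanSpace ℝ (Fin n)) (y : ℝ) : ℝ :=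
  fluxPoly (1 - 2 * s) τ (y ^ (1 - (1 - 2 * s))) (y * y - y ^ (1 + (1 - 2 * s))) (‖z‖ ^ 2)
    (expWeight τ s z y) (p z y) (scaledPrimitive (1 - 2 * s) (p z) y)
    (∑ i, z i * (scaledPrimitive (1 - 2 * s) (fun t => pd i (fun z => p z t) z) y
      - τ / 2 * z i * scaledPrimitive (1 - 2 * s) (p z) y)
      + n / 2 * scaledPrimitive (1 - 2 * s) (p z) y)
    (∑ i, (scaledPrimitive (1 - 2 * s) (fun t => pd i (fun z => p z t) z) y
      - τ / 2 * z i * scaledPrimitive (1 - 2 * s) (p z) y) ^ 2)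

lemma pd_u_zero {a : ℝ} (h : IsTangentiallySmooth a u p F k) (i : Fin n)
    (z : EuclideanSpace ℝ (Fin n)) : pd i (fun z => u z 0) z = 0 := by
  simp [pd, h.u_zero]

lemma lap_u_zero {a : ℝ} (h : IsTangentiallySmooth a u p F k)
    (z : EuclideanSpace ℝ (Fin n)) : lap (fun z => u z 0) z = 0 := by
  have : (fun z => u z 0) = fun _ => 0 := funext h.u_zero
  have h2 : ∀ i, pd i (fun _ : EuclideanSpace ℝ (Fin n) => (0 : ℝ)) = fun _ => 0 := fun i => by
    funext z
    simp [pd]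
  simp [lap, this, h2]

lemma continuous_slice {g : EuclideanSpace ℝ (Fin n) → ℝ → ℝ}
    (hg : Continuous fun q : EuclideanSpace ℝ (Fin n) × ℝ => g q.1 q.2)
    (z : EuclideanSpace ℝ (Fin n)) : Continuous (g z) :=
  hg.comp (f := fun t => (z, t)) (by fun_prop)

/-- Since `u` vanishes at the boundary, `u` and `∇'u` are `O(y^{1-a})`, which compensates the
negative powers of `y` in the flux. -/
lemma carlemanFlux_eq (h : IsTangentiallySmooth (1 - 2 * s) u p F k) (hs : 1 / 2 ≤ s)
    (z : EuclideanSpace ℝ (Fin n)) {y : ℝ} (hy : 0 < y) :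
    carlemanFlux τ s u p z y = carlemanFluxCont τ s p z y := by
  have ha : 1 - 2 * s ≤ 0 := by linarith
  have hY : y ^ (1 - 2 * s) ≠ 0 := (Real.rpow_pos_of_pos hy _).ne'
  have hα : y ^ (1 - (1 - 2 * s)) = y / y ^ (1 - 2 * s) := by
    rw [Real.rpow_sub hy, Real.rpow_one]
  have hβ : y * y - y ^ (1 + (1 - 2 * s)) = y * (y - y ^ (1 - 2 * s)) := by
    rw [Real.rpow_add hy, Real.rpow_one]
    ring
  have hu : u z y = y / y ^ (1 - 2 * s) * scaledPrimitive (1 - 2 * s) (p z) y := by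
    rw [← hα]
    exact eq_rpow_mul_scaledPrimitive ha (continuous_slice h.continuous_u z)
      (continuous_slice h.continuous_p z) (h.u_zero z) (h.hasDerivAt_u z) hy
  have hpu : ∀ i, pd i (fun z => u z y) z = y / y ^ (1 - 2 * s)
      * scaledPrimitive (1 - 2 * s) (fun t => pd i (fun z => p z t) z) y := fun i => by
    rw [← hα]
    exact eq_rpow_mul_scaledPrimitive (g := fun t => pd i (fun z => u z t) z) ha
      (continuous_slice (g := fun z t => pd i (fun z => u z t) z) (h.continuous_pd_u i) z)
      (continuous_slice (g := fun z t => pd i (fun z => p z t) z) (h.continuous_pd_p i) z)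
      (h.pd_u_zero i z) (h.hasDerivAt_pd_u i z) hy
  unfold carlemanFlux carlemanFluxCont
  rw [hα, hβ, ← flux_eq_fluxPoly hy.ne' hY rfl]
  simp only [rad, h.pd_conj]
  simp only [conj, conjDeriv, hu, hpu]
  congr 1
  · congr 1
    rw [mul_add, Finset.mul_sum]
    congr 1
    · exact Finset.sum_congr rfl fun i _ => by ring
    · ring
  · rw [Finset.mul_sum]
    exact Finset.sum_congr rfl fun i _ => by ring

lemma continuous_carlemanFluxCont (h : IsTangentiallySmooth (1 - 2 * s) u p F k)
    (hs : 1 / 2 ≤ s) (hs' : s < 1) : Continuous fun q : EuclideanSpace ℝ (Fin n) × ℝ =>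
      carlemanFluxCont τ s p q.1 q.2 := by
  have ha : 1 - 2 * s ≤ 0 := by linarith
  have c1 : Continuous fun q : EuclideanSpace ℝ (Fin n) × ℝ => q.2 ^ (1 - (1 - 2 * s)) :=
    continuous_snd.rpow_const fun _ => Or.inr (by linarith)
  have c2 : Continuous fun q : EuclideanSpace ℝ (Fin n) × ℝ => q.2 ^ (1 + (1 - 2 * s)) :=
    continuous_snd.rpow_const fun _ => Or.inr (by linarith)
  have c3 := continuous_expWeight (n := n) (τ := τ) hs'
  have c4 := h.continuous_p
  have c5 := continuous_scaledPrimitive ha h.continuous_p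
  have c6 := fun i => continuous_scaledPrimitive (q := fun z t => pd i (fun z => p z t) z) ha
    (h.continuous_pd_p i)
  obtain ⟨f1, e1⟩ : ∃ f : EuclideanSpace ℝ (Fin n) × ℝ → ℝ,
    ∀ q, q.2 ^ (1 - (1 - 2 * s)) = f q := ⟨_, fun _ => rfl⟩
  obtain ⟨f2, e2⟩ : ∃ f : EuclideanSpace ℝ (Fin n) × ℝ → ℝ,
    ∀ q, q.2 ^ (1 + (1 - 2 * s)) = f q := ⟨_, fun _ => rfl⟩
  unfold carlemanFluxCont fluxPoly
  simp only [e1, e2] at c1 c2 ⊢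
  fun_prop

lemma scaledPrimitive_eq_zero (h : IsTangentiallySmooth a u p F k)
    {z : EuclideanSpace ℝ (Fin n)} (hz : 5 / 8 < ‖z‖) (y : ℝ) :
    scaledPrimitive a (p z) y = 0 := by
  simp [scaledPrimitive, h.p_eq_zero z _ hz]

lemma carlemanFluxCont_eq_zero (h : IsTangentiallySmooth (1 - 2 * s) u p F k)
    (z : EuclideanSpace ℝ (Fin n)) (y : ℝ) (hz : 5 / 8 < ‖z‖) :
    carlemanFluxCont τ s p z y = 0 := by
  have e1 : ∀ i, scaledPrimitive (1 - 2 * s) (fun t => pd i (fun z => p z t) z) y = 0 :=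
    fun i => by
      have : ∀ t, pd i (fun z => p z t) z = 0 := fun t =>
        pd_eq_zero_of_eq_zero (fun w hw => h.p_eq_zero w t hw) i hz
      simp [scaledPrimitive, this]
  simp [carlemanFluxCont, fluxPoly, e1, h.scaledPrimitive_eq_zero hz, h.p_eq_zero z y hz]

/-- The value at the boundary is `4 τ / (1 - a)` times the squared Neumann data: all terms with a
factor `y^{1-a}` disappear. -/
lemma carlemanFluxCont_zero_le (hs : 1 / 2 ≤ s) (hs' : s < 1) (hτ : 0 ≤ τ)
    (z : EuclideanSpace ℝ (Fin n)) :
    carlemanFluxCont τ s p z 0 ≤ 4 * τ * (expWeight τ s z 0 ^ 2 * p z 0 ^ 2) := by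
  have ha : 1 - 2 * s ≤ 0 := by linarith
  have h1 : (1 - (1 - 2 * s)) ≠ 0 := by linarith
  have h2 : (1 + (1 - 2 * s)) ≠ 0 := by linarith
  unfold carlemanFluxCont fluxPoly
  rw [Real.zero_rpow h1, Real.zero_rpow h2, scaledPrimitive_zero ha]
  have e : (1 - 2 * s) = 1 - (1 - (1 - 2 * s)) := by ring
  have h3 : 0 < 1 - (1 - 2 * s) := by linarith
  have h4 : 1 ≤ 1 - (1 - 2 * s) := by linarith
  generalize 1 - (1 - 2 * s) = c at *
  rw [e]
  generalize expWeight τ s z 0 = E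
  generalize p z 0 = P
  have : 4 * τ * (E ^ 2 * P ^ 2) / c ≤ 4 * τ * (E ^ 2 * P ^ 2) :=
    div_le_self (by positivity) h4
  refine le_trans (le_of_eq ?_) this
  field_simp
  ring

lemma continuous_integral_slice {g : EuclideanSpace ℝ (Fin n) → ℝ → ℝ} {R : ℝ}
    (hg : Continuous fun q : EuclideanSpace ℝ (Fin n) × ℝ => g q.1 q.2)
    (h0 : ∀ z y, R < ‖z‖ → g z y = 0) : Continuous fun y => ∫ z, g z y := by
  have hg' : Continuous (Function.uncurry fun (y : ℝ) (z : EuclideanSpace ℝ (Fin n)) => g z y) :=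
    hg.comp (f := fun q : ℝ × EuclideanSpace ℝ (Fin n) => (q.2, q.1)) (by fun_prop)
  have hK : IsCompact (Metric.closedBall (0 : EuclideanSpace ℝ (Fin n)) R) :=
    isCompact_closedBall _ _
  have := continuous_parametric_integral_of_continuous (μ := volume) hg' hK
  refine this.congr fun y => ?_
  exact setIntegral_eq_integral_of_forall_compl_eq_zero fun z hz => h0 z y (by simpa using hz)

/-- In the limit the flux through the boundary is bounded by the Neumann data. -/
lemma exists_tendsto_integral_carlemanFlux (h : IsTangentiallySmooth (1 - 2 * s) u p F k)
    (hs : 1 / 2 ≤ s) (hs' : s < 1) (hτ : 0 ≤ τ) :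
    ∃ L ≤ 4 * τ * ∫ z, expWeight τ s z 0 ^ 2 * p z 0 ^ 2,
      Tendsto (fun y => ∫ z, carlemanFlux τ s u p z y) (𝓝[>] 0) (𝓝 L) := by
  have hc := h.continuous_carlemanFluxCont (τ := τ) hs hs'
  refine ⟨∫ z, carlemanFluxCont τ s p z 0, ?_, ?_⟩
  · rw [← integral_const_mul]
    have hE : Continuous fun z : EuclideanSpace ℝ (Fin n) => expWeight τ s z 0 :=
      (contDiff_expWeight 0).continuous
    have hp : Continuous fun z => p z 0 := (h.contDiff_p 0).continuous
    refine integral_mono ?_ ?_ fun z => carlemanFluxCont_zero_le hs hs' hτ z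
    · exact integrable_of_continuous_of_eq_zero (R := 5 / 8)
        (hc.comp (f := fun z => (z, (0 : ℝ))) (by fun_prop))
        fun z hz => h.carlemanFluxCont_eq_zero z 0 hz
    · exact integrable_of_continuous_of_eq_zero (R := 5 / 8) (by fun_prop)
        fun z hz => by simp [h.p_eq_zero z 0 hz]
  · have := (continuous_integral_slice hc fun z y hz =>
      h.carlemanFluxCont_eq_zero z y hz).continuousWithinAt (s := Set.Ioi 0) (x := 0)
    refine this.tendsto.congr' ?_
    filter_upwards [self_mem_nhdsWithin] with y hy
    exact integral_congr_ae (Eventually.of_forall fun z => (h.carlemanFlux_eq hs z hy).symm)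

end IsTangentiallySmooth

end BoundaryFlux

/-! ### Estimates up to the boundary for tangentially smooth solutions -/

section UpToBoundary

variable {n : ℕ} {a τ s b c : ℝ} {u p F : EuclideanSpace ℝ (Fin n) → ℝ → ℝ} {k : ℝ → ℝ}

lemma lintegral_slab_zero_le {f : EuclideanSpace ℝ (Fin n) × ℝ → ℝ≥0∞} {C : ℝ → ℝ≥0∞}
    {C₀ : ℝ≥0∞} (hf : ∀ b, 0 < b → b ≤ 1 / 2 → ∫⁻ q, f q ∂slab n b ≤ C b)
    (hC : Tendsto C (𝓝[>] 0) (𝓝 C₀)) : ∫⁻ q, f q ∂slab n 0 ≤ C₀ := by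
  have h1 : ∀ b, 0 < b → ∫⁻ q, f q ∂slab n b ≤ C₀ := fun b hb => by
    refine ge_of_tendsto hC ?_
    filter_upwards [Ioc_mem_nhdsGT (lt_min hb (by norm_num : (0 : ℝ) < 1 / 2))] with t ht
    exact (lintegral_mono' (slab_mono (ht.2.trans (min_le_left _ _))) le_rfl).trans
      (hf t ht.1 (ht.2.trans (min_le_right _ _)))
  have h2 : (Set.univ : Set (EuclideanSpace ℝ (Fin n))) ×ˢ Set.Ioc (0 : ℝ) (1 / 2)
      = ⋃ m : ℕ, Set.univ ×ˢ Set.Ioc (1 / ((m : ℝ) + 1)) (1 / 2) := by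
    ext q
    simp only [Set.mem_prod, Set.mem_univ, true_and, Set.mem_iUnion, Set.mem_Ioc]
    constructor
    · rintro ⟨h, h'⟩
      obtain ⟨m, hm⟩ := exists_nat_one_div_lt h
      exact ⟨m, hm, h'⟩
    · rintro ⟨m, hm, h'⟩
      exact ⟨lt_trans (by positivity) hm, h'⟩
  have hmono : Monotone fun m : ℕ => (Set.univ : Set (EuclideanSpace ℝ (Fin n)))
      ×ˢ Set.Ioc (1 / ((m : ℝ) + 1)) (1 / 2) := fun m m' hm =>
    Set.prod_mono_right (Set.Ioc_subset_Ioc_left (by gcongr))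
  rw [slab_eq_restrict, h2, setLIntegral_iUnion_of_directed _ hmono.directed_le]
  refine iSup_le fun m => ?_
  rw [← slab_eq_restrict]
  exact h1 _ (by positivity)

/-- The Cauchy-Schwarz inequality, without integrability assumptions. -/
lemma ofReal_sq_integral_mul_le {α : Type*} [MeasurableSpace α] {μ : Measure α} {f g : α → ℝ}
    (hf : AEMeasurable f μ) (hg : AEMeasurable g μ) :
    ENNReal.ofReal ((∫ x, f x * g x ∂μ) ^ 2)
      ≤ (∫⁻ x, ENNReal.ofReal (f x ^ 2) ∂μ) * ∫⁻ x, ENNReal.ofReal (g x ^ 2) ∂μ := by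
  have h1 : ENNReal.ofReal |∫ x, f x * g x ∂μ| ≤ ∫⁻ x, ‖f x‖ₑ * ‖g x‖ₑ ∂μ := by
    rw [← Real.norm_eq_abs, ofReal_norm]
    refine (enorm_integral_le_lintegral_enorm _).trans (le_of_eq ?_)
    exact lintegral_congr fun x => enorm_mul _ _
  have h2 := ENNReal.lintegral_mul_le_Lp_mul_Lq μ Real.HolderConjugate.two_two
    (f := fun x => ‖f x‖ₑ) (g := fun x => ‖g x‖ₑ) (by fun_prop) (by fun_prop)
  have h3 : ∀ h : α → ℝ, ∫⁻ x, ‖h x‖ₑ ^ (2 : ℝ) ∂μ = ∫⁻ x, ENNReal.ofReal (h x ^ 2) ∂μ :=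
    fun h => lintegral_congr fun x => by
      rw [ENNReal.rpow_two, ← ofReal_norm, ← ENNReal.ofReal_pow (norm_nonneg _), Real.norm_eq_abs,
        sq_abs]
  simp only [h3, Pi.mul_apply] at h2
  calc ENNReal.ofReal ((∫ x, f x * g x ∂μ) ^ 2) = ENNReal.ofReal |∫ x, f x * g x ∂μ| ^ 2 := by
        rw [← ENNReal.ofReal_pow (abs_nonneg _), sq_abs]
    _ ≤ ((∫⁻ x, ENNReal.ofReal (f x ^ 2) ∂μ) ^ (1 / 2 : ℝ)
        * (∫⁻ x, ENNReal.ofReal (g x ^ 2) ∂μ) ^ (1 / 2 : ℝ)) ^ 2 :=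
        pow_le_pow_left' (h1.trans h2) 2
    _ = _ := by
        rw [mul_pow, ← ENNReal.rpow_two, ← ENNReal.rpow_two, ← ENNReal.rpow_mul,
          ← ENNReal.rpow_mul]
        norm_num

/-- The Cauchy-Schwarz inequality for an increment, with a weight. -/
lemma ofReal_sq_sub_le {g h w : ℝ → ℝ} (hbc : b ≤ c) (hg : g c - g b = ∫ t in b..c, h t)
    (hw : ∀ t ∈ Set.Ioc b c, 0 < w t) (hwm : Measurable w)
    (hm : AEMeasurable h (volume.restrict (Set.Ioc b c))) :
    ENNReal.ofReal ((g c - g b) ^ 2) ≤ (∫⁻ t in Set.Ioc b c, ENNReal.ofReal (w t))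
      * ∫⁻ t in Set.Ioc b c, ENNReal.ofReal (h t ^ 2 / w t) := by
  have e1 : g c - g b = ∫ t in Set.Ioc b c, √(w t) * (h t / √(w t)) := by
    rw [hg, intervalIntegral.integral_of_le hbc]
    refine setIntegral_congr_fun measurableSet_Ioc fun t ht => ?_
    exact (mul_div_cancel₀ _ (Real.sqrt_pos.2 (hw t ht)).ne').symm
  rw [e1]
  refine (ofReal_sq_integral_mul_le (by fun_prop) (by fun_prop)).trans (le_of_eq ?_)
  congr 1
  · refine setLIntegral_congr_fun measurableSet_Ioc fun t ht => ?_
    exact congrArg _ (Real.sq_sqrt (hw t ht).le)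
  · refine setLIntegral_congr_fun measurableSet_Ioc fun t ht => ?_
    exact congrArg _ (by rw [div_pow, Real.sq_sqrt (hw t ht).le])

namespace IsTangentiallySmooth

/-- The Carleman inequality in the half-space, with the Neumann data on the right-hand side. -/
theorem carleman (h : IsTangentiallySmooth (1 - 2 * s) u p F k) (hs : 1 / 2 ≤ s)
    (hs' : s < 1) (hτ : 4 ≤ τ) :
    ∫⁻ q : EuclideanSpace ℝ (Fin n) × ℝ, ENNReal.ofReal (energy τ s u p q.1 q.2) ∂slab n 0
      ≤ ENNReal.ofReal (3 * (∫ q : EuclideanSpace ℝ (Fin n) × ℝ,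
          expWeight τ s q.1 q.2 ^ 2 * (F q.1 q.2 ^ 2 / q.2 ^ (1 - 2 * s)) ∂slab n 0
        + 4 * τ * ∫ z, expWeight τ s z 0 ^ 2 * p z 0 ^ 2)) := by
  obtain ⟨L, hL, hlim⟩ := h.exists_tendsto_integral_carlemanFlux (τ := τ) hs hs' (by linarith)
  have isq := h.integrable_mul_sq_F
    (G := fun z y => expWeight τ s z y ^ 2) ((continuous_expWeight hs').pow 2)
  refine (lintegral_slab_zero_le (C := fun b => ENNReal.ofReal (3 *
    (∫ q : EuclideanSpace ℝ (Fin n) × ℝ, expWeight τ s q.1 q.2 ^ 2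
      * (F q.1 q.2 ^ 2 / q.2 ^ (1 - 2 * s)) ∂slab n 0
      + ∫ z, carlemanFlux τ s u p z b))) (fun b hb hb' => ?_)
    (ENNReal.tendsto_ofReal ((hlim.const_add _).const_mul 3))).trans
    (ENNReal.ofReal_le_ofReal (by gcongr))
  obtain ⟨hi, hle⟩ := h.carleman_slab hs hs' hτ hb hb'
  have hpos : ∀ᵐ q ∂slab n b, 0 ≤ energy τ s u p q.1 q.2 := by
    filter_upwards [ae_slab_mem b] with q hq
    have hy : 0 < q.2 := hb.trans hq.1
    have : 0 ≤ ∑ i, pd i (fun z => u z q.2) q.1 ^ 2 := Finset.sum_nonneg fun i _ => sq_nonneg _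
    unfold energy
    positivity
  rw [← ofReal_integral_eq_lintegral_ofReal hi hpos]
  refine ENNReal.ofReal_le_ofReal (hle.trans ?_)
  have hmono := integral_mono_measure (slab_mono hb.le) (by
    filter_upwards [ae_slab_mem 0] with q hq
    have hy : 0 < q.2 := hq.1
    simp only [Pi.zero_apply]
    positivity) isq
  linarith

/-- Tangential regularity: testing the equation with the tangential Laplacian bounds
`∂_y (y^a ∂_y u)` and the tangential gradient of `y^a ∂_y u`. -/
theorem lintegral_sq_le (h : IsTangentiallySmooth a u p F k) :
    ∫⁻ q : EuclideanSpace ℝ (Fin n) × ℝ,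
      ENNReal.ofReal ((F q.1 q.2 - q.2 ^ a * lap (fun z => u z q.2) q.1) ^ 2 / q.2 ^ a
        + 2 * ∑ i, pd i (fun z => p z q.2) q.1 ^ 2 / q.2 ^ a) ∂slab n 0
      ≤ ENNReal.ofReal (∫ q : EuclideanSpace ℝ (Fin n) × ℝ, F q.1 q.2 ^ 2 / q.2 ^ a ∂slab n 0) := by
  have isq : Integrable (fun q : EuclideanSpace ℝ (Fin n) × ℝ => F q.1 q.2 ^ 2 / q.2 ^ a)
      (slab n 0) := by
    simpa using h.integrable_mul_sq_F (G := fun _ _ => 1) continuous_const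
  have hcj : Continuous fun q : EuclideanSpace ℝ (Fin n) × ℝ =>
      p q.1 q.2 * lap (fun z => u z q.2) q.1 := h.continuous_p.mul h.continuous_lap_u
  have hj := (continuous_integral_slice (R := 5 / 8)
    (g := fun z y => p z y * lap (fun z => u z y) z) hcj
    fun z y hz => by simp [h.p_eq_zero z y hz]).continuousWithinAt (s := Set.Ioi 0) (x := 0)
  have hj0 : ∫ z, p z 0 * lap (fun z => u z 0) z = 0 := by simp [h.lap_u_zero]
  have hlim : Tendsto (fun y => ENNReal.ofReal
      (∫ q : EuclideanSpace ℝ (Fin n) × ℝ, F q.1 q.2 ^ 2 / q.2 ^ a ∂slab n 0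
        + 2 * ∫ z, p z y * lap (fun z => u z y) z)) (𝓝[>] 0)
      (𝓝 (ENNReal.ofReal (∫ q : EuclideanSpace ℝ (Fin n) × ℝ,
        F q.1 q.2 ^ 2 / q.2 ^ a ∂slab n 0))) := by
    have := (hj.tendsto.const_mul 2).const_add
      (∫ q : EuclideanSpace ℝ (Fin n) × ℝ, F q.1 q.2 ^ 2 / q.2 ^ a ∂slab n 0)
    rw [hj0, mul_zero, add_zero] at this
    exact ENNReal.tendsto_ofReal this
  refine lintegral_slab_zero_le (fun b hb hb' => ?_) hlim
  have cY := IsTangentiallySmooth.continuousOn_rpow_snd (n := n) a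
  have cl := h.continuous_lap_u.continuousOn (s := {q : EuclideanSpace ℝ (Fin n) × ℝ | 0 < q.2})
  have clp := h.continuous_lap_p.continuousOn
    (s := {q : EuclideanSpace ℝ (Fin n) × ℝ | 0 < q.2})
  have cp := h.continuous_p.continuousOn (s := {q : EuclideanSpace ℝ (Fin n) × ℝ | 0 < q.2})
  have lu0 : ∀ z y, 5 / 8 < ‖z‖ → lap (fun z => u z y) z = 0 := fun z y hz =>
    lap_eq_zero_of_eq_zero (fun w hw => h.u_eq_zero w y hw) hz
  have pp0 : ∀ i z y, 5 / 8 < ‖z‖ → pd i (fun z => p z y) z = 0 := fun i z y hz =>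
    pd_eq_zero_of_eq_zero (fun w hw => h.p_eq_zero w y hw) i hz
  -- integrability of the terms
  have iF : Integrable (fun q : EuclideanSpace ℝ (Fin n) × ℝ => F q.1 q.2 ^ 2 / q.2 ^ a)
      (slab n b) := isq.mono_measure (slab_mono hb.le)
  have iFl : Integrable (fun q : EuclideanSpace ℝ (Fin n) × ℝ =>
      lap (fun z => u z q.2) q.1 * F q.1 q.2) (slab n b) :=
    integrable_slab_mul (R := 5 / 8) (G := fun z y => lap (fun z => u z y) z) hb cl lu0
      h.measurable_F
      (h.integrableOn_k.mono_set (Set.Ioc_subset_Ioc_left hb.le))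
      fun z y hy => h.abs_F_le z y ⟨hb.trans hy.1, hy.2⟩
  have ill : Integrable (fun q : EuclideanSpace ℝ (Fin n) × ℝ =>
      q.2 ^ a * lap (fun z => u z q.2) q.1 ^ 2) (slab n b) :=
    integrable_slab (R := 5 / 8) (G := fun z y => y ^ a * lap (fun z => u z y) z ^ 2) hb
      (cY.mul (cl.pow 2)) fun z y hz => by simp [lu0 z y hz]
  have ipl : Integrable (fun q : EuclideanSpace ℝ (Fin n) × ℝ =>
      p q.1 q.2 * lap (fun z => p z q.2) q.1 / q.2 ^ a) (slab n b) :=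
    integrable_slab (R := 5 / 8) (G := fun z y => p z y * lap (fun z => p z y) z / y ^ a) hb
      ((cp.mul clp).div cY (rpow_snd_ne_zero a)) fun z y hz => by
        simp [h.p_eq_zero z y hz]
  have ipp : Integrable (fun q : EuclideanSpace ℝ (Fin n) × ℝ =>
      ∑ i, pd i (fun z => p z q.2) q.1 ^ 2 / q.2 ^ a) (slab n b) :=
    integrable_slab (R := 5 / 8) (G := fun z y => ∑ i, pd i (fun z => p z y) z ^ 2 / y ^ a) hb
      (continuousOn_finsetSum _ fun i _ =>
        ((h.continuous_pd_p i).continuousOn.pow 2).div cY (rpow_snd_ne_zero a))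
      fun z y hz => by simp [pp0 _ z y hz]
  -- the divergence in the normal direction
  have ider : Integrable (fun q : EuclideanSpace ℝ (Fin n) × ℝ =>
      (F q.1 q.2 - q.2 ^ a * lap (fun z => u z q.2) q.1) * lap (fun z => u z q.2) q.1
        + p q.1 q.2 * (lap (fun z => p z q.2) q.1 / q.2 ^ a)) (slab n b) := by
    refine ((iFl.sub ill).add ipl).congr (Eventually.of_forall fun q => ?_)
    simp only [Pi.add_apply, Pi.sub_apply]
    ring
  have hflux := integral_flux_deriv (j := fun z y => p z y * lap (fun z => u z y) z)
    (j' := fun z y => (F z y - y ^ a * lap (fun z => u z y) z) * lap (fun z => u z y) z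
        + p z y * (lap (fun z => p z y) z / y ^ a)) hb'
    (fun z => by
      refine (h.absolutelyContinuousOnInterval_p z b (1 / 2)).fun_mul
        (absolutelyContinuousOnInterval_of_hasDerivAt
          (f' := fun t => lap (fun z => p z t) z / t ^ a) (fun t ht => ?_) ?_)
      · rw [Set.uIcc_of_le hb'] at ht
        exact h.hasDerivAt_lap_u z t (hb.trans_le ht.1)
      · exact continuousOn_Icc_slice (f := fun q => lap (fun z => p z q.2) q.1 / q.2 ^ a)
          (clp.div cY (rpow_snd_ne_zero a)) hb hb' z)
    (fun z => by
      filter_upwards [h.ae_hasDerivAt_p z] with y hy hy'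
      rw [Set.uIcc_of_le hb'] at hy'
      have hy0 := hb.trans_le hy'.1
      exact (hy hy0).fun_mul (h.hasDerivAt_lap_u z y hy0)) ider
  simp only [h.p_eq_zero_of_le _ _ le_rfl, zero_mul, zero_sub, integral_neg] at hflux
  have hnull : ∫ q : EuclideanSpace ℝ (Fin n) × ℝ, (p q.1 q.2 * lap (fun z => p z q.2) q.1 / q.2 ^ a
      + ∑ i, pd i (fun z => p z q.2) q.1 ^ 2 / q.2 ^ a) ∂slab n b = 0 := by
    rw [slab, integral_prod_symm _ (ipl.fun_add ipp)]
    refine integral_eq_zero_of_ae (Eventually.of_forall fun y => ?_)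
    have := integral_lap_mul (R := 5 / 8) (h.contDiff_p y)
      ((h.contDiff_p y).of_le (by norm_num)) fun z hz => h.p_eq_zero z y hz
    simp only [Pi.zero_apply]
    calc _ = ∫ z, (1 / y ^ a) * (lap (fun z => p z y) z * p z y
          + ∑ i, pd i (fun z => p z y) z * pd i (fun z => p z y) z) := by
          refine integral_congr_ae (Eventually.of_forall fun z => ?_)
          simp only
          rw [mul_add, Finset.mul_sum]
          congr 1
          · ring
          · exact Finset.sum_congr rfl fun i _ => by ring
      _ = 0 := by rw [integral_const_mul, this, mul_zero]
  have itot : Integrable (fun q : EuclideanSpace ℝ (Fin n) × ℝ =>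
      (F q.1 q.2 - q.2 ^ a * lap (fun z => u z q.2) q.1) ^ 2 / q.2 ^ a
        + 2 * ∑ i, pd i (fun z => p z q.2) q.1 ^ 2 / q.2 ^ a) (slab n b) := by
    refine Integrable.fun_add ?_ (ipp.const_mul 2)
    refine ((iF.sub (iFl.const_mul 2)).add ill).congr ?_
    filter_upwards [ae_slab_mem b] with q hq
    have hY : q.2 ^ a ≠ 0 := (Real.rpow_pos_of_pos (hb.trans hq.1) a).ne'
    simp only [Pi.add_apply, Pi.sub_apply]
    field_simp
    ring
  have hpos : ∀ᵐ q : EuclideanSpace ℝ (Fin n) × ℝ ∂slab n b,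
      0 ≤ (F q.1 q.2 - q.2 ^ a * lap (fun z => u z q.2) q.1) ^ 2 / q.2 ^ a
        + 2 * ∑ i, pd i (fun z => p z q.2) q.1 ^ 2 / q.2 ^ a := by
    filter_upwards [ae_slab_mem b] with q hq
    have hY : 0 < q.2 ^ a := Real.rpow_pos_of_pos (hb.trans hq.1) a
    have := Finset.sum_nonneg fun i (_ : i ∈ Finset.univ) =>
      div_nonneg (sq_nonneg (pd i (fun z => p z q.2) q.1)) hY.le
    positivity
  rw [← ofReal_integral_eq_lintegral_ofReal itot hpos]
  refine ENNReal.ofReal_le_ofReal ?_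
  have hFle : ∫ q : EuclideanSpace ℝ (Fin n) × ℝ, F q.1 q.2 ^ 2 / q.2 ^ a ∂slab n b
      ≤ ∫ q : EuclideanSpace ℝ (Fin n) × ℝ, F q.1 q.2 ^ 2 / q.2 ^ a ∂slab n 0 := by
    refine integral_mono_measure (slab_mono hb.le) ?_ isq
    filter_upwards [ae_slab_mem 0] with q hq
    have hy : 0 < q.2 := hq.1
    simp only [Pi.zero_apply]
    positivity
  have i1 : Integrable (fun q : EuclideanSpace ℝ (Fin n) × ℝ => F q.1 q.2 ^ 2 / q.2 ^ a
      - 2 * ((F q.1 q.2 - q.2 ^ a * lap (fun z => u z q.2) q.1) * lap (fun z => u z q.2) q.1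
        + p q.1 q.2 * (lap (fun z => p z q.2) q.1 / q.2 ^ a))) (slab n b) :=
    iF.sub (ider.const_mul 2)
  have i2 : Integrable (fun q : EuclideanSpace ℝ (Fin n) × ℝ =>
      p q.1 q.2 * lap (fun z => p z q.2) q.1 / q.2 ^ a
        + ∑ i, pd i (fun z => p z q.2) q.1 ^ 2 / q.2 ^ a) (slab n b) := ipl.add ipp
  have hle : ∫ q : EuclideanSpace ℝ (Fin n) × ℝ,
      ((F q.1 q.2 - q.2 ^ a * lap (fun z => u z q.2) q.1) ^ 2 / q.2 ^ a
        + 2 * ∑ i, pd i (fun z => p z q.2) q.1 ^ 2 / q.2 ^ a) ∂slab n b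
      ≤ ∫ q : EuclideanSpace ℝ (Fin n) × ℝ, (F q.1 q.2 ^ 2 / q.2 ^ a
      - 2 * ((F q.1 q.2 - q.2 ^ a * lap (fun z => u z q.2) q.1) * lap (fun z => u z q.2) q.1
        + p q.1 q.2 * (lap (fun z => p z q.2) q.1 / q.2 ^ a))
      + 2 * (p q.1 q.2 * lap (fun z => p z q.2) q.1 / q.2 ^ a
        + ∑ i, pd i (fun z => p z q.2) q.1 ^ 2 / q.2 ^ a)) ∂slab n b := by
    refine integral_mono_ae itot (i1.fun_add (i2.const_mul 2)) ?_
    filter_upwards [ae_slab_mem b] with q hq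
    have hY : 0 < q.2 ^ a := Real.rpow_pos_of_pos (hb.trans hq.1) a
    have hpos : 0 ≤ q.2 ^ a * lap (fun z => u z q.2) q.1 ^ 2 := by positivity
    generalize ∑ i, pd i (fun z => p z q.2) q.1 ^ 2 / q.2 ^ a = S at *
    generalize lap (fun z => u z q.2) q.1 = l at *
    generalize lap (fun z => p z q.2) q.1 = m at *
    generalize q.2 ^ a = Y at *
    have e : F q.1 q.2 ^ 2 / Y - 2 * ((F q.1 q.2 - Y * l) * l + p q.1 q.2 * (m / Y))
        + 2 * (p q.1 q.2 * m / Y + S) = (F q.1 q.2 - Y * l) ^ 2 / Y + 2 * S + Y * l ^ 2 := by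
      field_simp
      ring
    simp only [e]
    linarith
  rw [integral_add i1 (i2.const_mul 2), integral_sub iF (ider.const_mul 2), integral_const_mul,
    integral_const_mul, hnull, hflux] at hle
  linarith

end IsTangentiallySmooth

end UpToBoundary

section UpToBoundary

namespace IsTangentiallySmooth

variable {n : ℕ} {a τ s b c : ℝ} {u p F : EuclideanSpace ℝ (Fin n) → ℝ → ℝ} {k : ℝ → ℝ}

lemma ofReal_integral_sq_F (h : IsTangentiallySmooth a u p F k)
    {G : EuclideanSpace ℝ (Fin n) → ℝ → ℝ}
    (hG : Continuous fun q : EuclideanSpace ℝ (Fin n) × ℝ => G q.1 q.2) (hG0 : ∀ z y, 0 ≤ G z y) :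
    ENNReal.ofReal (∫ q : EuclideanSpace ℝ (Fin n) × ℝ,
        G q.1 q.2 * (F q.1 q.2 ^ 2 / q.2 ^ a) ∂slab n 0)
      = ∫⁻ q : EuclideanSpace ℝ (Fin n) × ℝ,
        ENNReal.ofReal (G q.1 q.2 * (F q.1 q.2 ^ 2 / q.2 ^ a)) ∂slab n 0 := by
  refine ofReal_integral_eq_lintegral_ofReal (h.integrable_mul_sq_F hG) ?_
  filter_upwards [ae_slab_mem 0] with q hq
  have hy : 0 < q.2 := hq.1
  have := hG0 q.1 q.2
  simp only [Pi.zero_apply]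
  positivity

/-- Tangential regularity, with the weighted norm of the right-hand side as a Lebesgue integral. -/
lemma lintegral_sq_le' (h : IsTangentiallySmooth a u p F k) :
    ∫⁻ q : EuclideanSpace ℝ (Fin n) × ℝ,
      ENNReal.ofReal ((F q.1 q.2 - q.2 ^ a * lap (fun z => u z q.2) q.1) ^ 2 / q.2 ^ a
        + 2 * ∑ i, pd i (fun z => p z q.2) q.1 ^ 2 / q.2 ^ a) ∂slab n 0
      ≤ ∫⁻ q : EuclideanSpace ℝ (Fin n) × ℝ,
        ENNReal.ofReal (F q.1 q.2 ^ 2 / q.2 ^ a) ∂slab n 0 := by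
  have := h.ofReal_integral_sq_F (G := fun _ _ => 1) continuous_const fun _ _ => zero_le_one
  simp only [one_mul] at this
  exact this ▸ h.lintegral_sq_le

lemma lintegral_slice_le {f : EuclideanSpace ℝ (Fin n) × ℝ → ℝ≥0∞} (hf : Measurable f)
    (hb : 0 ≤ b) (hc : c ≤ 1 / 2) :
    ∫⁻ z, ∫⁻ t in Set.Ioc b c, f (z, t) ≤ ∫⁻ q, f q ∂slab n 0 := by
  rw [slab, lintegral_prod _ hf.aemeasurable]
  exact lintegral_mono fun z => lintegral_mono_set (Set.Ioc_subset_Ioc hb hc)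

/-- The conormal derivative is Hölder continuous in the normal variable with values in `L²`. -/
lemma lintegral_sq_sub_p_le (h : IsTangentiallySmooth a u p F k) (hb : 0 ≤ b) (hbc : b ≤ c)
    (hc : c ≤ 1 / 2) :
    ∫⁻ z, ENNReal.ofReal ((p z c - p z b) ^ 2)
      ≤ (∫⁻ t in Set.Ioc b c, ENNReal.ofReal (t ^ a))
        * ∫⁻ q : EuclideanSpace ℝ (Fin n) × ℝ, ENNReal.ofReal (F q.1 q.2 ^ 2 / q.2 ^ a)
          ∂slab n 0 := by
  have hF := h.measurable_F
  have hl := h.continuous_lap_u.measurable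
  have hm : Measurable fun q : EuclideanSpace ℝ (Fin n) × ℝ =>
      F q.1 q.2 - q.2 ^ a * lap (fun z => u z q.2) q.1 :=
    hF.sub ((measurable_snd.pow_const a).mul hl)
  have hm2 : Measurable fun q : EuclideanSpace ℝ (Fin n) × ℝ => ENNReal.ofReal
      ((F q.1 q.2 - q.2 ^ a * lap (fun z => u z q.2) q.1) ^ 2 / q.2 ^ a) :=
    ((hm.pow_const 2).div (measurable_snd.pow_const a)).ennreal_ofReal
  have h1 : ∀ z, ENNReal.ofReal ((p z c - p z b) ^ 2)
      ≤ (∫⁻ t in Set.Ioc b c, ENNReal.ofReal (t ^ a)) * ∫⁻ t in Set.Ioc b c, ENNReal.ofReal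
        ((F z t - t ^ a * lap (fun z => u z t) z) ^ 2 / t ^ a) := fun z => by
    obtain ⟨g, hg, hpg, hg'⟩ := h.p_sub z
    refine ofReal_sq_sub_le (g := p z) (h := fun t => F z t - t ^ a * lap (fun z => u z t) z)
      (w := fun t => t ^ a) hbc ?_
      (fun t ht => Real.rpow_pos_of_pos (hb.trans_lt ht.1) a) (by fun_prop)
      (hm.comp measurable_prodMk_left).aemeasurable
    rw [hpg]
    refine intervalIntegral.integral_congr_ae ?_
    filter_upwards [hg'] with t ht ht'
    rw [Set.uIoc_of_le hbc] at ht'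
    exact ht (hb.trans_lt ht'.1)
  refine (lintegral_mono h1).trans ?_
  rw [lintegral_const_mul _ hm2.lintegral_prod_right']
  refine mul_le_mul_right ((lintegral_slice_le hm2 hb hc).trans (le_trans ?_ h.lintegral_sq_le')) _
  refine lintegral_mono_ae ?_
  filter_upwards [ae_slab_mem 0] with q hq
  have hY : 0 < q.2 ^ a := Real.rpow_pos_of_pos hq.1 a
  have := Finset.sum_nonneg fun i (_ : i ∈ Finset.univ) =>
    div_nonneg (sq_nonneg (pd i (fun z => p z q.2) q.1)) hY.le
  refine ENNReal.ofReal_le_ofReal ?_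
  linarith

/-- The tangential gradient vanishes at the boundary in `L²`, at a rate. -/
lemma lintegral_sq_pd_u_le (h : IsTangentiallySmooth a u p F k) (ha : a ≤ 0) (i : Fin n)
    (hc : 0 ≤ c) (hc' : c ≤ 1 / 2) :
    ∫⁻ z, ENNReal.ofReal (pd i (fun z => u z c) z ^ 2)
      ≤ (∫⁻ t in Set.Ioc 0 c, ENNReal.ofReal (t ^ (-a)))
        * ∫⁻ q : EuclideanSpace ℝ (Fin n) × ℝ, ENNReal.ofReal (F q.1 q.2 ^ 2 / q.2 ^ a)
          ∂slab n 0 := by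
  have hpp := h.continuous_pd_p i
  have hm : Measurable fun q : EuclideanSpace ℝ (Fin n) × ℝ =>
      q.2 ^ (-a) * pd i (fun z => p z q.2) q.1 := (measurable_snd.pow_const _).mul hpp.measurable
  have hm2 : Measurable fun q : EuclideanSpace ℝ (Fin n) × ℝ => ENNReal.ofReal
      ((q.2 ^ (-a) * pd i (fun z => p z q.2) q.1) ^ 2 / q.2 ^ (-a)) :=
    ((hm.pow_const 2).div (measurable_snd.pow_const _)).ennreal_ofReal
  have h1 : ∀ z, ENNReal.ofReal (pd i (fun z => u z c) z ^ 2)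
      ≤ (∫⁻ t in Set.Ioc 0 c, ENNReal.ofReal (t ^ (-a))) * ∫⁻ t in Set.Ioc 0 c, ENNReal.ofReal
        ((t ^ (-a) * pd i (fun z => p z t) z) ^ 2 / t ^ (-a)) := fun z => by
    have e := ofReal_sq_sub_le (b := 0) (c := c) (g := fun t => pd i (fun z => u z t) z)
      (h := fun t => t ^ (-a) * pd i (fun z => p z t) z)
      (w := fun t => t ^ (-a)) hc ?_
      (fun t ht => Real.rpow_pos_of_pos ht.1 _) (by fun_prop)
      (hm.comp measurable_prodMk_left).aemeasurable
    · simpa only [h.pd_u_zero, sub_zero] using e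
    · symm
      have cp : Continuous fun t => pd i (fun z => p z t) z :=
        continuous_slice (g := fun z t => pd i (fun z => p z t) z) hpp z
      refine intervalIntegral.integral_eq_sub_of_hasDerivAt_of_le hc
        (continuous_slice (g := fun z t => pd i (fun z => u z t) z)
          (h.continuous_pd_u i) z).continuousOn (fun t ht => ?_)
        (intervalIntegrable_rpow_neg_mul ha cp _ _)
      refine (h.hasDerivAt_pd_u i z t ht.1).congr_deriv ?_
      rw [Real.rpow_neg ht.1.le]
      ring
  refine (lintegral_mono h1).trans ?_
  rw [lintegral_const_mul _ hm2.lintegral_prod_right']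
  refine mul_le_mul_right ((lintegral_slice_le hm2 le_rfl hc').trans
    (le_trans ?_ h.lintegral_sq_le')) _
  refine lintegral_mono_ae ?_
  filter_upwards [ae_slab_mem 0] with q hq
  have hY : 0 < q.2 ^ a := Real.rpow_pos_of_pos hq.1 a
  have h2 := Finset.single_le_sum (f := fun i => pd i (fun z => p z q.2) q.1 ^ 2 / q.2 ^ a)
    (fun i _ => div_nonneg (sq_nonneg _) hY.le) (Finset.mem_univ i)
  have h3 : 0 ≤ pd i (fun z => p z q.2) q.1 ^ 2 / q.2 ^ a := by positivity
  have h4 : 0 ≤ (F q.1 q.2 - q.2 ^ a * lap (fun z => u z q.2) q.1) ^ 2 / q.2 ^ a := by positivity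
  refine ENNReal.ofReal_le_ofReal ?_
  have e : (q.2 ^ (-a) * pd i (fun z => p z q.2) q.1) ^ 2 / q.2 ^ (-a)
      = pd i (fun z => p z q.2) q.1 ^ 2 / q.2 ^ a := by
    rw [Real.rpow_neg hq.1.le]
    field_simp
  rw [e]
  linarith

/-- The Carleman inequality with the Neumann data taken at height `c`. The error is uniform over
solutions with a bounded right-hand side and tends to zero with `c`. Weak solutions need this form,
since their conormal derivative is known on almost every slice only. -/
theorem carleman_of_height (h : IsTangentiallySmooth (1 - 2 * s) u p F k) (hs : 1 / 2 ≤ s)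
    (hs' : s < 1) (hτ : 4 ≤ τ) (hc : 0 ≤ c) (hc' : c ≤ 1 / 2) :
    ∫⁻ q : EuclideanSpace ℝ (Fin n) × ℝ, ENNReal.ofReal (energy τ s u p q.1 q.2) ∂slab n 0
      ≤ 3 * (∫⁻ q : EuclideanSpace ℝ (Fin n) × ℝ, ENNReal.ofReal
          (expWeight τ s q.1 q.2 ^ 2 * (F q.1 q.2 ^ 2 / q.2 ^ (1 - 2 * s))) ∂slab n 0
        + ENNReal.ofReal (8 * τ) * ((∫⁻ z, ENNReal.ofReal (expWeight τ s z 0 ^ 2 * p z c ^ 2))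
          + (∫⁻ t in Set.Ioc 0 c, ENNReal.ofReal (t ^ (1 - 2 * s)))
            * ∫⁻ q : EuclideanSpace ℝ (Fin n) × ℝ,
              ENNReal.ofReal (F q.1 q.2 ^ 2 / q.2 ^ (1 - 2 * s)) ∂slab n 0)) := by
  have hE := (continuous_expWeight (n := n) (τ := τ) hs').pow 2
  have hE0 : Continuous fun z : EuclideanSpace ℝ (Fin n) => expWeight τ s z 0 :=
    (contDiff_expWeight 0).continuous
  have hp := fun y => (h.contDiff_p y).continuous
  refine (h.carleman hs hs' hτ).trans ?_
  have hI : 0 ≤ ∫ q : EuclideanSpace ℝ (Fin n) × ℝ,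
      expWeight τ s q.1 q.2 ^ 2 * (F q.1 q.2 ^ 2 / q.2 ^ (1 - 2 * s)) ∂slab n 0 := by
    refine integral_nonneg_of_ae ?_
    filter_upwards [ae_slab_mem 0] with q hq
    have hy : 0 < q.2 := hq.1
    simp only [Pi.zero_apply]
    positivity
  rw [ENNReal.ofReal_mul (by norm_num), ENNReal.ofReal_add hI (by positivity),
    h.ofReal_integral_sq_F (G := fun z y => expWeight τ s z y ^ 2) hE fun z y => sq_nonneg _,
    ENNReal.ofReal_mul (by linarith)]
  have hi0 : Integrable fun z => expWeight τ s z 0 ^ 2 * p z 0 ^ 2 :=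
    integrable_of_continuous_of_eq_zero (R := 5 / 8) ((hE0.pow 2).mul ((hp 0).pow 2))
      fun z hz => by simp [h.p_eq_zero z 0 hz]
  rw [ofReal_integral_eq_lintegral_ofReal hi0 (Eventually.of_forall fun z => by positivity)]
  have hle : ∀ z, ENNReal.ofReal (expWeight τ s z 0 ^ 2 * p z 0 ^ 2)
      ≤ 2 * (ENNReal.ofReal (expWeight τ s z 0 ^ 2 * p z c ^ 2)
        + ENNReal.ofReal ((p z c - p z 0) ^ 2)) := fun z => by
    rw [← ENNReal.ofReal_add (by positivity) (by positivity), ← ENNReal.ofReal_ofNat,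
      ← ENNReal.ofReal_mul (by norm_num)]
    refine ENNReal.ofReal_le_ofReal ?_
    have h1 : expWeight τ s z 0 ^ 2 ≤ 1 := by
      refine pow_le_one₀ (expWeight_pos z 0).le ?_
      have h2 : 2 - 2 * s ≠ 0 := by linarith
      rw [expWeight, weight, Real.exp_le_one_iff]
      simp only [Real.zero_rpow h2]
      have : 0 ≤ ‖z‖ ^ 2 := sq_nonneg _
      nlinarith
    have h3 : p z 0 ^ 2 ≤ 2 * p z c ^ 2 + 2 * (p z c - p z 0) ^ 2 := by
      nlinarith [sq_nonneg (2 * p z c - p z 0)]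
    have h4 := mul_le_mul_of_nonneg_left h3 (sq_nonneg (expWeight τ s z 0))
    have h5 := mul_le_mul_of_nonneg_right h1 (sq_nonneg (p z c - p z 0))
    linarith
  have hm : Measurable fun z => ENNReal.ofReal (expWeight τ s z 0 ^ 2 * p z c ^ 2) :=
    ((hE0.pow 2).mul ((hp c).pow 2)).measurable.ennreal_ofReal
  have hsum : ∫⁻ z, ENNReal.ofReal (expWeight τ s z 0 ^ 2 * p z 0 ^ 2)
      ≤ 2 * ((∫⁻ z, ENNReal.ofReal (expWeight τ s z 0 ^ 2 * p z c ^ 2))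
        + (∫⁻ t in Set.Ioc 0 c, ENNReal.ofReal (t ^ (1 - 2 * s)))
            * ∫⁻ q : EuclideanSpace ℝ (Fin n) × ℝ,
              ENNReal.ofReal (F q.1 q.2 ^ 2 / q.2 ^ (1 - 2 * s)) ∂slab n 0) := by
    refine (lintegral_mono hle).trans ?_
    rw [lintegral_const_mul' _ _ (by norm_num), lintegral_add_left hm]
    gcongr
    exact h.lintegral_sq_sub_p_le le_rfl hc hc'
  have e8 : ENNReal.ofReal (8 * τ) = ENNReal.ofReal (4 * τ) * 2 := by
    rw [← ENNReal.ofReal_ofNat 2, ← ENNReal.ofReal_mul (by linarith)]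
    ring_nf
  rw [e8, mul_assoc (ENNReal.ofReal (4 * τ)), ENNReal.ofReal_ofNat]
  gcongr

end IsTangentiallySmooth

end UpToBoundary

/-! ### Mollification in the tangential variables -/

section Mollification

variable {n : ℕ}

/-- The tangential convolution `θ * k`. -/
noncomputable def moll (θ k : EuclideanSpace ℝ (Fin n) → ℝ) (z : EuclideanSpace ℝ (Fin n)) : ℝ :=
  ∫ x, θ (z - x) * k x

/-- A smooth function supported in the ball of radius `1/8`. -/
structure IsMollifier (θ : EuclideanSpace ℝ (Fin n) → ℝ) : Prop where
  contDiff : ContDiff ℝ ∞ θ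
  eq_zero : ∀ z, 1 / 8 < ‖z‖ → θ z = 0

variable {θ k : EuclideanSpace ℝ (Fin n) → ℝ}

namespace IsMollifier

lemma pd (hθ : IsMollifier θ) (i : Fin n) : IsMollifier (pd i θ) where
  contDiff := contDiff_pd hθ.contDiff (by simp) i
  eq_zero _ hz := pd_eq_zero_of_eq_zero hθ.eq_zero i hz

lemma lap (hθ : IsMollifier θ) : IsMollifier (lap θ) where
  contDiff := ContDiff.sum fun i _ => ((hθ.pd i).pd i).contDiff
  eq_zero _ hz := lap_eq_zero_of_eq_zero hθ.eq_zero hz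

lemma contDiff_nat (hθ : IsMollifier θ) (m : ℕ) : ContDiff ℝ m θ :=
  hθ.contDiff.of_le (by exact_mod_cast le_top)

lemma continuous (hθ : IsMollifier θ) : Continuous θ := hθ.contDiff.continuous

lemma hasCompactSupport (hθ : IsMollifier θ) : HasCompactSupport θ :=
  HasCompactSupport.intro (isCompact_closedBall 0 (1 / 8)) fun z hz =>
    hθ.eq_zero z (by simpa using hz)

lemma exists_bound (hθ : IsMollifier θ) : ∃ C, 0 ≤ C ∧ ∀ z, |θ z| ≤ C := by
  obtain ⟨C, hC⟩ := hθ.hasCompactSupport.exists_bound_of_continuous hθ.continuous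
  exact ⟨C, (norm_nonneg _).trans (hC 0), hC⟩

lemma pd_lap (hθ : IsMollifier θ) (i : Fin n) : Carleman.pd i (Carleman.lap θ)
    = Carleman.lap (Carleman.pd i θ) := by
  funext z
  have h1 : ∀ j, DifferentiableAt ℝ (Carleman.pd j (Carleman.pd j θ)) z := fun j =>
    (((hθ.pd j).pd j).contDiff_nat 1).differentiable (by norm_num) |>.differentiableAt
  show Carleman.pd i (fun z => ∑ j, Carleman.pd j (Carleman.pd j θ) z) z = _
  rw [pd_sum _ fun j _ => h1 j]
  refine Finset.sum_congr rfl fun j _ => ?_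
  rw [pd_pd_comm (by exact_mod_cast (hθ.pd j).contDiff_nat 2)]
  have e : Carleman.pd i (Carleman.pd j θ) = Carleman.pd j (Carleman.pd i θ) :=
    funext fun x => pd_pd_comm (by exact_mod_cast hθ.contDiff_nat 2) i j
  rw [e]

end IsMollifier

lemma moll_eq_convolution :
    moll θ k = convolution k θ (ContinuousLinearMap.mul ℝ ℝ) volume := by
  funext z
  simp only [moll, convolution_def, ContinuousLinearMap.mul_apply']
  exact integral_congr_ae (Eventually.of_forall fun x => mul_comm _ _)

lemma contDiff_moll (hθ : IsMollifier θ) (hk : Integrable k) (m : ℕ) :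
    ContDiff ℝ m (moll θ k) := by
  rw [moll_eq_convolution]
  exact_mod_cast hθ.hasCompactSupport.contDiff_convolution_right _ hk.locallyIntegrable
    (n := (m : ℕ∞)) (by exact_mod_cast hθ.contDiff_nat m)

lemma pd_moll (hθ : IsMollifier θ) (hk : Integrable k) (i : Fin n) :
    pd i (moll θ k) = moll (pd i θ) k := by
  funext z
  have h1 : ContDiff ℝ 1 θ := by exact_mod_cast hθ.contDiff_nat 1
  have h := hθ.hasCompactSupport.hasFDerivAt_convolution_right (ContinuousLinearMap.mul ℝ ℝ)
    hk.locallyIntegrable h1 z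
  rw [pd, moll_eq_convolution, h.fderiv, convolution_precompR_apply _ hk.locallyIntegrable
    (hθ.hasCompactSupport.fderiv ℝ) (h1.continuous_fderiv one_ne_zero), moll_eq_convolution]
  rfl

lemma lap_moll (hθ : IsMollifier θ) (hk : Integrable k) :
    lap (moll θ k) = moll (lap θ) k := by
  funext z
  simp only [lap, pd_moll hθ hk, fun i => pd_moll (hθ.pd i) hk, moll, Finset.sum_mul]
  rw [integral_finsetSum]
  intro i _
  obtain ⟨C, -, hC⟩ := ((hθ.pd i).pd i).exists_bound
  exact hk.bdd_mul (((hθ.pd i).pd i).continuous.comp (by fun_prop)).aestronglyMeasurable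
    (c := C) (Eventually.of_forall fun x => hC _)

lemma moll_eq_zero (hθ : IsMollifier θ) (hk : ∀ x, 1 / 2 < ‖x‖ → k x = 0)
    {z : EuclideanSpace ℝ (Fin n)} (hz : 5 / 8 < ‖z‖) : moll θ k z = 0 := by
  refine integral_eq_zero_of_ae (Eventually.of_forall fun x => ?_)
  by_cases hx : 1 / 2 < ‖x‖
  · simp [hk x hx]
  · have : 1 / 8 < ‖z - x‖ := by
      have := norm_sub_norm_le z x
      linarith [not_lt.1 hx]
    simp [hθ.eq_zero _ this]

end Mollification

/-! ### Integral operators in the normal variable -/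

section Kernel

variable {n : ℕ} {κ : ℝ → ℝ → ℝ} {h : EuclideanSpace ℝ (Fin n) × ℝ → ℝ}
  {θ : EuclideanSpace ℝ (Fin n) → ℝ} {a : ℝ}

/-- The integral operator in the normal variable with kernel `κ`, combined with the tangential
convolution with `θ`. -/
noncomputable def kernelIntegral (κ : ℝ → ℝ → ℝ) (h : EuclideanSpace ℝ (Fin n) × ℝ → ℝ)
    (θ : EuclideanSpace ℝ (Fin n) → ℝ) (z : EuclideanSpace ℝ (Fin n)) (y : ℝ) : ℝ :=
  ∫ q : EuclideanSpace ℝ (Fin n) × ℝ, θ (z - q.1) * (κ y q.2 * h q)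

/-- Kernels that are bounded and almost everywhere continuous in the parameter. -/
structure IsKernel (κ : ℝ → ℝ → ℝ) : Prop where
  measurable : ∀ y, Measurable (κ y)
  abs_le : ∀ y, ∀ r ∈ Set.Ioc (0 : ℝ) (1 / 2), |κ y r| ≤ 1
  continuousAt : ∀ y, ∀ᵐ r, ContinuousAt (fun t => κ t r) y

/-- Integrable functions supported in `{|x| ≤ 1/2, 0 < y ≤ 1/2}`. -/
structure IsSource (h : EuclideanSpace ℝ (Fin n) × ℝ → ℝ) : Prop where
  integrable : Integrable h
  eq_zero_of_lt : ∀ q, 1 / 2 < ‖q.1‖ → h q = 0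
  eq_zero : ∀ q, q.2 ∉ Set.Ioc (0 : ℝ) (1 / 2) → h q = 0

lemma IsKernel.abs_mul_le (hκ : IsKernel κ) (hh : IsSource h) (y : ℝ)
    (q : EuclideanSpace ℝ (Fin n) × ℝ) : |κ y q.2 * h q| ≤ |h q| := by
  by_cases hq : q.2 ∈ Set.Ioc (0 : ℝ) (1 / 2)
  · rw [abs_mul]
    exact mul_le_of_le_one_left (abs_nonneg _) (hκ.abs_le y _ hq)
  · simp [hh.eq_zero q hq]

lemma IsKernel.integrable_mul (hκ : IsKernel κ) (hh : IsSource h) (y : ℝ) :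
    Integrable fun q : EuclideanSpace ℝ (Fin n) × ℝ => κ y q.2 * h q :=
  hh.integrable.mono (((hκ.measurable y).comp measurable_snd).aestronglyMeasurable.mul
    hh.integrable.aestronglyMeasurable) (Eventually.of_forall fun q => hκ.abs_mul_le hh y q)

lemma IsMollifier.integrable_mul (hθ : IsMollifier θ) (hh : Integrable h)
    (z : EuclideanSpace ℝ (Fin n)) :
    Integrable fun q : EuclideanSpace ℝ (Fin n) × ℝ => θ (z - q.1) * h q := by
  obtain ⟨C, -, hC⟩ := hθ.exists_bound
  exact hh.bdd_mul (hθ.continuous.comp (by fun_prop)).aestronglyMeasurable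
    (c := C) (Eventually.of_forall fun x => hC _)

lemma kernelIntegral_eq_moll (hκ : IsKernel κ) (hh : IsSource h) (hθ : IsMollifier θ) (y : ℝ) :
    (fun z => kernelIntegral κ h θ z y) = moll θ fun x => ∫ r, κ y r * h (x, r) := by
  funext z
  rw [kernelIntegral, Measure.volume_eq_prod, integral_prod _
    (hθ.integrable_mul (hκ.integrable_mul hh y) z)]
  simp only [integral_const_mul, moll]

lemma integrable_marginal (hκ : IsKernel κ) (hh : IsSource h) (y : ℝ) :
    Integrable fun x : EuclideanSpace ℝ (Fin n) => ∫ r, κ y r * h (x, r) :=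
  (hκ.integrable_mul hh y).integral_prod_left

lemma contDiff_kernelIntegral (hκ : IsKernel κ) (hh : IsSource h) (hθ : IsMollifier θ) (y : ℝ)
    (m : ℕ) : ContDiff ℝ m fun z => kernelIntegral κ h θ z y := by
  rw [kernelIntegral_eq_moll hκ hh hθ]
  exact contDiff_moll hθ (integrable_marginal hκ hh y) m

lemma pd_kernelIntegral (hκ : IsKernel κ) (hh : IsSource h) (hθ : IsMollifier θ) (y : ℝ)
    (i : Fin n) (z : EuclideanSpace ℝ (Fin n)) :
    pd i (fun z => kernelIntegral κ h θ z y) z = kernelIntegral κ h (pd i θ) z y := by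
  rw [kernelIntegral_eq_moll hκ hh hθ, pd_moll hθ (integrable_marginal hκ hh y),
    ← kernelIntegral_eq_moll hκ hh (hθ.pd i)]

lemma lap_kernelIntegral (hκ : IsKernel κ) (hh : IsSource h) (hθ : IsMollifier θ) (y : ℝ)
    (z : EuclideanSpace ℝ (Fin n)) :
    lap (fun z => kernelIntegral κ h θ z y) z = kernelIntegral κ h (lap θ) z y := by
  rw [kernelIntegral_eq_moll hκ hh hθ, lap_moll hθ (integrable_marginal hκ hh y),
    ← kernelIntegral_eq_moll hκ hh hθ.lap]

lemma kernelIntegral_eq_zero (hh : IsSource h) (hθ : IsMollifier θ)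
    (z : EuclideanSpace ℝ (Fin n)) (y : ℝ) (hz : 5 / 8 < ‖z‖) : kernelIntegral κ h θ z y = 0 := by
  refine integral_eq_zero_of_ae (Eventually.of_forall fun x => ?_)
  by_cases hx : 1 / 2 < ‖x.1‖
  · simp [hh.eq_zero_of_lt x hx]
  · have : 1 / 8 < ‖z - x.1‖ := by
      have := norm_sub_norm_le z x.1
      linarith [not_lt.1 hx]
    simp [hθ.eq_zero _ this]

lemma kernelIntegral_eq_zero_of_kernel (hh : IsSource h) (z : EuclideanSpace ℝ (Fin n)) (y : ℝ)
    (hκ : ∀ r ∈ Set.Ioc (0 : ℝ) (1 / 2), κ y r = 0) : kernelIntegral κ h θ z y = 0 := by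
  refine integral_eq_zero_of_ae (Eventually.of_forall fun x => ?_)
  by_cases hx : x.2 ∈ Set.Ioc (0 : ℝ) (1 / 2)
  · simp [hκ _ hx]
  · simp [hh.eq_zero x hx]

lemma continuous_kernelIntegral (hκ : IsKernel κ) (hh : IsSource h) (hθ : IsMollifier θ) :
    Continuous fun x : EuclideanSpace ℝ (Fin n) × ℝ => kernelIntegral κ h θ x.1 x.2 := by
  obtain ⟨C, hC0, hC⟩ := hθ.exists_bound
  refine continuous_iff_continuousAt.2 fun x₀ => ?_
  refine continuousAt_of_dominated (bound := fun q => C * |h q|)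
    (Eventually.of_forall fun x => (hθ.integrable_mul (hκ.integrable_mul hh x.2)
      x.1).aestronglyMeasurable) (Eventually.of_forall fun x => Eventually.of_forall fun q => ?_)
    (hh.integrable.abs.const_mul C) ?_
  · rw [norm_mul]
    exact mul_le_mul (hC _) (hκ.abs_mul_le hh _ _) (norm_nonneg _) hC0
  · have := (Measure.quasiMeasurePreserving_snd (μ := (volume : Measure (EuclideanSpace ℝ (Fin n))))
      (ν := (volume : Measure ℝ))).ae (hκ.continuousAt x₀.2)
    rw [← Measure.volume_eq_prod] at this
    filter_upwards [this] with q hq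
    have h1 : Continuous fun x : EuclideanSpace ℝ (Fin n) × ℝ => θ (x.1 - q.1) :=
      hθ.continuous.comp (by fun_prop)
    have h2 : ContinuousAt (fun x : EuclideanSpace ℝ (Fin n) × ℝ => κ x.2 q.2) x₀ :=
      ContinuousAt.comp (f := Prod.snd) (x := x₀) hq continuousAt_snd
    exact h1.continuousAt.mul (h2.mul continuousAt_const)

/-- The kernel of the operator `h ↦ -∫_y^∞ h`. -/
noncomputable def tailKernel (y r : ℝ) : ℝ := if y < r then -1 else 0

/-- The kernel of the operator `h ↦ ∫_y^∞ t^{-a} ∫_t^∞ h`. The truncation of `y` at zero makes it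
continuous in `y` on the whole line. -/
noncomputable def doubleTailKernel (a y r : ℝ) : ℝ :=
  max 0 (r ^ (1 - a) - max 0 y ^ (1 - a)) / (1 - a)

lemma isKernel_tailKernel : IsKernel tailKernel where
  measurable y := Measurable.ite (measurableSet_lt measurable_const measurable_id)
    measurable_const measurable_const
  abs_le y r _ := by
    unfold tailKernel
    split_ifs <;> simp
  continuousAt y := by
    have : ∀ᵐ r : ℝ, r ≠ y := by simp [ae_iff, measure_singleton]
    filter_upwards [this] with r hr
    rcases lt_or_gt_of_ne hr with h | h
    · refine (continuousAt_const (y := (0 : ℝ))).congr ?_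
      filter_upwards [lt_mem_nhds h] with t ht
      simp [tailKernel, ht.le]
    · refine (continuousAt_const (y := (-1 : ℝ))).congr ?_
      filter_upwards [gt_mem_nhds h] with t ht
      simp [tailKernel, ht]

lemma isKernel_doubleTailKernel (ha : a ≤ 0) : IsKernel (doubleTailKernel a) where
  measurable y := by
    unfold doubleTailKernel
    fun_prop
  abs_le y r hr := by
    have h1 : r ^ (1 - a) ≤ 1 := Real.rpow_le_one hr.1.le (by linarith [hr.2]) (by linarith)
    have h2 : 0 ≤ max 0 y ^ (1 - a) := Real.rpow_nonneg (le_max_left _ _) _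
    have h3 : max 0 (r ^ (1 - a) - max 0 y ^ (1 - a)) ≤ 1 := max_le zero_le_one (by linarith)
    have h4 : 0 ≤ max 0 (r ^ (1 - a) - max 0 y ^ (1 - a)) := le_max_left _ _
    rw [doubleTailKernel, abs_of_nonneg (div_nonneg h4 (by linarith)), div_le_one (by linarith)]
    linarith
  continuousAt y := Eventually.of_forall fun r => by
    have h1 : Continuous fun t : ℝ => max 0 t ^ (1 - a) :=
      (by fun_prop : Continuous fun t : ℝ => max 0 t).rpow_const fun _ => Or.inr (by linarith)
    unfold doubleTailKernel
    exact ((continuous_const.max (continuous_const.sub h1)).div_const _).continuousAt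

lemma hasDerivAt_doubleTailKernel (ha : a ≤ 0) {y r : ℝ} (hy : 0 < y) (hr : 0 < r) (h : r ≠ y) :
    HasDerivAt (fun t => doubleTailKernel a t r) (tailKernel y r / y ^ a) y := by
  have ha' : 0 < 1 - a := by linarith
  rcases lt_or_gt_of_ne h with h | h
  · have e : tailKernel y r / y ^ a = 0 := by simp [tailKernel, h.le]
    rw [e]
    refine (hasDerivAt_const y (0 : ℝ)).congr_of_eventuallyEq ?_
    filter_upwards [lt_mem_nhds h, lt_mem_nhds hy] with t ht ht0
    have : r ^ (1 - a) ≤ t ^ (1 - a) := Real.rpow_le_rpow hr.le (le_of_lt ht) ha'.le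
    rw [doubleTailKernel, max_eq_right ht0.le, max_eq_left (by linarith), zero_div]
  · have h1 := (((Real.hasDerivAt_rpow_const (x := y) (p := 1 - a) (Or.inl hy.ne')).const_sub
      (r ^ (1 - a))).div_const (1 - a))
    have e : -((1 - a) * y ^ (1 - a - 1)) / (1 - a) = tailKernel y r / y ^ a := by
      rw [tailKernel, if_pos h, show 1 - a - 1 = -a by ring, Real.rpow_neg hy.le]
      field_simp
    rw [e] at h1
    refine h1.congr_of_eventuallyEq ?_
    filter_upwards [gt_mem_nhds h, lt_mem_nhds hy] with t ht ht0
    have : t ^ (1 - a) ≤ r ^ (1 - a) := Real.rpow_le_rpow ht0.le (le_of_lt ht) ha'.le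
    rw [doubleTailKernel, max_eq_right ht0.le, max_eq_right (by linarith)]

lemma lipschitzOnWith_doubleTailKernel (ha : a ≤ 0) {r : ℝ} :
    LipschitzOnWith 1 (fun t => doubleTailKernel a t r) (Set.Ioo 0 1) := by
  have ha' : 0 < 1 - a := by linarith
  have h1 : LipschitzOnWith 1 (fun t : ℝ => (r ^ (1 - a) - t ^ (1 - a)) / (1 - a))
      (Set.Ioo 0 1) := by
    refine (convex_Ioo 0 1).lipschitzOnWith_of_nnnorm_hasDerivWithin_le
      (f' := fun t => -((1 - a) * t ^ (1 - a - 1)) / (1 - a)) (fun t ht =>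
        (((Real.hasDerivAt_rpow_const (x := t) (p := 1 - a) (Or.inl ht.1.ne')).const_sub
          (r ^ (1 - a))).div_const (1 - a)).hasDerivWithinAt) fun t ht => ?_
    rw [← NNReal.coe_le_coe, coe_nnnorm, Real.norm_eq_abs, neg_div, abs_neg,
      mul_div_cancel_left₀ _ ha'.ne', abs_of_nonneg (Real.rpow_nonneg ht.1.le _)]
    exact Real.rpow_le_one ht.1.le ht.2.le (by linarith)
  have h2 : LipschitzWith 1 fun t : ℝ => max 0 t :=
    LipschitzWith.id.const_max 0
  have h3 := h2.comp_lipschitzOnWith h1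
  rw [one_mul] at h3
  intro t ht t' ht'
  have e : ∀ t ∈ Set.Ioo (0 : ℝ) 1, doubleTailKernel a t r
      = max 0 ((r ^ (1 - a) - t ^ (1 - a)) / (1 - a)) := fun t ht => by
    rw [doubleTailKernel, max_eq_right ht.1.le, ← max_div_div_right ha'.le, zero_div]
  simp only [e t ht, e t' ht']
  exact h3 ht ht'

/-- `kernelIntegral (doubleTailKernel a) h` is a second primitive of `h`, with the weight `y^a`
between the two integrations. -/
lemma hasDerivAt_kernelIntegral (ha : a ≤ 0) (hh : IsSource h) (hθ : IsMollifier θ)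
    (z : EuclideanSpace ℝ (Fin n)) {y : ℝ} (hy : 0 < y) :
    HasDerivAt (kernelIntegral (doubleTailKernel a) h θ z)
      (kernelIntegral tailKernel h θ z y / y ^ a) y := by
  obtain hy1 | hy1 := le_or_gt 1 y
  · -- above the support everything vanishes
    have h0 : kernelIntegral tailKernel h θ z y / y ^ a = 0 := by
      rw [kernelIntegral_eq_zero_of_kernel hh, zero_div]
      intro r hr
      simp [tailKernel, (by linarith [hr.2] : r ≤ y)]
    rw [h0]
    refine (hasDerivAt_const y (0 : ℝ)).congr_of_eventuallyEq ?_
    filter_upwards [lt_mem_nhds (by linarith : 1 / 2 < y)] with t ht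
    refine kernelIntegral_eq_zero_of_kernel hh _ _ fun r hr => ?_
    have ht0 : 0 < t := lt_trans (by norm_num) ht
    have : r ^ (1 - a) ≤ t ^ (1 - a) :=
      Real.rpow_le_rpow hr.1.le (hr.2.trans (le_of_lt ht)) (by linarith)
    rw [doubleTailKernel, max_eq_right ht0.le, max_eq_left (by linarith), zero_div]
  obtain ⟨C, hC0, hC⟩ := hθ.exists_bound
  have hκ := isKernel_doubleTailKernel ha
  have key := hasDerivAt_integral_of_dominated_loc_of_lip (x₀ := y) (s := Set.Ioo 0 1)
    (μ := (volume : Measure (EuclideanSpace ℝ (Fin n) × ℝ)))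
    (F := fun t q => θ (z - q.1) * (doubleTailKernel a t q.2 * h q))
    (F' := fun q => θ (z - q.1) * (tailKernel y q.2 / y ^ a * h q))
    (bound := fun q => C * |h q|) (Ioo_mem_nhds hy hy1)
    (Eventually.of_forall fun t =>
      (hθ.integrable_mul (hκ.integrable_mul hh t) z).aestronglyMeasurable)
    (hθ.integrable_mul (hκ.integrable_mul hh y) z) ?_ ?_ (hh.integrable.abs.const_mul C) ?_
  · refine key.2.congr_deriv ?_
    rw [kernelIntegral, div_eq_mul_inv, ← integral_mul_const]
    exact integral_congr_ae (Eventually.of_forall fun q => by ring)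
  · have := ((hθ.integrable_mul (isKernel_tailKernel.integrable_mul hh y) z).mul_const
      (y ^ a)⁻¹).aestronglyMeasurable
    refine this.congr (Eventually.of_forall fun q => ?_)
    simp only
    ring
  · refine Eventually.of_forall fun q t ht t' ht' => ?_
    have h1 := lipschitzOnWith_doubleTailKernel (r := q.2) ha ht ht'
    rw [edist_dist, edist_dist, ENNReal.coe_one, one_mul,
      ENNReal.ofReal_le_ofReal_iff dist_nonneg] at h1
    rw [edist_dist, edist_dist, ENNReal.coe_nnreal_eq, ← ENNReal.ofReal_mul (by positivity)]
    refine ENNReal.ofReal_le_ofReal ?_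
    simp only [Real.dist_eq, Real.coe_nnabs] at h1 ⊢
    rw [← mul_sub, ← sub_mul, abs_mul, abs_mul, abs_mul, abs_of_nonneg hC0, abs_abs]
    calc _ ≤ C * (|t - t'| * |h q|) := by
          gcongr
          exact hC _
      _ = _ := by ring
  · have hne : ∀ᵐ r : ℝ, r ≠ y := by simp [ae_iff, measure_singleton]
    have := (Measure.quasiMeasurePreserving_snd (μ := (volume : Measure (EuclideanSpace ℝ (Fin n))))
      (ν := (volume : Measure ℝ))).ae hne
    rw [← Measure.volume_eq_prod] at this
    filter_upwards [this] with q hq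
    by_cases hq2 : q.2 ∈ Set.Ioc (0 : ℝ) (1 / 2)
    · exact ((hasDerivAt_doubleTailKernel ha hy hq2.1 hq).mul_const _).const_mul _
    · simp only [hh.eq_zero q hq2, mul_zero]
      exact hasDerivAt_const _ _

/-- The increments of `kernelIntegral tailKernel h`. -/
lemma kernelIntegral_tailKernel_sub (hh : IsSource h) (hθ : IsMollifier θ)
    (z : EuclideanSpace ℝ (Fin n)) (b c : ℝ) :
    kernelIntegral tailKernel h θ z c - kernelIntegral tailKernel h θ z b
      = ∫ t in b..c, moll θ (fun x => h (x, t)) z := by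
  have hi := hθ.integrable_mul hh.integrable z
  rw [Measure.volume_eq_prod] at hi
  have hi' : Integrable fun t => moll θ (fun x => h (x, t)) z := hi.integral_prod_right
  have e : ∀ y, kernelIntegral tailKernel h θ z y
      = -∫ t in Set.Ioi y, moll θ (fun x => h (x, t)) z := fun y => by
    have hk := hθ.integrable_mul (isKernel_tailKernel.integrable_mul hh y) z
    rw [Measure.volume_eq_prod] at hk
    rw [kernelIntegral, Measure.volume_eq_prod, integral_prod_symm _ hk, ← integral_neg,
      ← integral_indicator measurableSet_Ioi]
    refine integral_congr_ae (Eventually.of_forall fun t => ?_)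
    simp only [Set.indicator, Set.mem_Ioi, tailKernel]
    split_ifs with ht
    · rw [moll, ← integral_neg]
      exact integral_congr_ae (Eventually.of_forall fun x => by simp)
    · simp
  rw [e, e, ← intervalIntegral.integral_Ioi_sub_Ioi' hi'.integrableOn hi'.integrableOn]
  ring

end Kernel

/-! ### Weak derivatives in the normal variable -/

section DuBoisReymond

/-- Test functions on the half-line `(0, ∞)`. -/
structure IsNormalTest (χ : ℝ → ℝ) : Prop where
  contDiff : ContDiff ℝ ∞ χ
  hasCompactSupport : HasCompactSupport χ
  tsupport_subset : tsupport χ ⊆ Set.Ioi 0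

lemma IsNormalTest.exists_pos {χ : ℝ → ℝ} (h : IsNormalTest χ) :
    ∃ b > 0, ∀ y ≤ b, χ y = 0 := by
  have h0 : (0 : ℝ) ∈ (tsupport χ)ᶜ := fun h' => lt_irrefl (0 : ℝ) (h.tsupport_subset h')
  obtain ⟨ε, hε, hb⟩ := Metric.isOpen_iff.1 (isClosed_tsupport χ).isOpen_compl 0 h0
  refine ⟨ε / 2, by positivity, fun y hy => image_eq_zero_of_notMem_tsupport fun h' => ?_⟩
  have hy0 : 0 < y := h.tsupport_subset h'
  refine hb ?_ h'
  rw [Metric.mem_ball, Real.dist_eq, sub_zero, abs_of_pos hy0]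
  linarith

lemma IsNormalTest.of_eq_zero {χ : ℝ → ℝ} (h : ContDiff ℝ ∞ χ) {b c : ℝ} (hb : 0 < b)
    (h0 : ∀ y ≤ b, χ y = 0) (h1 : ∀ y, c ≤ y → χ y = 0) : IsNormalTest χ := by
  have hs : Function.support χ ⊆ Set.Icc b c := fun y hy => by
    by_contra hn
    rw [Set.mem_Icc, not_and_or, not_le, not_le] at hn
    exact hy (hn.elim (fun h => h0 y h.le) fun h => h1 y h.le)
  have ht : tsupport χ ⊆ Set.Icc b c := closure_minimal hs isClosed_Icc
  exact ⟨h, isCompact_Icc.of_isClosed_subset (isClosed_tsupport χ) ht,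
    ht.trans fun y hy => hb.trans_le hy.1⟩

lemma IsNormalTest.rpow_mul {χ : ℝ → ℝ} (h : IsNormalTest χ) (a : ℝ) :
    IsNormalTest fun y => y ^ a * χ y := by
  obtain ⟨b, hb, hb0⟩ := h.exists_pos
  have hsub : tsupport (fun y => y ^ a * χ y) ⊆ tsupport χ := tsupport_mul_subset_right
  refine ⟨contDiff_iff_contDiffAt.2 fun y => ?_, h.hasCompactSupport.mul_left,
    hsub.trans h.tsupport_subset⟩
  rcases lt_or_ge y b with hy | hy
  · refine (contDiffAt_const (c := (0 : ℝ))).congr_of_eventuallyEq ?_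
    filter_upwards [gt_mem_nhds hy] with t ht
    rw [hb0 t (le_of_lt ht), mul_zero]
  · exact (Real.contDiffAt_rpow_const_of_ne (hb.trans_le hy).ne').mul h.contDiff.contDiffAt

/-- A function on the half-line that vanishes above `1/2` is determined by its weak derivative. -/
lemma ae_eq_of_forall_test {g h V : ℝ → ℝ} (hg : Integrable g) (hh : Integrable h)
    (hg0 : ∀ y, 1 / 2 < y → g y = 0) (hh0 : ∀ y, 1 / 2 < y → h y = 0)
    (hV0 : ∀ y, 1 / 2 ≤ y → V y = 0)
    (hV : ∀ b c, 0 < b → 0 < c → V c - V b = ∫ t in b..c, h t)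
    (hweak : ∀ χ, IsNormalTest χ → ∫ y, deriv χ y * g y = -∫ y, χ y * h y) :
    ∀ᵐ y, 0 < y → g y = V y := by
  obtain ⟨V', hV'⟩ : ∃ V' : ℝ → ℝ, V' = fun y => ∫ t in (1 : ℝ)..y, h t := ⟨_, rfl⟩
  have hVV : ∀ y, 0 < y → V y = V' y := fun y hy => by
    rw [hV']
    simp only
    rw [← hV 1 y one_pos hy, hV0 1 (by norm_num), sub_zero]
  have hcV : Continuous V' := by
    rw [hV']
    exact intervalIntegral.continuous_primitive (fun _ _ => hh.intervalIntegrable) _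
  have hdV : ∀ᵐ y, HasDerivAt V' (h y) y := by
    filter_upwards [LocallyIntegrable.ae_hasDerivAt_integral hh.locallyIntegrable] with y hy
    rw [hV']
    exact hy 1
  have key : ∀ᵐ y, y ∈ Set.Ioi (0 : ℝ) → (fun y => g y - V' y) y = 0 := by
    refine isOpen_Ioi.ae_eq_zero_of_integral_contDiff_smul_eq_zero
      ((hg.locallyIntegrable.sub hcV.locallyIntegrable).locallyIntegrableOn _)
      fun ρ hρ hρc hρs => ?_
    have hρt : IsNormalTest ρ := ⟨hρ, hρc, hρs⟩
    obtain ⟨b, hb, hb0⟩ := hρt.exists_pos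
    obtain ⟨R, hR⟩ : ∃ R : ℝ → ℝ, R = fun y => ∫ t in (0 : ℝ)..y, ρ t := ⟨_, rfl⟩
    have hdR : ∀ y, HasDerivAt R (ρ y) y := fun y => by
      rw [hR]
      exact intervalIntegral.integral_hasDerivAt_right (hρ.continuous.intervalIntegrable _ _)
        (hρ.continuous.stronglyMeasurableAtFilter _ _) hρ.continuous.continuousAt
    have hR0 : ∀ y ≤ b, R y = 0 := fun y hy => by
      rw [hR]
      refine intervalIntegral.integral_zero_ae (Eventually.of_forall fun t ht => hb0 t ?_)
      exact (Set.uIoc_subset_uIcc ht).2.trans (max_le hb.le hy)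
    have hRs : ContDiff ℝ ∞ R := by
      refine contDiff_infty_iff_deriv.2 ⟨fun y => (hdR y).differentiableAt, ?_⟩
      rwa [show deriv R = ρ from funext fun y => (hdR y).deriv]
    -- a primitive of `ρ`, cut off above the supports of `g` and `h`
    obtain ⟨χ, hχ⟩ : ∃ χ : ℝ → ℝ, χ = fun y => Real.smoothTransition (2 - 2 * y) * R y :=
      ⟨_, rfl⟩
    have hχs : ContDiff ℝ ∞ χ := by
      rw [hχ]
      exact (Real.smoothTransition.contDiff.comp (by fun_prop)).mul hRs
    have hχb : ∀ y ≤ b, χ y = 0 := fun y hy => by rw [hχ]; simp [hR0 y hy]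
    have hχt : IsNormalTest χ := .of_eq_zero hχs hb hχb (c := 1) fun y hy => by
      rw [hχ]
      simp [Real.smoothTransition.zero_of_nonpos (by linarith : 2 - 2 * y ≤ 0)]
    have hχd : ∀ y < 1 / 2, deriv χ y = ρ y := fun y hy => by
      have : χ =ᶠ[𝓝 y] R := by
        filter_upwards [gt_mem_nhds hy] with t ht
        rw [hχ]
        simp [Real.smoothTransition.one_of_one_le (by linarith : 1 ≤ 2 - 2 * t)]
      rw [this.deriv_eq, (hdR y).deriv]
    have hne : ∀ᵐ r : ℝ, r ≠ 1 / 2 := by simp [ae_iff, measure_singleton]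
    have e1 : ∫ y, ρ y * g y = ∫ y, deriv χ y * g y := by
      refine integral_congr_ae ?_
      filter_upwards [hne] with y hy
      rcases lt_or_gt_of_ne hy with h' | h'
      · rw [hχd y h']
      · rw [hg0 y h', mul_zero, mul_zero]
    have e2 : ∫ y, χ y * h y = -∫ y, ρ y * V' y := by
      rcases le_or_gt (1 / 2) b with hb2 | hb2
      · have h1 : ∀ y, χ y * h y = 0 := fun y => by
          rcases le_or_gt y b with h' | h'
          · rw [hχb y h', zero_mul]
          · rw [hh0 y (by linarith), mul_zero]
        have h2 : ∀ y, ρ y * V' y = 0 := fun y => by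
          rcases le_or_gt y b with h' | h'
          · rw [hb0 y h', zero_mul]
          · rw [← hVV y (hb.trans h'), hV0 y (by linarith), mul_zero]
        simp [h1, h2]
      have hχac : AbsolutelyContinuousOnInterval χ b (1 / 2) :=
        (hχs.of_le (by exact_mod_cast le_top)).contDiffOn.absolutelyContinuousOnInterval
      have hVac : AbsolutelyContinuousOnInterval V' b (1 / 2) := by
        have h1 := hh.intervalIntegrable.absolutelyContinuousOnInterval_intervalIntegral
          (a := b) (b := 1 / 2) (c := b) Set.left_mem_uIcc
        have h2 : AbsolutelyContinuousOnInterval (fun _ : ℝ => ∫ t in (1 : ℝ)..b, h t) b (1 / 2) :=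
          contDiffOn_const.absolutelyContinuousOnInterval
        have h3 : V' = fun y => (∫ t in (1 : ℝ)..b, h t) + ∫ t in b..y, h t := by
          rw [hV']
          exact funext fun y => (intervalIntegral.integral_add_adjacent_intervals
            hh.intervalIntegrable hh.intervalIntegrable).symm
        rw [h3]
        exact h2.fun_add h1
      have ibp := hVac.integral_mul_deriv_eq_deriv_mul hχac
      rw [hχb b le_rfl, ← hVV (1 / 2) (by norm_num), hV0 _ le_rfl, zero_mul, mul_zero, sub_zero,
        zero_sub] at ibp
      have h1 : ∫ y in b..(1 / 2), V' y * deriv χ y = ∫ y, ρ y * V' y := by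
        rw [intervalIntegral.integral_of_le hb2.le, ← integral_indicator measurableSet_Ioc]
        refine integral_congr_ae ?_
        filter_upwards [hne] with y hy
        rw [Set.indicator_apply]
        split_ifs with hy'
        · rw [hχd y (lt_of_le_of_ne hy'.2 hy), mul_comm]
        · rw [Set.mem_Ioc, not_and_or, not_lt, not_le] at hy'
          rcases hy' with h' | h'
          · rw [hb0 y h', zero_mul]
          · rw [← hVV y (by linarith), hV0 y h'.le, mul_zero]
      have h2 : ∫ y in b..(1 / 2), deriv V' y * χ y = ∫ y, χ y * h y := by
        rw [intervalIntegral.integral_of_le hb2.le, ← integral_indicator measurableSet_Ioc]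
        refine integral_congr_ae ?_
        filter_upwards [hdV] with y hy
        rw [Set.indicator_apply]
        split_ifs with hy'
        · rw [hy.deriv, mul_comm]
        · rw [Set.mem_Ioc, not_and_or, not_lt, not_le] at hy'
          rcases hy' with h' | h'
          · rw [hχb y h', zero_mul]
          · rw [hh0 y h', mul_zero]
      rw [h1, h2] at ibp
      linarith
    have i1 : Integrable fun y => ρ y * g y := by
      obtain ⟨C, hC⟩ := hρc.exists_bound_of_continuous hρ.continuous
      exact hg.bdd_mul hρ.continuous.aestronglyMeasurable (c := C) (Eventually.of_forall hC)
    have i2 : Integrable fun y => ρ y * V' y :=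
      (hρ.continuous.mul hcV).integrable_of_hasCompactSupport hρc.mul_right
    simp only [smul_eq_mul, mul_sub]
    rw [integral_sub i1 i2, e1, hweak χ hχt, e2]
    ring
  filter_upwards [key] with y hy hy0
  rw [hVV y hy0]
  exact sub_eq_zero.1 (hy hy0)

end DuBoisReymond

/-! ### Localized weak solutions -/

section WeakData

variable {n : ℕ}

/-- Functions supported in `{|x| ≤ 1/2, 0 < y ≤ 1/2}`, with square integrable slices and with
finite norm in the space `L²` with weight `y^b`. -/
structure IsLocalized (b : ℝ) (g : EuclideanSpace ℝ (Fin n) × ℝ → ℝ) : Prop where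
  measurable : Measurable g
  eq_zero_of_lt : ∀ q, 1 / 2 < ‖q.1‖ → g q = 0
  eq_zero : ∀ q, q.2 ∉ Set.Ioc (0 : ℝ) (1 / 2) → g q = 0
  memLp : ∀ y, MemLp (fun x => g (x, y)) 2
  lintegral_ne_top : ∫⁻ q, ENNReal.ofReal (q.2 ^ b * g q ^ 2) ≠ ⊤

variable {b ρ : ℝ} {g : EuclideanSpace ℝ (Fin n) × ℝ → ℝ}

lemma IsLocalized.integrable_sq (h : IsLocalized b g) :
    Integrable fun q => q.2 ^ b * g q ^ 2 := by
  refine (lintegral_ofReal_ne_top_iff_integrable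
    ((measurable_snd.pow_const b).mul (h.measurable.pow_const 2)).aestronglyMeasurable
    (Eventually.of_forall fun q => ?_)).1 h.lintegral_ne_top
  by_cases hq : q.2 ∈ Set.Ioc (0 : ℝ) (1 / 2)
  · have := hq.1
    show 0 ≤ q.2 ^ b * g q ^ 2
    positivity
  · simp [h.eq_zero q hq]

lemma IsLocalized.isSource (h : IsLocalized b g) (hρ : -1 < 2 * ρ - b) :
    IsSource fun q => q.2 ^ ρ * g q where
  eq_zero_of_lt q hq := by rw [h.eq_zero_of_lt q hq, mul_zero]
  eq_zero q hq := by rw [h.eq_zero q hq, mul_zero]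
  integrable := by
    have h1 : Integrable fun q : EuclideanSpace ℝ (Fin n) × ℝ =>
        (Metric.closedBall (0 : EuclideanSpace ℝ (Fin n)) (1 / 2)).indicator (fun _ => (1 : ℝ)) q.1
          * (Set.Ioc (0 : ℝ) (1 / 2)).indicator (fun y => y ^ (2 * ρ - b)) q.2 := by
      rw [Measure.volume_eq_prod]
      refine Integrable.mul_prod ((integrable_indicator_iff measurableSet_closedBall).2
        (integrableOn_const measure_closedBall_lt_top.ne)) ?_
      rw [integrable_indicator_iff measurableSet_Ioc, ← intervalIntegrable_iff_integrableOn_Ioc_of_le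
        (by norm_num)]
      exact intervalIntegral.intervalIntegrable_rpow' hρ
    refine (h1.add h.integrable_sq).mono'
      ((measurable_snd.pow_const ρ).mul h.measurable).aestronglyMeasurable
      (Eventually.of_forall fun q => ?_)
    have h0 : 0 ≤ (Metric.closedBall (0 : EuclideanSpace ℝ (Fin n)) (1 / 2)).indicator
        (fun _ => (1 : ℝ)) q.1 * (Set.Ioc (0 : ℝ) (1 / 2)).indicator
          (fun y => y ^ (2 * ρ - b)) q.2 :=
      mul_nonneg (Set.indicator_nonneg (fun _ _ => zero_le_one) _)
        (Set.indicator_nonneg (fun y hy => Real.rpow_nonneg hy.1.le _) _)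
    by_cases hq : q.2 ∈ Set.Ioc (0 : ℝ) (1 / 2)
    · by_cases hq1 : 1 / 2 < ‖q.1‖
      · rw [h.eq_zero_of_lt q hq1, mul_zero, norm_zero, Pi.add_apply, h.eq_zero_of_lt q hq1]
        linarith
      · have hp : 0 < q.2 ^ b := Real.rpow_pos_of_pos hq.1 b
        have hq1' : q.1 ∈ Metric.closedBall (0 : EuclideanSpace ℝ (Fin n)) (1 / 2) := by
          simpa using hq1
        simp only [Pi.add_apply, Set.indicator_of_mem hq, Set.indicator_of_mem hq1', one_mul]
        rw [norm_mul, Real.norm_eq_abs, Real.norm_eq_abs, abs_of_pos (Real.rpow_pos_of_pos hq.1 ρ),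
          Real.rpow_sub hq.1, two_mul, Real.rpow_add hq.1]
        have h2 : 0 ≤ (q.2 ^ ρ / q.2 ^ b - |g q|) ^ 2 * q.2 ^ b := by positivity
        have h3 : (q.2 ^ ρ / q.2 ^ b - |g q|) ^ 2 * q.2 ^ b = q.2 ^ ρ * q.2 ^ ρ / q.2 ^ b
            - 2 * (q.2 ^ ρ * |g q|) + q.2 ^ b * |g q| ^ 2 := by
          field_simp
          ring
        have h4 : 0 ≤ q.2 ^ ρ * |g q| := by
          have := hq.1
          positivity
        rw [sq_abs] at h3
        linarith
    · rw [h.eq_zero q hq, mul_zero, norm_zero, Pi.add_apply, h.eq_zero q hq]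
      linarith

lemma IsLocalized.isSource_self (h : IsLocalized b g) (hb : b < 1) : IsSource g := by
  have := h.isSource (ρ := 0) (by linarith)
  simpa using this

/-- A localized function `w` with weak gradient `(gx, gy)` that solves
`∇ · y^a ∇w = f` weakly and has vanishing trace, where `-1 < a ≤ 0`. The test functions are products
`θ(x') χ(y)`, which is all that tangential mollification needs. -/
structure IsWeakData (a : ℝ) (w : EuclideanSpace ℝ (Fin n) × ℝ → ℝ)
    (gx : Fin n → EuclideanSpace ℝ (Fin n) × ℝ → ℝ) (gy f : EuclideanSpace ℝ (Fin n) × ℝ → ℝ) :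
    Prop where
  nonpos : a ≤ 0
  neg_one_lt : -1 < a
  isLocalized : IsLocalized a w
  isLocalized_tangential : ∀ i, IsLocalized a (gx i)
  isLocalized_normal : IsLocalized a gy
  isLocalized_rhs : IsLocalized (-a) f
  tangential : ∀ θ χ, ContDiff ℝ ∞ θ → HasCompactSupport θ → IsNormalTest χ → ∀ i,
    ∫ q : EuclideanSpace ℝ (Fin n) × ℝ, pd i θ q.1 * χ q.2 * w q
      = -∫ q : EuclideanSpace ℝ (Fin n) × ℝ, θ q.1 * χ q.2 * gx i q
  normal : ∀ θ χ, ContDiff ℝ ∞ θ → HasCompactSupport θ → IsNormalTest χ →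
    ∫ q : EuclideanSpace ℝ (Fin n) × ℝ, θ q.1 * deriv χ q.2 * w q
      = -∫ q : EuclideanSpace ℝ (Fin n) × ℝ, θ q.1 * χ q.2 * gy q
  equation : ∀ θ χ, ContDiff ℝ ∞ θ → HasCompactSupport θ → IsNormalTest χ →
    ∫ q : EuclideanSpace ℝ (Fin n) × ℝ, q.2 ^ a * (∑ i, pd i θ q.1 * χ q.2 * gx i q
        + θ q.1 * deriv χ q.2 * gy q)
      = -∫ q : EuclideanSpace ℝ (Fin n) × ℝ, θ q.1 * χ q.2 * f q
  trace : Tendsto (fun y => ∫⁻ x, ENNReal.ofReal (w (x, y) ^ 2)) boundaryFilter (𝓝 0)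

end WeakData

/-! ### Mollified weak solutions -/

section Identification

variable {n : ℕ} {a : ℝ} {w gy f h : EuclideanSpace ℝ (Fin n) × ℝ → ℝ}
  {gx : Fin n → EuclideanSpace ℝ (Fin n) × ℝ → ℝ} {θ : EuclideanSpace ℝ (Fin n) → ℝ} {χ : ℝ → ℝ}

lemma pd_comp_sub (hθ : IsMollifier θ) (z x : EuclideanSpace ℝ (Fin n)) (i : Fin n) :
    pd i (fun x => θ (z - x)) x = -pd i θ (z - x) := by
  have h1 : HasFDerivAt θ (fderiv ℝ θ (z - x)) (z - x) :=
    ((hθ.contDiff_nat 1).differentiable (by norm_num)).differentiableAt.hasFDerivAt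
  have h2 : HasFDerivAt (fun x : EuclideanSpace ℝ (Fin n) => z - x)
      (-ContinuousLinearMap.id ℝ (EuclideanSpace ℝ (Fin n))) x := (hasFDerivAt_id x).const_sub z
  have h3 := h1.comp x h2
  rw [pd, show (fun x => θ (z - x)) = θ ∘ fun x => z - x from rfl, h3.fderiv]
  simp [pd]

lemma IsMollifier.contDiff_comp_sub (hθ : IsMollifier θ) (z : EuclideanSpace ℝ (Fin n)) :
    ContDiff ℝ ∞ fun x => θ (z - x) :=
  hθ.contDiff.comp (by fun_prop)

lemma IsMollifier.hasCompactSupport_comp_sub (hθ : IsMollifier θ)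
    (z : EuclideanSpace ℝ (Fin n)) : HasCompactSupport fun x => θ (z - x) :=
  HasCompactSupport.intro (isCompact_closedBall z (1 / 8)) fun x hx => hθ.eq_zero _ (by
    rw [Metric.mem_closedBall, not_le, dist_comm, dist_eq_norm] at hx
    exact hx)

lemma IsNormalTest.deriv (hχ : IsNormalTest χ) : IsNormalTest (deriv χ) where
  contDiff := (contDiff_infty_iff_deriv.1 hχ.contDiff).2
  hasCompactSupport := hχ.hasCompactSupport.deriv
  tsupport_subset := tsupport_deriv_subset.trans hχ.tsupport_subset

lemma integrable_mollifier_mul (hh : IsSource h) (hθ : IsMollifier θ) (hχ : IsNormalTest χ)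
    (z : EuclideanSpace ℝ (Fin n)) :
    Integrable fun q : EuclideanSpace ℝ (Fin n) × ℝ => θ (z - q.1) * χ q.2 * h q := by
  obtain ⟨C, hC⟩ := hχ.hasCompactSupport.exists_bound_of_continuous hχ.contDiff.continuous
  refine ((hθ.integrable_mul hh.integrable z).bdd_mul
    ((hχ.contDiff.continuous.comp continuous_snd).aestronglyMeasurable) (c := C)
    (Eventually.of_forall fun q => hC _)).congr (Eventually.of_forall fun q => ?_)
  simp only [Function.comp]
  ring

lemma integral_mollifier_mul (hh : IsSource h) (hθ : IsMollifier θ) (hχ : IsNormalTest χ)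
    (z : EuclideanSpace ℝ (Fin n)) :
    ∫ q : EuclideanSpace ℝ (Fin n) × ℝ, θ (z - q.1) * χ q.2 * h q
      = ∫ y, χ y * moll θ (fun x => h (x, y)) z := by
  have hi := integrable_mollifier_mul hh hθ hχ z
  rw [Measure.volume_eq_prod] at hi ⊢
  rw [integral_prod_symm _ hi]
  refine integral_congr_ae (Eventually.of_forall fun y => ?_)
  simp only
  rw [moll, ← integral_const_mul]
  exact integral_congr_ae (Eventually.of_forall fun x => by simp only; ring)

lemma integrable_moll (hh : IsSource h) (hθ : IsMollifier θ) (z : EuclideanSpace ℝ (Fin n)) :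
    Integrable fun y => moll θ (fun x => h (x, y)) z := by
  have hi := hθ.integrable_mul hh.integrable z
  rw [Measure.volume_eq_prod] at hi
  exact hi.integral_prod_right

lemma moll_eq_zero_of_notMem (hh : IsSource h) {y : ℝ} (hy : y ∉ Set.Ioc (0 : ℝ) (1 / 2))
    (z : EuclideanSpace ℝ (Fin n)) : moll θ (fun x => h (x, y)) z = 0 :=
  integral_eq_zero_of_ae (Eventually.of_forall fun x => by simp [hh.eq_zero (x, y) hy])

lemma moll_const_mul (c : ℝ) (k : EuclideanSpace ℝ (Fin n) → ℝ) (z : EuclideanSpace ℝ (Fin n)) :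
    moll θ (fun x => c * k x) z = c * moll θ k z := by
  rw [moll, moll, ← integral_const_mul]
  exact integral_congr_ae (Eventually.of_forall fun x => by simp only; ring)

/-- The mollified conormal derivative `θ * y^a ∂_y w`, reconstructed from the equation as
`-∫_y^∞ (θ * f - Δ'θ * t^a w) dt`. In contrast to the convolution it is continuous in `y`. -/
noncomputable def mollConormal (a : ℝ) (w f : EuclideanSpace ℝ (Fin n) × ℝ → ℝ)
    (θ : EuclideanSpace ℝ (Fin n) → ℝ) (z : EuclideanSpace ℝ (Fin n)) (y : ℝ) : ℝ :=
  kernelIntegral tailKernel f θ z y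
    - kernelIntegral tailKernel (fun q => q.2 ^ a * w q) (lap θ) z y

/-- The mollified solution `θ * w`, reconstructed from the equation as the weighted primitive
`-∫_y^∞ t^{-a} p(t) dt` of `p = mollConormal a w f θ`. -/
noncomputable def mollSolution (a : ℝ) (w f : EuclideanSpace ℝ (Fin n) × ℝ → ℝ)
    (θ : EuclideanSpace ℝ (Fin n) → ℝ) (z : EuclideanSpace ℝ (Fin n)) (y : ℝ) : ℝ :=
  kernelIntegral (doubleTailKernel a) f θ z y
    - kernelIntegral (doubleTailKernel a) (fun q => q.2 ^ a * w q) (lap θ) z y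

namespace IsWeakData

variable (hD : IsWeakData a w gx gy f)
include hD

lemma isSource_w : IsSource w :=
  hD.isLocalized.isSource_self (by linarith [hD.nonpos, hD.neg_one_lt])

lemma isSource_gx (i : Fin n) : IsSource (gx i) :=
  (hD.isLocalized_tangential i).isSource_self (by linarith [hD.nonpos, hD.neg_one_lt])

lemma isSource_gy : IsSource gy :=
  hD.isLocalized_normal.isSource_self (by linarith [hD.nonpos, hD.neg_one_lt])

lemma isSource_f : IsSource f :=
  hD.isLocalized_rhs.isSource_self (by linarith [hD.nonpos, hD.neg_one_lt])

lemma isSource_rpow_mul_w : IsSource fun q => q.2 ^ a * w q :=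
  hD.isLocalized.isSource (by linarith [hD.nonpos, hD.neg_one_lt])

lemma isSource_rpow_mul_gx (i : Fin n) : IsSource fun q => q.2 ^ a * gx i q :=
  (hD.isLocalized_tangential i).isSource (by linarith [hD.nonpos, hD.neg_one_lt])

lemma isSource_rpow_mul_gy : IsSource fun q => q.2 ^ a * gy q :=
  hD.isLocalized_normal.isSource (by linarith [hD.nonpos, hD.neg_one_lt])

/-- Tangential derivatives of the mollified solution fall on the mollifier. -/
lemma moll_pd_ae_eq (hθ : IsMollifier θ) (z : EuclideanSpace ℝ (Fin n)) (i : Fin n) :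
    ∀ᵐ y, moll (pd i θ) (fun x => w (x, y)) z = moll θ (fun x => gx i (x, y)) z := by
  have sw := hD.isSource_w
  have sg := hD.isSource_gx i
  have i1 := integrable_moll sw (hθ.pd i) z
  have i2 := integrable_moll sg hθ z
  have key : ∀ᵐ y, y ∈ Set.Ioi (0 : ℝ) → (moll (pd i θ) (fun x => w (x, y)) z
      - moll θ (fun x => gx i (x, y)) z) = 0 := by
    refine isOpen_Ioi.ae_eq_zero_of_integral_contDiff_smul_eq_zero
      ((i1.sub i2).locallyIntegrable.locallyIntegrableOn _) fun χ hχ hχc hχs => ?_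
    have hχt : IsNormalTest χ := ⟨hχ, hχc, hχs⟩
    have e := hD.tangential _ χ (hθ.contDiff_comp_sub z) (hθ.hasCompactSupport_comp_sub z) hχt i
    simp only [pd_comp_sub hθ, neg_mul, integral_neg, neg_inj] at e
    rw [integral_mollifier_mul sw (hθ.pd i) hχt, integral_mollifier_mul sg hθ hχt] at e
    obtain ⟨C, hC⟩ := hχc.exists_bound_of_continuous hχ.continuous
    have j1 := i1.bdd_mul hχ.continuous.aestronglyMeasurable (c := C) (Eventually.of_forall hC)
    have j2 := i2.bdd_mul hχ.continuous.aestronglyMeasurable (c := C) (Eventually.of_forall hC)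
    simp only [smul_eq_mul, mul_sub]
    rw [integral_sub j1 j2, e, sub_self]
  filter_upwards [key] with y hy
  by_cases hy0 : 0 < y
  · exact sub_eq_zero.1 (hy hy0)
  · have : y ∉ Set.Ioc (0 : ℝ) (1 / 2) := fun h => hy0 h.1
    rw [moll_eq_zero_of_notMem sw this, moll_eq_zero_of_notMem sg this]

/-- The mollified equation, as a weak equation in the normal variable. -/
lemma integral_deriv_mul_moll (hθ : IsMollifier θ) (hχ : IsNormalTest χ)
    (z : EuclideanSpace ℝ (Fin n)) :
    ∫ y, deriv χ y * moll θ (fun x => y ^ a * gy (x, y)) z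
      = -∫ y, χ y * (moll θ (fun x => f (x, y)) z
        - moll (lap θ) (fun x => y ^ a * w (x, y)) z) := by
  have sf := hD.isSource_f
  have sw := hD.isSource_rpow_mul_w
  have sx := hD.isSource_rpow_mul_gx
  have sy := hD.isSource_rpow_mul_gy
  have e := hD.equation _ χ (hθ.contDiff_comp_sub z) (hθ.hasCompactSupport_comp_sub z) hχ
  have e' : ∀ q : EuclideanSpace ℝ (Fin n) × ℝ,
      q.2 ^ a * (∑ i, pd i (fun x => θ (z - x)) q.1 * χ q.2 * gx i q
        + θ (z - q.1) * deriv χ q.2 * gy q)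
      = -∑ i, pd i θ (z - q.1) * χ q.2 * (q.2 ^ a * gx i q)
        + θ (z - q.1) * deriv χ q.2 * (q.2 ^ a * gy q) := fun q => by
    simp only [pd_comp_sub hθ, mul_add, Finset.mul_sum, ← Finset.sum_neg_distrib]
    congr 1
    · exact Finset.sum_congr rfl fun i _ => by ring
    · ring
  have j1 : ∀ i ∈ Finset.univ, Integrable fun q : EuclideanSpace ℝ (Fin n) × ℝ =>
      pd i θ (z - q.1) * χ q.2 * (q.2 ^ a * gx i q) := fun i _ =>
    integrable_mollifier_mul (sx i) (hθ.pd i) hχ z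
  have j2 := integrable_mollifier_mul sy hθ hχ.deriv z
  have j3 : Integrable fun q : EuclideanSpace ℝ (Fin n) × ℝ =>
      -∑ i, pd i θ (z - q.1) * χ q.2 * (q.2 ^ a * gx i q) := (integrable_finsetSum _ j1).neg
  simp only [e'] at e
  rw [integral_add j3 j2, integral_neg, integral_finsetSum _ j1,
    integral_mollifier_mul sy hθ hχ.deriv, integral_mollifier_mul sf hθ hχ] at e
  -- integration by parts in the tangential variables, with the weight in the test function
  have e2 : ∀ i, ∫ q : EuclideanSpace ℝ (Fin n) × ℝ,
      pd i θ (z - q.1) * χ q.2 * (q.2 ^ a * gx i q)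
      = ∫ q : EuclideanSpace ℝ (Fin n) × ℝ,
        pd i (pd i θ) (z - q.1) * χ q.2 * (q.2 ^ a * w q) := fun i => by
    have t := hD.tangential _ _ ((hθ.pd i).contDiff_comp_sub z)
      ((hθ.pd i).hasCompactSupport_comp_sub z) (hχ.rpow_mul a) i
    simp only [pd_comp_sub (hθ.pd i), neg_mul, integral_neg, neg_inj] at t
    calc _ = ∫ q : EuclideanSpace ℝ (Fin n) × ℝ,
          pd i θ (z - q.1) * (q.2 ^ a * χ q.2) * gx i q :=
          integral_congr_ae (Eventually.of_forall fun q => by simp only; ring)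
      _ = _ := t.symm
      _ = _ := integral_congr_ae (Eventually.of_forall fun q => by simp only; ring)
  have e3 : ∑ i, ∫ q : EuclideanSpace ℝ (Fin n) × ℝ,
        pd i θ (z - q.1) * χ q.2 * (q.2 ^ a * gx i q)
      = ∫ y, χ y * moll (lap θ) (fun x => y ^ a * w (x, y)) z := by
    rw [← integral_mollifier_mul sw hθ.lap hχ, Finset.sum_congr rfl fun i _ => e2 i,
      ← integral_finsetSum _ fun i _ => integrable_mollifier_mul sw ((hθ.pd i).pd i) hχ z]
    refine integral_congr_ae (Eventually.of_forall fun q => ?_)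
    simp only [lap, Finset.sum_mul]
  rw [e3] at e
  obtain ⟨C, hC⟩ := hχ.hasCompactSupport.exists_bound_of_continuous hχ.contDiff.continuous
  have k1 := (integrable_moll sf hθ z).bdd_mul hχ.contDiff.continuous.aestronglyMeasurable
    (c := C) (Eventually.of_forall hC)
  have k2 := (integrable_moll sw hθ.lap z).bdd_mul hχ.contDiff.continuous.aestronglyMeasurable
    (c := C) (Eventually.of_forall hC)
  simp only [mul_sub]
  rw [integral_sub k1 k2]
  linarith

/-- `mollConormal` satisfies the mollified equation in integrated form. -/
lemma mollConormal_sub (hθ : IsMollifier θ) (z : EuclideanSpace ℝ (Fin n)) (b c : ℝ) :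
    mollConormal a w f θ z c - mollConormal a w f θ z b
      = ∫ t in b..c, (moll θ (fun x => f (x, t)) z
        - moll (lap θ) (fun x => t ^ a * w (x, t)) z) := by
  have sf := hD.isSource_f
  have sw := hD.isSource_rpow_mul_w
  rw [intervalIntegral.integral_sub (integrable_moll sf hθ z).intervalIntegrable
    (integrable_moll sw hθ.lap z).intervalIntegrable, ← kernelIntegral_tailKernel_sub sf hθ,
    ← kernelIntegral_tailKernel_sub sw hθ.lap]
  unfold mollConormal
  ring

lemma mollConormal_eq_zero_of_le (z : EuclideanSpace ℝ (Fin n)) {y : ℝ}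
    (hy : 1 / 2 ≤ y) : mollConormal a w f θ z y = 0 := by
  have h1 : ∀ r ∈ Set.Ioc (0 : ℝ) (1 / 2), tailKernel y r = 0 := fun r hr => by
    simp [tailKernel, hr.2.trans hy]
  rw [mollConormal, kernelIntegral_eq_zero_of_kernel (hD.isSource_f) z y h1,
    kernelIntegral_eq_zero_of_kernel (hD.isSource_rpow_mul_w) z y h1, sub_zero]

lemma mollSolution_eq_zero_of_le (z : EuclideanSpace ℝ (Fin n)) {y : ℝ}
    (hy : 1 / 2 ≤ y) : mollSolution a w f θ z y = 0 := by
  have h1 : ∀ r ∈ Set.Ioc (0 : ℝ) (1 / 2), doubleTailKernel a y r = 0 := fun r hr => by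
    have : r ^ (1 - a) ≤ y ^ (1 - a) :=
      Real.rpow_le_rpow hr.1.le (hr.2.trans hy) (by linarith [hD.nonpos, hD.neg_one_lt])
    rw [doubleTailKernel, max_eq_right (by linarith : (0 : ℝ) ≤ y),
      max_eq_left (by linarith [hD.nonpos, hD.neg_one_lt]),
      zero_div]
  rw [mollSolution, kernelIntegral_eq_zero_of_kernel (hD.isSource_f) z y h1,
    kernelIntegral_eq_zero_of_kernel (hD.isSource_rpow_mul_w) z y h1, sub_zero]

/-- On almost every slice `mollConormal` is the mollification of `y^a ∂_y w`: both vanish above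
height `1/2` and have the same weak derivative in `y`. -/
lemma ae_moll_conormal_eq (hθ : IsMollifier θ) (z : EuclideanSpace ℝ (Fin n)) :
    ∀ᵐ y, 0 < y → y ^ a * moll θ (fun x => gy (x, y)) z = mollConormal a w f θ z y := by
  have sf := hD.isSource_f
  have sw := hD.isSource_rpow_mul_w
  have sy := hD.isSource_rpow_mul_gy
  have hout : ∀ y : ℝ, 1 / 2 < y → y ∉ Set.Ioc (0 : ℝ) (1 / 2) := fun y hy h => by
    linarith [h.2]
  have := ae_eq_of_forall_test (V := mollConormal a w f θ z) (integrable_moll sy hθ z)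
    ((integrable_moll sf hθ z).sub (integrable_moll sw hθ.lap z))
    (fun y hy => moll_eq_zero_of_notMem sy (hout y hy) z)
    (fun y hy => by
      simp only [Pi.sub_apply]
      rw [moll_eq_zero_of_notMem sf (hout y hy) z, moll_eq_zero_of_notMem sw (hout y hy) z,
        sub_zero])
    (fun y hy => hD.mollConormal_eq_zero_of_le z hy)
    (fun b c _ _ => hD.mollConormal_sub hθ z b c)
    (fun χ hχ => hD.integral_deriv_mul_moll hθ hχ z)
  filter_upwards [this] with y hy hy0
  rw [← hy hy0, ← moll_const_mul]

lemma continuous_mollConormal (hθ : IsMollifier θ) :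
    Continuous fun q : EuclideanSpace ℝ (Fin n) × ℝ => mollConormal a w f θ q.1 q.2 :=
  (continuous_kernelIntegral isKernel_tailKernel (hD.isSource_f) hθ).sub
    (continuous_kernelIntegral isKernel_tailKernel (hD.isSource_rpow_mul_w) hθ.lap)

lemma continuous_mollSolution (hθ : IsMollifier θ) :
    Continuous fun q : EuclideanSpace ℝ (Fin n) × ℝ => mollSolution a w f θ q.1 q.2 :=
  (continuous_kernelIntegral (isKernel_doubleTailKernel hD.nonpos) (hD.isSource_f) hθ).sub
    (continuous_kernelIntegral (isKernel_doubleTailKernel hD.nonpos) (hD.isSource_rpow_mul_w)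
      hθ.lap)

lemma hasDerivAt_mollSolution (hθ : IsMollifier θ) (z : EuclideanSpace ℝ (Fin n)) {y : ℝ}
    (hy : 0 < y) :
    HasDerivAt (mollSolution a w f θ z) (mollConormal a w f θ z y / y ^ a) y := by
  refine ((hasDerivAt_kernelIntegral hD.nonpos (hD.isSource_f) hθ z hy).sub
    (hasDerivAt_kernelIntegral hD.nonpos (hD.isSource_rpow_mul_w) hθ.lap z hy)).congr_deriv ?_
  rw [mollConormal, sub_div]

/-- On almost every slice `mollSolution` is the mollification of `w`, for the same reason. -/
lemma ae_moll_solution_eq (hθ : IsMollifier θ) (z : EuclideanSpace ℝ (Fin n)) :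
    ∀ᵐ y, 0 < y → moll θ (fun x => w (x, y)) z = mollSolution a w f θ z y := by
  have sw := hD.isSource_w
  have sy := hD.isSource_gy
  have hout : ∀ y : ℝ, 1 / 2 < y → y ∉ Set.Ioc (0 : ℝ) (1 / 2) := fun y hy h => by
    linarith [h.2]
  refine ae_eq_of_forall_test (V := mollSolution a w f θ z) (integrable_moll sw hθ z)
    (integrable_moll sy hθ z)
    (fun y hy => moll_eq_zero_of_notMem sw (hout y hy) z)
    (fun y hy => moll_eq_zero_of_notMem sy (hout y hy) z)
    (fun y hy => hD.mollSolution_eq_zero_of_le z hy)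
    (fun b c hb hc => ?_) (fun χ hχ => ?_)
  · have hpos : ∀ t ∈ Set.uIcc b c, 0 < t := fun t ht => (lt_min hb hc).trans_le ht.1
    have hcont : ContinuousOn (fun t => mollConormal a w f θ z t / t ^ a) (Set.uIcc b c) :=
      (IsTangentiallySmooth.continuous_slice (hD.continuous_mollConormal hθ)
        z).continuousOn.div (continuousOn_id.rpow_const fun t ht => Or.inl (hpos t ht).ne')
        fun t ht => (Real.rpow_pos_of_pos (hpos t ht) a).ne'
    rw [← intervalIntegral.integral_eq_sub_of_hasDerivAt
      (fun t ht => hD.hasDerivAt_mollSolution hθ z (hpos t ht)) hcont.intervalIntegrable]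
    refine intervalIntegral.integral_congr_ae ?_
    filter_upwards [hD.ae_moll_conormal_eq hθ z] with t ht ht'
    have ht0 := hpos t (Set.uIoc_subset_uIcc ht')
    rw [← ht ht0, mul_div_cancel_left₀ _ (Real.rpow_pos_of_pos ht0 a).ne']
  · have e := hD.normal _ χ (hθ.contDiff_comp_sub z) (hθ.hasCompactSupport_comp_sub z) hχ
    rwa [integral_mollifier_mul sw hθ hχ.deriv, integral_mollifier_mul sy hθ hχ] at e

end IsWeakData

end Identification

section Smoothness

variable {n : ℕ} {a : ℝ} {w gy f h : EuclideanSpace ℝ (Fin n) × ℝ → ℝ}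
  {gx : Fin n → EuclideanSpace ℝ (Fin n) × ℝ → ℝ} {θ : EuclideanSpace ℝ (Fin n) → ℝ}

instance neBot_boundaryFilter : boundaryFilter.NeBot := by
  refine ⟨fun h => ?_⟩
  have h1 : (∅ : Set ℝ) ∈ boundaryFilter := h ▸ mem_bot
  obtain ⟨s, hs, t, ht, hst⟩ := mem_inf_iff.1 h1
  obtain ⟨b, hb, hbs⟩ := mem_nhdsGT_iff_exists_Ioc_subset.1 hs
  have h2 : Set.Ioc 0 b ⊆ tᶜ := fun y hy hyt => by
    have : y ∈ s ∩ t := ⟨hbs hy, hyt⟩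
    rw [← hst] at this
    exact this
  replace h2 : volume (Set.Ioc 0 b) = 0 := measure_mono_null h2 (mem_ae_iff.1 ht)
  rw [Real.volume_Ioc, sub_zero, ENNReal.ofReal_eq_zero] at h2
  exact absurd hb (not_lt.2 h2)

lemma eventually_boundaryFilter_of_ae {P : ℝ → Prop} (h : ∀ᵐ y, 0 < y → P y) :
    ∀ᶠ y in boundaryFilter, P y := by
  have h1 : ∀ᶠ y in boundaryFilter, 0 < y :=
    Filter.mem_inf_of_left self_mem_nhdsWithin
  have h2 : ∀ᶠ y in boundaryFilter, 0 < y → P y := Filter.mem_inf_of_right h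
  filter_upwards [h1, h2] with y hy hy'
  exact hy' hy

lemma boundaryFilter_le : boundaryFilter ≤ 𝓝 0 := inf_le_left.trans nhdsWithin_le_nhds

lemma ofReal_sq_moll_le (hθ : IsMollifier θ) {k : EuclideanSpace ℝ (Fin n) → ℝ}
    (hk : AEMeasurable k) (z : EuclideanSpace ℝ (Fin n)) :
    ENNReal.ofReal (moll θ k z ^ 2)
      ≤ (∫⁻ x, ENNReal.ofReal (θ (z - x) ^ 2)) * ∫⁻ x, ENNReal.ofReal (k x ^ 2) :=
  ofReal_sq_integral_mul_le
    (hθ.contDiff_comp_sub z).continuous.aemeasurable hk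

lemma measurable_moll (hθ : IsMollifier θ) (hh : Measurable h) :
    Measurable fun q : EuclideanSpace ℝ (Fin n) × ℝ => moll θ (fun x => h (x, q.2)) q.1 := by
  have h1 : Measurable fun q : (EuclideanSpace ℝ (Fin n) × ℝ) × EuclideanSpace ℝ (Fin n) =>
      θ (q.1.1 - q.2) := (hθ.continuous.comp (by fun_prop)).measurable
  have h2 : Measurable fun q : (EuclideanSpace ℝ (Fin n) × ℝ) × EuclideanSpace ℝ (Fin n) =>
      h (q.2, q.1.2) := hh.comp (by fun_prop)
  exact (h1.mul h2).stronglyMeasurable.integral_prod_right'.measurable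

namespace IsLocalized

variable {b : ℝ} {g : EuclideanSpace ℝ (Fin n) × ℝ → ℝ}

lemma integrable_slice (h : IsLocalized b g) (y : ℝ) : Integrable fun x => g (x, y) := by
  have h1 : IntegrableOn (fun x => g (x, y))
      (Metric.closedBall (0 : EuclideanSpace ℝ (Fin n)) (1 / 2)) :=
    haveI : IsFiniteMeasure ((volume : Measure (EuclideanSpace ℝ (Fin n))).restrict
      (Metric.closedBall 0 (1 / 2))) := ⟨by
        rw [Measure.restrict_apply_univ]
        exact measure_closedBall_lt_top⟩
    ((h.memLp y).restrict _).integrable one_le_two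
  refine (integrableOn_iff_integrable_of_support_subset fun x hx => ?_).1 h1
  by_contra hn
  exact hx (h.eq_zero_of_lt (x, y) (by simpa using hn))

lemma sq_integral_abs_le (h : IsLocalized b g) (y : ℝ) :
    (∫ x, |g (x, y)|) ^ 2
      ≤ (volume (Metric.closedBall (0 : EuclideanSpace ℝ (Fin n)) (1 / 2))).toReal
        * ∫ x, g (x, y) ^ 2 := by
  have hm : Measurable fun x => g (x, y) := h.measurable.comp measurable_prodMk_right
  have e1 : ∫ x, |g (x, y)| = ∫ x, (Metric.closedBall (0 : EuclideanSpace ℝ (Fin n))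
      (1 / 2)).indicator (fun _ => (1 : ℝ)) x * |g (x, y)| := by
    refine integral_congr_ae (Eventually.of_forall fun x => ?_)
    by_cases hx : x ∈ Metric.closedBall (0 : EuclideanSpace ℝ (Fin n)) (1 / 2)
    · simp only [Set.indicator_of_mem hx, one_mul]
    · have : g (x, y) = 0 := h.eq_zero_of_lt (x, y) (by simpa using hx)
      simp [this]
  have e2 := ofReal_sq_integral_mul_le (μ := volume) (f := (Metric.closedBall
    (0 : EuclideanSpace ℝ (Fin n)) (1 / 2)).indicator fun _ => (1 : ℝ)) (g := fun x => |g (x, y)|)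
    (measurable_const.indicator measurableSet_closedBall).aemeasurable
    (continuous_abs.measurable.comp hm).aemeasurable
  rw [← e1] at e2
  have e3 : ∫⁻ x, ENNReal.ofReal ((Metric.closedBall (0 : EuclideanSpace ℝ (Fin n))
      (1 / 2)).indicator (fun _ => (1 : ℝ)) x ^ 2)
      = volume (Metric.closedBall (0 : EuclideanSpace ℝ (Fin n)) (1 / 2)) := by
    rw [← lintegral_indicator_one measurableSet_closedBall]
    refine lintegral_congr fun x => ?_
    by_cases hx : x ∈ Metric.closedBall (0 : EuclideanSpace ℝ (Fin n)) (1 / 2)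
    · rw [Set.indicator_of_mem hx, Set.indicator_of_mem hx]
      simp
    · rw [Set.indicator_of_notMem hx, Set.indicator_of_notMem hx]
      simp
  have e4 : ∫⁻ x, ENNReal.ofReal (|g (x, y)| ^ 2) = ENNReal.ofReal (∫ x, g (x, y) ^ 2) := by
    simp only [sq_abs]
    exact (ofReal_integral_eq_lintegral_ofReal (h.memLp y).integrable_sq
      (Eventually.of_forall fun x => sq_nonneg _)).symm
  have hnn : 0 ≤ ∫ x, g (x, y) ^ 2 := integral_nonneg fun x => sq_nonneg _
  rw [e3, e4, ← ENNReal.ofReal_toReal (measure_closedBall_lt_top (μ := volume)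
    (x := (0 : EuclideanSpace ℝ (Fin n))) (r := 1 / 2)).ne,
    ← ENNReal.ofReal_mul ENNReal.toReal_nonneg, ENNReal.ofReal_le_ofReal_iff (by positivity)] at e2
  exact e2

end IsLocalized

namespace IsWeakData

variable (hD : IsWeakData a w gx gy f)
include hD

lemma contDiff_mollSolution (hθ : IsMollifier θ) (y : ℝ) (m : ℕ) :
    ContDiff ℝ m fun z => mollSolution a w f θ z y :=
  (contDiff_kernelIntegral (isKernel_doubleTailKernel hD.nonpos) hD.isSource_f hθ y m).sub
    (contDiff_kernelIntegral (isKernel_doubleTailKernel hD.nonpos) hD.isSource_rpow_mul_w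
      hθ.lap y m)

lemma contDiff_mollConormal (hθ : IsMollifier θ) (y : ℝ) (m : ℕ) :
    ContDiff ℝ m fun z => mollConormal a w f θ z y :=
  (contDiff_kernelIntegral isKernel_tailKernel hD.isSource_f hθ y m).sub
    (contDiff_kernelIntegral isKernel_tailKernel hD.isSource_rpow_mul_w hθ.lap y m)

lemma pd_sub_kernelIntegral {κ : ℝ → ℝ → ℝ} (hκ : IsKernel κ) (hθ : IsMollifier θ) (y : ℝ)
    (i : Fin n) (z : EuclideanSpace ℝ (Fin n)) :
    pd i (fun z => kernelIntegral κ f θ z y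
        - kernelIntegral κ (fun q => q.2 ^ a * w q) (lap θ) z y) z
      = kernelIntegral κ f (pd i θ) z y
        - kernelIntegral κ (fun q => q.2 ^ a * w q) (lap (pd i θ)) z y := by
  have h1 := ((contDiff_kernelIntegral hκ hD.isSource_f hθ y 1).differentiable
    (by norm_num)).differentiableAt (x := z)
  have h2 := ((contDiff_kernelIntegral hκ hD.isSource_rpow_mul_w hθ.lap y 1).differentiable
    (by norm_num)).differentiableAt (x := z)
  rw [← pd_kernelIntegral hκ hD.isSource_f hθ, ← hθ.pd_lap,
    ← pd_kernelIntegral hκ hD.isSource_rpow_mul_w hθ.lap]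
  simp only [pd]
  rw [fderiv_fun_sub h1 h2]
  rfl

lemma pd_mollSolution (hθ : IsMollifier θ) (y : ℝ) (i : Fin n) :
    pd i (fun z => mollSolution a w f θ z y) = fun z => mollSolution a w f (pd i θ) z y :=
  funext fun z => hD.pd_sub_kernelIntegral (isKernel_doubleTailKernel hD.nonpos) hθ y i z

lemma pd_mollConormal (hθ : IsMollifier θ) (y : ℝ) (i : Fin n) :
    pd i (fun z => mollConormal a w f θ z y) = fun z => mollConormal a w f (pd i θ) z y :=
  funext fun z => hD.pd_sub_kernelIntegral isKernel_tailKernel hθ y i z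

lemma sum_kernelIntegral {κ : ℝ → ℝ → ℝ} (hκ : IsKernel κ) (hθ : IsMollifier θ) (y : ℝ)
    (z : EuclideanSpace ℝ (Fin n)) :
    ∑ i, (kernelIntegral κ f (pd i (pd i θ)) z y
        - kernelIntegral κ (fun q => q.2 ^ a * w q) (lap (pd i (pd i θ))) z y)
      = kernelIntegral κ f (lap θ) z y
        - kernelIntegral κ (fun q => q.2 ^ a * w q) (lap (lap θ)) z y := by
  have e : ∀ {g : EuclideanSpace ℝ (Fin n) × ℝ → ℝ} (_ : IsSource g)
      {θ : EuclideanSpace ℝ (Fin n) → ℝ} (_ : IsMollifier θ),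
      ∑ i, kernelIntegral κ g (pd i (pd i θ)) z y = kernelIntegral κ g (lap θ) z y :=
    fun hg θ hθ => by
      rw [← lap_kernelIntegral hκ hg hθ]
      refine Finset.sum_congr rfl fun i _ => ?_
      rw [funext fun z => pd_kernelIntegral hκ hg hθ y i z, pd_kernelIntegral hκ hg (hθ.pd i)]
  rw [Finset.sum_sub_distrib, e hD.isSource_f hθ, ← e hD.isSource_rpow_mul_w hθ.lap]
  simp only [hθ.pd_lap, (hθ.pd _).pd_lap]

lemma lap_mollSolution (hθ : IsMollifier θ) (y : ℝ) :
    lap (fun z => mollSolution a w f θ z y) = fun z => mollSolution a w f (lap θ) z y := by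
  funext z
  simp only [lap, hD.pd_mollSolution hθ, hD.pd_mollSolution (hθ.pd _)]
  exact hD.sum_kernelIntegral (isKernel_doubleTailKernel hD.nonpos) hθ y z

lemma lap_mollConormal (hθ : IsMollifier θ) (y : ℝ) :
    lap (fun z => mollConormal a w f θ z y) = fun z => mollConormal a w f (lap θ) z y := by
  funext z
  simp only [lap, hD.pd_mollConormal hθ, hD.pd_mollConormal (hθ.pd _)]
  exact hD.sum_kernelIntegral isKernel_tailKernel hθ y z

/-- The mollified solution vanishes at the boundary, because `w` has zero trace. -/
lemma mollSolution_zero (hθ : IsMollifier θ) (z : EuclideanSpace ℝ (Fin n)) :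
    mollSolution a w f θ z 0 = 0 := by
  have hc : Continuous (mollSolution a w f θ z) :=
    IsTangentiallySmooth.continuous_slice (hD.continuous_mollSolution hθ) z
  have h1 : Tendsto (fun y => ENNReal.ofReal (mollSolution a w f θ z y ^ 2)) boundaryFilter
      (𝓝 (ENNReal.ofReal (mollSolution a w f θ z 0 ^ 2))) :=
    ENNReal.tendsto_ofReal (((hc.tendsto 0).mono_left boundaryFilter_le).pow 2)
  have hfin : ∫⁻ x, ENNReal.ofReal (θ (z - x) ^ 2) ≠ ⊤ := by
    have : Integrable fun x => θ (z - x) ^ 2 :=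
      ((hθ.contDiff_comp_sub z).continuous.pow 2).integrable_of_hasCompactSupport
        (HasCompactSupport.intro (isCompact_closedBall z (1 / 8)) fun x hx => by
          rw [Metric.mem_closedBall, not_le, dist_comm, dist_eq_norm] at hx
          show θ (z - x) ^ 2 = 0
          rw [hθ.eq_zero _ hx, zero_pow two_ne_zero])
    exact (lintegral_ofReal_ne_top_iff_integrable this.aestronglyMeasurable
      (Eventually.of_forall fun x => sq_nonneg _)).2 this
  have h2 : Tendsto (fun y => (∫⁻ x, ENNReal.ofReal (θ (z - x) ^ 2))
      * ∫⁻ x, ENNReal.ofReal (w (x, y) ^ 2)) boundaryFilter (𝓝 0) := by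
    have := ENNReal.Tendsto.const_mul hD.trace (Or.inr hfin)
    rwa [mul_zero] at this
  have h3 : Tendsto (fun y => ENNReal.ofReal (mollSolution a w f θ z y ^ 2)) boundaryFilter
      (𝓝 0) := by
    refine tendsto_of_tendsto_of_tendsto_of_le_of_le' tendsto_const_nhds h2
      (Eventually.of_forall fun _ => zero_le) ?_
    filter_upwards [eventually_boundaryFilter_of_ae (hD.ae_moll_solution_eq hθ z)] with y hy
    rw [← hy]
    exact ofReal_sq_moll_le hθ
      (hD.isLocalized.measurable.comp measurable_prodMk_right).aemeasurable z
  have h4 := tendsto_nhds_unique h1 h3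
  rw [ENNReal.ofReal_eq_zero] at h4
  exact pow_eq_zero_iff two_ne_zero |>.1 (le_antisymm h4 (sq_nonneg _))

/-- Mollification turns weak solutions into tangentially smooth ones. -/
theorem exists_isTangentiallySmooth (hθ : IsMollifier θ) :
    ∃ k, IsTangentiallySmooth a (mollSolution a w f θ) (mollConormal a w f θ)
      (fun z y => moll θ (fun x => f (x, y)) z) k := by
  obtain ⟨C, hC0, hC⟩ := hθ.exists_bound
  have hf := hD.isLocalized_rhs
  have sf := hD.isSource_f
  have sw := hD.isSource_rpow_mul_w
  have hk : Integrable fun y => ∫ x, |f (x, y)| := by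
    have := sf.integrable.abs
    rw [Measure.volume_eq_prod] at this
    exact this.integral_prod_right
  refine ⟨fun y => C * ∫ x, |f (x, y)|, ?_⟩
  refine
    { contDiff_u := fun y => by exact_mod_cast hD.contDiff_mollSolution hθ y 2
      contDiff_p := fun y => by exact_mod_cast hD.contDiff_mollConormal hθ y 2
      u_eq_zero := fun z y hz => ?_
      p_eq_zero := fun z y hz => ?_
      F_eq_zero := fun z y hz => moll_eq_zero hθ (fun x hx => hf.eq_zero_of_lt (x, y) hx) hz
      u_eq_zero_of_le := fun z y hy => hD.mollSolution_eq_zero_of_le z hy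
      p_eq_zero_of_le := fun z y hy => hD.mollConormal_eq_zero_of_le z hy
      u_zero := hD.mollSolution_zero hθ
      continuous_u := hD.continuous_mollSolution hθ
      continuous_pd_u := fun i => ?_
      continuous_lap_u := ?_
      continuous_p := hD.continuous_mollConormal hθ
      continuous_pd_p := fun i => ?_
      continuous_lap_p := ?_
      hasDerivAt_u := fun z y hy => hD.hasDerivAt_mollSolution hθ z hy
      hasDerivAt_pd_u := fun i z y hy => ?_
      hasDerivAt_lap_u := fun z y hy => ?_
      measurable_F := ?_
      abs_F_le := fun z y _ => ?_
      integrableOn_k := (hk.const_mul C).integrableOn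
      integrableOn_sq_k := ?_
      p_sub := fun z => ⟨fun t => moll θ (fun x => f (x, t)) z
        - moll (lap θ) (fun x => t ^ a * w (x, t)) z,
        (integrable_moll sf hθ z).sub (integrable_moll sw hθ.lap z),
        fun b c => hD.mollConormal_sub hθ z b c, ?_⟩ }
  · rw [mollSolution, kernelIntegral_eq_zero sf hθ z y hz,
      kernelIntegral_eq_zero sw hθ.lap z y hz, sub_zero]
  · rw [mollConormal, kernelIntegral_eq_zero sf hθ z y hz,
      kernelIntegral_eq_zero sw hθ.lap z y hz, sub_zero]
  · simp only [hD.pd_mollSolution hθ]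
    exact hD.continuous_mollSolution (hθ.pd i)
  · simp only [hD.lap_mollSolution hθ]
    exact hD.continuous_mollSolution hθ.lap
  · simp only [hD.pd_mollConormal hθ]
    exact hD.continuous_mollConormal (hθ.pd i)
  · simp only [hD.lap_mollConormal hθ]
    exact hD.continuous_mollConormal hθ.lap
  · simp only [hD.pd_mollSolution hθ, hD.pd_mollConormal hθ]
    exact hD.hasDerivAt_mollSolution (hθ.pd i) z hy
  · simp only [hD.lap_mollSolution hθ, hD.lap_mollConormal hθ]
    exact hD.hasDerivAt_mollSolution hθ.lap z hy
  · exact measurable_moll hθ hf.measurable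
  · rw [← integral_const_mul, ← Real.norm_eq_abs]
    refine norm_integral_le_of_norm_le ((hf.integrable_slice y).abs.const_mul C)
      (Eventually.of_forall fun x => ?_)
    rw [norm_mul, Real.norm_eq_abs, Real.norm_eq_abs]
    exact mul_le_mul_of_nonneg_right (hC _) (abs_nonneg _)
  · have hi := hf.integrable_sq
    rw [Measure.volume_eq_prod] at hi
    have hi2 := (hi.integral_prod_right.const_mul (C ^ 2 * (volume (Metric.closedBall
      (0 : EuclideanSpace ℝ (Fin n)) (1 / 2))).toReal)).integrableOn (s := Set.Ioc 0 (1 / 2))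
    refine hi2.mono' ?_ ?_
    · have h1 := (hk.const_mul C).aestronglyMeasurable.pow 2
      have h2 : Measurable fun y : ℝ => y ^ a := by fun_prop
      exact (h1.aemeasurable.div h2.aemeasurable).aestronglyMeasurable.restrict
    · filter_upwards [ae_restrict_mem measurableSet_Ioc] with y hy
      have hY : 0 < y ^ a := Real.rpow_pos_of_pos hy.1 a
      have h1 := hf.sq_integral_abs_le y
      rw [Real.norm_eq_abs, abs_of_nonneg (by positivity), integral_const_mul,
        Real.rpow_neg hy.1.le, mul_pow]
      calc C ^ 2 * (∫ x, |f (x, y)|) ^ 2 / y ^ a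
          ≤ C ^ 2 * ((volume (Metric.closedBall (0 : EuclideanSpace ℝ (Fin n)) (1 / 2))).toReal
            * ∫ x, f (x, y) ^ 2) / y ^ a := by gcongr
        _ = _ := by ring
  · filter_upwards [hD.ae_moll_solution_eq hθ.lap z] with t ht ht0
    simp only [hD.lap_mollSolution hθ]
    rw [← ht ht0, moll_const_mul]

end IsWeakData

end Smoothness

/-! ### Approximate identities in the tangential variables -/

section ApproximateIdentity

variable {n : ℕ} {g : EuclideanSpace ℝ (Fin n) → ℝ}

/-- A smooth bump with inner radius `1/(16(k+1))` and outer radius `1/(8(k+1))`. -/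
noncomputable def approxBump (n k : ℕ) : ContDiffBump (0 : EuclideanSpace ℝ (Fin n)) where
  rIn := 1 / (16 * ((k : ℝ) + 1))
  rOut := 1 / (8 * ((k : ℝ) + 1))
  rIn_pos := by positivity
  rIn_lt_rOut := by
    have : (0 : ℝ) < k + 1 := by positivity
    exact one_div_lt_one_div_of_lt (by positivity) (by linarith)

/-- A smooth approximate identity on `ℝⁿ`. -/
noncomputable def approxId (n k : ℕ) : EuclideanSpace ℝ (Fin n) → ℝ :=
  (approxBump n k).normed volume

lemma approxId_nonneg (k : ℕ) (z : EuclideanSpace ℝ (Fin n)) : 0 ≤ approxId n k z :=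
  (approxBump n k).nonneg_normed z

lemma approxId_eq_zero {k : ℕ} {z : EuclideanSpace ℝ (Fin n)}
    (hz : 1 / (8 * ((k : ℝ) + 1)) < ‖z‖) : approxId n k z = 0 := by
  have h := (approxBump n k).support_normed_eq (μ := volume)
  by_contra hn
  have h1 : z ∈ Metric.ball (0 : EuclideanSpace ℝ (Fin n)) (approxBump n k).rOut := h ▸ hn
  rw [mem_ball_zero_iff] at h1
  exact absurd hz (not_lt.2 h1.le)

lemma isMollifier_approxId (k : ℕ) : IsMollifier (approxId n k) where
  contDiff := (approxBump n k).contDiff_normed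
  eq_zero z hz := approxId_eq_zero (lt_of_le_of_lt
    (one_div_le_one_div_of_le (by norm_num) (by linarith [Nat.cast_nonneg (α := ℝ) k])) hz)

lemma lintegral_approxId (k : ℕ) :
    ∫⁻ z : EuclideanSpace ℝ (Fin n), ENNReal.ofReal (approxId n k z) = 1 := by
  simp only [approxId]
  rw [← ofReal_integral_eq_lintegral_ofReal (approxBump n k).integrable_normed
    (Eventually.of_forall fun z => approxId_nonneg k z)]
  simp [(approxBump n k).integral_normed]

lemma tendsto_approxRadius : Tendsto (fun k : ℕ => 1 / (8 * ((k : ℝ) + 1))) atTop (𝓝 0) := by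
  have := (tendsto_one_div_add_atTop_nhds_zero_nat (𝕜 := ℝ)).const_mul (1 / 8)
  rw [mul_zero] at this
  exact this.congr fun k => by rw [one_div_mul_one_div]

lemma ae_tendsto_moll_approxId (hg : LocallyIntegrable g) :
    ∀ᵐ z, Tendsto (fun k => moll (approxId n k) g z) atTop (𝓝 (g z)) := by
  filter_upwards [ContDiffBump.ae_convolution_tendsto_right_of_locallyIntegrable
    (φ := fun k => approxBump n k) (K := 2) tendsto_approxRadius (Eventually.of_forall fun k => by
      have : (0 : ℝ) < k + 1 := by positivity
      show 1 / (8 * ((k : ℝ) + 1)) ≤ 2 * (1 / (16 * ((k : ℝ) + 1)))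
      apply le_of_eq
      field_simp
      norm_num) hg] with z hz
  refine hz.congr fun k => ?_
  rw [convolution_lsmul_swap]
  rfl

/-- A weighted form of Jensen's inequality for the convolution with an approximate identity. -/
lemma lintegral_mul_moll_approxId_sq_le (hg : Measurable g) {k : ℕ}
    {A B : EuclideanSpace ℝ (Fin n) → ℝ≥0∞} (hB : Measurable B)
    (hAB : ∀ z x, ‖z - x‖ ≤ 1 / (8 * ((k : ℝ) + 1)) → g x ≠ 0 → A z ≤ B x) :
    ∫⁻ z, A z * ENNReal.ofReal (moll (approxId n k) g z ^ 2)
      ≤ ∫⁻ x, B x * ENNReal.ofReal (g x ^ 2) := by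
  have hη := (isMollifier_approxId (n := n) k).continuous
  have hη0 := approxId_nonneg (n := n) k
  have hsub : ∀ z : EuclideanSpace ℝ (Fin n), Measurable fun x => approxId n k (z - x) := fun z =>
    (hη.comp (by fun_prop)).measurable
  have hj : ∀ z, ENNReal.ofReal (moll (approxId n k) g z ^ 2)
      ≤ ∫⁻ x, ENNReal.ofReal (approxId n k (z - x)) * ENNReal.ofReal (g x ^ 2) := fun z => by
    have h1 := ofReal_sq_integral_mul_le (μ := volume) (f := fun x => √(approxId n k (z - x)))
      (g := fun x => √(approxId n k (z - x)) * g x) (hsub z).sqrt.aemeasurable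
      ((hsub z).sqrt.mul hg).aemeasurable
    have e1 : ∀ x, √(approxId n k (z - x)) * (√(approxId n k (z - x)) * g x)
        = approxId n k (z - x) * g x := fun x => by
      rw [← mul_assoc, Real.mul_self_sqrt (hη0 _)]
    have e2 : ∀ x, √(approxId n k (z - x)) ^ 2 = approxId n k (z - x) := fun x =>
      Real.sq_sqrt (hη0 _)
    simp only [e1, mul_pow, e2] at h1
    rw [lintegral_sub_left_eq_self (fun x => ENNReal.ofReal (approxId n k x)) z,
      lintegral_approxId, one_mul] at h1
    refine h1.trans (le_of_eq (lintegral_congr fun x => ENNReal.ofReal_mul (hη0 _)))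
  have hm : Measurable fun q : EuclideanSpace ℝ (Fin n) × EuclideanSpace ℝ (Fin n) =>
      ENNReal.ofReal (approxId n k (q.1 - q.2)) := (hη.comp (by fun_prop)).measurable.ennreal_ofReal
  calc ∫⁻ z, A z * ENNReal.ofReal (moll (approxId n k) g z ^ 2)
      ≤ ∫⁻ z, ∫⁻ x, B x * (ENNReal.ofReal (approxId n k (z - x)) * ENNReal.ofReal (g x ^ 2)) := by
        refine lintegral_mono fun z => ?_
        refine (mul_le_mul_right (hj z) (A z)).trans ?_
        rw [← lintegral_const_mul _
          ((hsub z).ennreal_ofReal.fun_mul (hg.pow_const 2).ennreal_ofReal)]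
        refine lintegral_mono fun x => ?_
        by_cases hx : ‖z - x‖ ≤ 1 / (8 * ((k : ℝ) + 1))
        · by_cases h0 : g x = 0
          · simp [h0]
          · exact mul_le_mul_left (hAB z x hx h0) _
        · simp [approxId_eq_zero (not_le.1 hx)]
    _ = ∫⁻ x, ∫⁻ z, B x * (ENNReal.ofReal (approxId n k (z - x)) * ENNReal.ofReal (g x ^ 2)) := by
        refine lintegral_lintegral_swap (Measurable.aemeasurable ?_)
        exact (hB.comp measurable_snd).mul
          (hm.mul ((hg.comp measurable_snd).pow_const 2).ennreal_ofReal)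
    _ = ∫⁻ x, B x * ENNReal.ofReal (g x ^ 2) := by
        refine lintegral_congr fun x => ?_
        have h1 : Measurable fun z => ENNReal.ofReal (approxId n k (z - x)) :=
          (hη.comp (by fun_prop)).measurable.ennreal_ofReal
        rw [lintegral_const_mul _ (h1.mul_const _), lintegral_mul_const _ h1,
          lintegral_sub_right_eq_self (fun x => ENNReal.ofReal (approxId n k x)) x,
          lintegral_approxId, one_mul]

/-- The slab version of `lintegral_mul_moll_approxId_sq_le`. -/
lemma lintegral_slab_mul_moll_approxId_sq_le {h : EuclideanSpace ℝ (Fin n) × ℝ → ℝ}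
    (hh : Measurable h) {k : ℕ} {A B : EuclideanSpace ℝ (Fin n) × ℝ → ℝ≥0∞} (hA : Measurable A)
    (hB : Measurable B) (hAB : ∀ z x y, ‖z - x‖ ≤ 1 / (8 * ((k : ℝ) + 1)) → h (x, y) ≠ 0 →
      A (z, y) ≤ B (x, y)) :
    ∫⁻ q, A q * ENNReal.ofReal (moll (approxId n k) (fun x => h (x, q.2)) q.1 ^ 2) ∂slab n 0
      ≤ ∫⁻ q, B q * ENNReal.ofReal (h q ^ 2) ∂slab n 0 := by
  rw [slab, lintegral_prod_symm _ (hA.fun_mul ((measurable_moll (isMollifier_approxId k)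
      hh).pow_const 2).ennreal_ofReal).aemeasurable,
    lintegral_prod_symm _ (hB.fun_mul (hh.pow_const 2).ennreal_ofReal).aemeasurable]
  exact lintegral_mono fun y => lintegral_mul_moll_approxId_sq_le
    (hh.comp measurable_prodMk_right) (hB.comp measurable_prodMk_right)
    fun z x hz hx => hAB z x y hz hx

/-- The weight changes by a factor close to one over the support of an approximate identity. -/
lemma expWeight_sq_le {τ s y ε : ℝ} (hτ : 0 ≤ τ) {z x : EuclideanSpace ℝ (Fin n)}
    (hzx : ‖z - x‖ ≤ ε) (hx : ‖x‖ ≤ 1 / 2) :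
    expWeight τ s z y ^ 2 ≤ Real.exp (τ * ε) * expWeight τ s x y ^ 2 := by
  have h1 : ‖x‖ - ε ≤ ‖z‖ := by
    have := norm_sub_norm_le x z
    rw [norm_sub_rev] at this
    linarith
  have h0 : 0 ≤ ε := (norm_nonneg _).trans hzx
  have h2 : ‖x‖ ^ 2 - ‖z‖ ^ 2 ≤ 2 * ε := by
    by_cases h : ε ≤ ‖x‖
    · nlinarith [norm_nonneg z, norm_nonneg x]
    · nlinarith [norm_nonneg z, norm_nonneg x]
  rw [expWeight, expWeight, ← Real.exp_nat_mul, ← Real.exp_nat_mul, ← Real.exp_add]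
  refine Real.exp_le_exp.2 ?_
  simp only [weight]
  push_cast
  nlinarith [mul_le_mul_of_nonneg_left h2 hτ]

/-- Fatou's lemma: an almost everywhere limit inherits bounds on integrals. -/
lemma lintegral_le_of_ae_tendsto {α : Type*} [MeasurableSpace α] {μ : Measure α}
    {F : ℕ → α → ℝ} {G : α → ℝ} {C : ℕ → ℝ≥0∞} {C₀ : ℝ≥0∞} (hF : ∀ k, AEMeasurable (F k) μ)
    (h : ∀ᵐ x ∂μ, Tendsto (fun k => F k x) atTop (𝓝 (G x)))
    (hC : ∀ k, ∫⁻ x, ENNReal.ofReal (F k x) ∂μ ≤ C k) (hC₀ : Tendsto C atTop (𝓝 C₀)) :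
    ∫⁻ x, ENNReal.ofReal (G x) ∂μ ≤ C₀ := by
  have h1 : ∫⁻ x, ENNReal.ofReal (G x) ∂μ
      = ∫⁻ x, liminf (fun k => ENNReal.ofReal (F k x)) atTop ∂μ := by
    refine lintegral_congr_ae ?_
    filter_upwards [h] with x hx
    exact (ENNReal.tendsto_ofReal hx).liminf_eq.symm
  rw [h1]
  refine (lintegral_liminf_le' fun k => (hF k).ennreal_ofReal).trans ?_
  rw [← hC₀.liminf_eq]
  exact liminf_le_liminf (Eventually.of_forall hC)

lemma ae_ae_of_ae_volume {P : EuclideanSpace ℝ (Fin n) × ℝ → Prop}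
    (h : ∀ᵐ q, P q) : ∀ᵐ y : ℝ, ∀ᵐ x : EuclideanSpace ℝ (Fin n), P (x, y) := by
  rw [Measure.volume_eq_prod] at h
  exact Measure.ae_ae_of_ae_prod
    (Measure.measurePreserving_swap.quasiMeasurePreserving.ae h)

lemma ae_volume_of_forall_ae {P : EuclideanSpace ℝ (Fin n) × ℝ → Prop}
    (hP : MeasurableSet {q | P q}) (h : ∀ y, ∀ᵐ x, P (x, y)) : ∀ᵐ q, P q := by
  rw [Measure.volume_eq_prod, Measure.ae_prod_iff_ae_ae hP]
  exact (Measure.ae_ae_comm (p := fun x y => P (x, y)) hP).2 (Eventually.of_forall h)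

/-- The mollifications of a localized function converge almost everywhere. -/
lemma IsLocalized.ae_tendsto_moll_approxId {b : ℝ} {h : EuclideanSpace ℝ (Fin n) × ℝ → ℝ}
    (hh : IsLocalized b h) : ∀ᵐ q : EuclideanSpace ℝ (Fin n) × ℝ,
      Tendsto (fun k => moll (approxId n k) (fun x => h (x, q.2)) q.1) atTop (𝓝 (h q)) :=
  ae_volume_of_forall_ae (measurableSet_tendsto_fun
      (fun k => measurable_moll (isMollifier_approxId k) hh.measurable) hh.measurable) fun y =>
    Carleman.ae_tendsto_moll_approxId (hh.integrable_slice y).locallyIntegrable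

end ApproximateIdentity

/-! ### Removal of the mollification -/

section WeakSolutions

variable {n : ℕ} {a b c r s τ : ℝ} {w gy f : EuclideanSpace ℝ (Fin n) × ℝ → ℝ}
  {gx : Fin n → EuclideanSpace ℝ (Fin n) × ℝ → ℝ}

lemma lintegral_Ioc_rpow (hr : -1 < r) (hc : 0 ≤ c) :
    ∫⁻ t in Set.Ioc 0 c, ENNReal.ofReal (t ^ r) = ENNReal.ofReal (c ^ (r + 1) / (r + 1)) := by
  have h1 : IntegrableOn (fun t : ℝ => t ^ r) (Set.Ioc 0 c) := by
    rw [← intervalIntegrable_iff_integrableOn_Ioc_of_le hc]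
    exact intervalIntegral.intervalIntegrable_rpow' hr
  rw [← ofReal_integral_eq_lintegral_ofReal h1, ← intervalIntegral.integral_of_le hc,
    integral_rpow (Or.inl hr), Real.zero_rpow (by linarith), sub_zero]
  filter_upwards [ae_restrict_mem measurableSet_Ioc] with t ht
  exact Real.rpow_nonneg ht.1.le r

lemma tendsto_lintegral_Ioc_rpow (hr : -1 < r) :
    Tendsto (fun c => ∫⁻ t in Set.Ioc 0 c, ENNReal.ofReal (t ^ r)) boundaryFilter (𝓝 0) := by
  have h1 : Tendsto (fun c : ℝ => ENNReal.ofReal (c ^ (r + 1) / (r + 1))) (𝓝 0) (𝓝 0) := by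
    have h2 := (Real.continuousAt_rpow_const 0 (r + 1) (Or.inr (by linarith))).tendsto
    rw [Real.zero_rpow (by linarith)] at h2
    have h3 := ENNReal.tendsto_ofReal (h2.div_const (r + 1))
    rwa [zero_div, ENNReal.ofReal_zero] at h3
  refine (h1.mono_left boundaryFilter_le).congr' ?_
  filter_upwards [eventually_boundaryFilter_of_ae (P := fun y => 0 < y)
    (Eventually.of_forall fun _ h => h)] with c hc
  exact (lintegral_Ioc_rpow hr hc.le).symm

lemma eventually_boundaryFilter_mem_Ioc : ∀ᶠ y in boundaryFilter, y ∈ Set.Ioc (0 : ℝ) (1 / 2) :=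
  Filter.mem_inf_of_left (Ioc_mem_nhdsGT (by norm_num))

lemma eLpNorm_two_sq {α F : Type*} [MeasurableSpace α] [NormedAddCommGroup F] {μ : Measure α}
    (g : α → F) : eLpNorm g 2 μ ^ 2 = ∫⁻ x, ENNReal.ofReal (‖g x‖ ^ 2) ∂μ := by
  have h := eLpNorm_nnreal_pow_eq_lintegral (f := g) (μ := μ) (p := 2) two_ne_zero
  simp only [NNReal.coe_ofNat, ENNReal.coe_ofNat, ENNReal.rpow_ofNat] at h
  rw [h]
  refine lintegral_congr fun x => ?_
  rw [ENNReal.ofReal_pow (norm_nonneg _), ofReal_norm]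

lemma ae_eq_of_forall_ae_eq {A B : EuclideanSpace ℝ (Fin n) × ℝ → ℝ} (hA : Measurable A)
    (hB : Measurable B) (h : ∀ z, ∀ᵐ y, 0 < y → A (z, y) = B (z, y)) :
    ∀ᵐ q : EuclideanSpace ℝ (Fin n) × ℝ, 0 < q.2 → A q = B q := by
  rw [Measure.volume_eq_prod, Measure.ae_prod_iff_ae_ae]
  · exact Eventually.of_forall h
  · have h1 : {q : EuclideanSpace ℝ (Fin n) × ℝ | 0 < q.2 → A q = B q}
        = {q | q.2 ≤ 0} ∪ {q | A q = B q} := by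
      ext q
      simp only [Set.mem_ofPred_eq, Set.mem_union, ← not_lt]
      tauto
    rw [h1]
    exact (measurableSet_le measurable_snd measurable_const).union (measurableSet_eq_fun hA hB)

lemma expWeight_eq_mul (z : EuclideanSpace ℝ (Fin n)) (y : ℝ) : expWeight τ s z y
    = Real.exp (τ * (2 * (-(1 / (2 - 2 * s)) * y ^ (2 - 2 * s) + 1 / 2 * y ^ 2)))
      * Real.exp (τ * -(‖z‖ ^ 2 / 4)) := by
  rw [expWeight, weight, ← Real.exp_add]
  congr 1
  ring

lemma expWeight_zero (hs' : s < 1) (z : EuclideanSpace ℝ (Fin n)) :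
    expWeight τ s z 0 = Real.exp (τ * -(‖z‖ ^ 2 / 4)) := by
  rw [expWeight_eq_mul, Real.zero_rpow (by linarith)]
  simp

namespace IsWeakData

variable (hD : IsWeakData a w gx gy f)
include hD

lemma ae_rpow_mul_moll_eq : ∀ᵐ q : EuclideanSpace ℝ (Fin n) × ℝ, 0 < q.2 → ∀ k,
    q.2 ^ a * moll (approxId n k) (fun x => gy (x, q.2)) q.1
      = mollConormal a w f (approxId n k) q.1 q.2 := by
  have h1 : ∀ k, ∀ᵐ q : EuclideanSpace ℝ (Fin n) × ℝ, 0 < q.2 →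
      q.2 ^ a * moll (approxId n k) (fun x => gy (x, q.2)) q.1
        = mollConormal a w f (approxId n k) q.1 q.2 := fun k =>
    ae_eq_of_forall_ae_eq ((measurable_snd.pow_const a).mul
        (measurable_moll (isMollifier_approxId k) hD.isLocalized_normal.measurable))
      (hD.continuous_mollConormal (isMollifier_approxId k)).measurable
      fun z => hD.ae_moll_conormal_eq (isMollifier_approxId k) z
  filter_upwards [ae_all_iff.2 h1] with q hq h0 k
  exact hq k h0

lemma ae_tendsto_mollConormal : ∀ᵐ q : EuclideanSpace ℝ (Fin n) × ℝ, 0 < q.2 →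
    Tendsto (fun k => mollConormal a w f (approxId n k) q.1 q.2) atTop (𝓝 (q.2 ^ a * gy q)) := by
  filter_upwards [hD.ae_rpow_mul_moll_eq, hD.isLocalized_normal.ae_tendsto_moll_approxId]
    with q hq hq' h0
  exact (hq'.const_mul _).congr fun k => hq h0 k

lemma ae_tendsto_mollSolution : ∀ᵐ q : EuclideanSpace ℝ (Fin n) × ℝ, 0 < q.2 →
    Tendsto (fun k => mollSolution a w f (approxId n k) q.1 q.2) atTop (𝓝 (w q)) := by
  have h1 : ∀ k, ∀ᵐ q : EuclideanSpace ℝ (Fin n) × ℝ, 0 < q.2 →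
      moll (approxId n k) (fun x => w (x, q.2)) q.1
        = mollSolution a w f (approxId n k) q.1 q.2 := fun k =>
    ae_eq_of_forall_ae_eq
      (measurable_moll (isMollifier_approxId k) hD.isLocalized.measurable)
      (hD.continuous_mollSolution (isMollifier_approxId k)).measurable
      fun z => hD.ae_moll_solution_eq (isMollifier_approxId k) z
  filter_upwards [ae_all_iff.2 h1, hD.isLocalized.ae_tendsto_moll_approxId] with q hq hq' h0
  exact hq'.congr fun k => hq k h0

lemma ae_tendsto_pd_mollSolution (i : Fin n) : ∀ᵐ q : EuclideanSpace ℝ (Fin n) × ℝ, 0 < q.2 →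
    Tendsto (fun k => pd i (fun z => mollSolution a w f (approxId n k) z q.2) q.1) atTop
      (𝓝 (gx i q)) := by
  have h1 : ∀ k, ∀ᵐ q : EuclideanSpace ℝ (Fin n) × ℝ, 0 < q.2 →
      moll (approxId n k) (fun x => gx i (x, q.2)) q.1
        = mollSolution a w f (pd i (approxId n k)) q.1 q.2 := fun k =>
    ae_eq_of_forall_ae_eq
      (measurable_moll (isMollifier_approxId k) (hD.isLocalized_tangential i).measurable)
      (hD.continuous_mollSolution ((isMollifier_approxId k).pd i)).measurable
      fun z => by
        filter_upwards [hD.ae_moll_solution_eq ((isMollifier_approxId k).pd i) z,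
          hD.moll_pd_ae_eq (isMollifier_approxId k) z i] with y hy hy' h0
        exact hy'.symm.trans (hy h0)
  filter_upwards [ae_all_iff.2 h1, (hD.isLocalized_tangential i).ae_tendsto_moll_approxId]
    with q hq hq' h0
  refine hq'.congr fun k => ?_
  rw [hq k h0, hD.pd_mollSolution (isMollifier_approxId k)]

lemma lintegral_sq_rhs_ne_top :
    ∫⁻ q, ENNReal.ofReal (f q ^ 2 / q.2 ^ a) ∂slab n 0 ≠ ⊤ := by
  refine ne_top_of_le_ne_top hD.isLocalized_rhs.lintegral_ne_top ?_
  have h1 : ∫⁻ q, ENNReal.ofReal (f q ^ 2 / q.2 ^ a) ∂slab n 0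
      = ∫⁻ q, ENNReal.ofReal (q.2 ^ (-a) * f q ^ 2) ∂slab n 0 := by
    refine lintegral_congr_ae ?_
    filter_upwards [ae_slab_mem 0] with q hq
    rw [Real.rpow_neg hq.1.le, div_eq_inv_mul]
  rw [h1, slab_eq_restrict]
  exact lintegral_mono' Measure.restrict_le_self le_rfl

lemma lintegral_sq_moll_rhs_le (k : ℕ) :
    ∫⁻ q : EuclideanSpace ℝ (Fin n) × ℝ, ENNReal.ofReal
      (moll (approxId n k) (fun x => f (x, q.2)) q.1 ^ 2 / q.2 ^ a) ∂slab n 0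
      ≤ ∫⁻ q, ENNReal.ofReal (f q ^ 2 / q.2 ^ a) ∂slab n 0 := by
  have hA : Measurable fun q : EuclideanSpace ℝ (Fin n) × ℝ =>
      ENNReal.ofReal ((q.2 ^ a)⁻¹) := (measurable_snd.pow_const a).inv.ennreal_ofReal
  have h := lintegral_slab_mul_moll_approxId_sq_le hD.isLocalized_rhs.measurable (k := k) hA hA
    fun z x y _ _ => le_rfl
  have e : ∀ x y : ℝ, ENNReal.ofReal (x ^ 2 / y ^ a)
      = ENNReal.ofReal ((y ^ a)⁻¹) * ENNReal.ofReal (x ^ 2) := fun x y => by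
    rw [div_eq_mul_inv, ENNReal.ofReal_mul (sq_nonneg _), mul_comm]
  simpa only [e] using h

lemma lintegral_weight_sq_moll_rhs_le (hs' : s < 1) (hτ : 0 ≤ τ) (k : ℕ) :
    ∫⁻ q : EuclideanSpace ℝ (Fin n) × ℝ, ENNReal.ofReal (expWeight τ s q.1 q.2 ^ 2
      * (moll (approxId n k) (fun x => f (x, q.2)) q.1 ^ 2 / q.2 ^ a)) ∂slab n 0
      ≤ ENNReal.ofReal (Real.exp (τ * (1 / (8 * ((k : ℝ) + 1)))))
        * ∫⁻ q, ENNReal.ofReal (expWeight τ s q.1 q.2 ^ 2 * (f q ^ 2 / q.2 ^ a)) ∂slab n 0 := by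
  have hE := (continuous_expWeight (n := n) (τ := τ) hs').measurable
  have hY : Measurable fun q : EuclideanSpace ℝ (Fin n) × ℝ => q.2 ^ a :=
    measurable_snd.pow_const a
  have hf := hD.isLocalized_rhs
  have h := lintegral_slab_mul_moll_approxId_sq_le hf.measurable (k := k)
    (A := fun q => ENNReal.ofReal (expWeight τ s q.1 q.2 ^ 2 / q.2 ^ a))
    (B := fun q => ENNReal.ofReal (Real.exp (τ * (1 / (8 * ((k : ℝ) + 1)))))
      * ENNReal.ofReal (expWeight τ s q.1 q.2 ^ 2 / q.2 ^ a))
    ((hE.pow_const 2).div hY).ennreal_ofReal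
    (((hE.pow_const 2).div hY).ennreal_ofReal.const_mul _) fun z x y hzx hx => by
      have hy : 0 < y := by
        by_contra hn
        exact hx (hf.eq_zero (x, y) fun h => hn h.1)
      have hx' : ‖x‖ ≤ 1 / 2 := by
        by_contra hn
        exact hx (hf.eq_zero_of_lt (x, y) (not_le.1 hn))
      rw [← ENNReal.ofReal_mul (Real.exp_pos _).le, ← mul_div_assoc]
      have := expWeight_sq_le (s := s) (y := y) hτ hzx hx'
      have hp : 0 < y ^ a := Real.rpow_pos_of_pos hy a
      gcongr
  have e : ∀ x y E : ℝ, ENNReal.ofReal (E ^ 2 * (x ^ 2 / y ^ a))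
      = ENNReal.ofReal (E ^ 2 / y ^ a) * ENNReal.ofReal (x ^ 2) := fun x y E => by
    rw [← ENNReal.ofReal_mul' (sq_nonneg _)]
    ring_nf
  simp only [e]
  refine h.trans (le_of_eq ?_)
  simp only [mul_assoc]
  exact lintegral_const_mul _ (((hE.pow_const 2).div hY).ennreal_ofReal.fun_mul
    (hf.measurable.pow_const 2).ennreal_ofReal)

lemma lintegral_sq_sub_conormal_le (hb : 0 ≤ b) (hbc : b ≤ c) (hc : c ≤ 1 / 2)
    (h1 : ∀ᵐ x : EuclideanSpace ℝ (Fin n), Tendsto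
      (fun k => mollConormal a w f (approxId n k) x b) atTop (𝓝 (b ^ a * gy (x, b))))
    (h2 : ∀ᵐ x : EuclideanSpace ℝ (Fin n), Tendsto
      (fun k => mollConormal a w f (approxId n k) x c) atTop (𝓝 (c ^ a * gy (x, c)))) :
    ∫⁻ x, ENNReal.ofReal ((c ^ a * gy (x, c) - b ^ a * gy (x, b)) ^ 2)
      ≤ (∫⁻ t in Set.Ioc b c, ENNReal.ofReal (t ^ a))
        * ∫⁻ q, ENNReal.ofReal (f q ^ 2 / q.2 ^ a) ∂slab n 0 := by
  refine lintegral_le_of_ae_tendsto (F := fun k x => (mollConormal a w f (approxId n k) x c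
    - mollConormal a w f (approxId n k) x b) ^ 2) (fun k => ?_) ?_ (fun k => ?_)
    tendsto_const_nhds
  · have h := fun y => (hD.contDiff_mollConormal (isMollifier_approxId k) y 0).continuous
    exact (((h c).sub (h b)).pow 2).aemeasurable
  · filter_upwards [h1, h2] with x hx hx'
    exact (hx'.sub hx).pow 2
  · obtain ⟨_, h⟩ := hD.exists_isTangentiallySmooth (isMollifier_approxId k)
    exact (h.lintegral_sq_sub_p_le hb hbc hc).trans
      (mul_le_mul_right (hD.lintegral_sq_moll_rhs_le k) _)

lemma lintegral_sq_tangential_le (hc : 0 ≤ c) (hc' : c ≤ 1 / 2) (i : Fin n)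
    (h : ∀ᵐ x : EuclideanSpace ℝ (Fin n), Tendsto
      (fun k => pd i (fun z => mollSolution a w f (approxId n k) z c) x) atTop
        (𝓝 (gx i (x, c)))) :
    ∫⁻ x, ENNReal.ofReal (gx i (x, c) ^ 2)
      ≤ (∫⁻ t in Set.Ioc 0 c, ENNReal.ofReal (t ^ (-a)))
        * ∫⁻ q, ENNReal.ofReal (f q ^ 2 / q.2 ^ a) ∂slab n 0 := by
  refine lintegral_le_of_ae_tendsto (F := fun k x =>
    pd i (fun z => mollSolution a w f (approxId n k) z c) x ^ 2) (fun k => ?_) ?_ (fun k => ?_)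
    tendsto_const_nhds
  · rw [hD.pd_mollSolution (isMollifier_approxId k)]
    exact ((hD.contDiff_mollSolution ((isMollifier_approxId k).pd i) c 0).continuous.pow
      2).aemeasurable
  · filter_upwards [h] with x hx
    exact hx.pow 2
  · obtain ⟨_, h⟩ := hD.exists_isTangentiallySmooth (isMollifier_approxId k)
    exact (h.lintegral_sq_pd_u_le hD.nonpos i hc hc').trans
      (mul_le_mul_right (hD.lintegral_sq_moll_rhs_le k) _)

/-- The tangential gradient vanishes at the boundary, since `w` does and the equation provides one
more tangential derivative of the conormal derivative. -/
theorem tendsto_lintegral_sq_tangential (i : Fin n) :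
    Tendsto (fun y => ∫⁻ x, ENNReal.ofReal (gx i (x, y) ^ 2)) boundaryFilter (𝓝 0) := by
  have h1 := ENNReal.Tendsto.mul_const (b := ∫⁻ q, ENNReal.ofReal (f q ^ 2 / q.2 ^ a) ∂slab n 0)
    (tendsto_lintegral_Ioc_rpow (r := -a) (by linarith [hD.nonpos]))
    (Or.inr hD.lintegral_sq_rhs_ne_top)
  rw [zero_mul] at h1
  refine tendsto_of_tendsto_of_tendsto_of_le_of_le' tendsto_const_nhds h1
    (Eventually.of_forall fun _ => zero_le) ?_
  have h2 := ae_ae_of_ae_volume (hD.ae_tendsto_pd_mollSolution i)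
  filter_upwards [eventually_boundaryFilter_of_ae (h2.mono fun y hy _ => hy),
    eventually_boundaryFilter_mem_Ioc] with y hy hy'
  exact hD.lintegral_sq_tangential_le hy'.1.le hy'.2 i (hy.mono fun x hx => hx hy'.1)

lemma eventually_ae_tendsto_mollConormal : ∀ᶠ y in boundaryFilter,
    ∀ᵐ x : EuclideanSpace ℝ (Fin n), Tendsto
      (fun k => mollConormal a w f (approxId n k) x y) atTop (𝓝 (y ^ a * gy (x, y))) := by
  have h2 := ae_ae_of_ae_volume hD.ae_tendsto_mollConormal
  filter_upwards [eventually_boundaryFilter_of_ae (h2.mono fun y hy _ => hy),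
    eventually_boundaryFilter_mem_Ioc] with y hy hy'
  exact hy.mono fun x hx => hx hy'.1

lemma tendsto_lintegral_Ioc_mul :
    Tendsto (fun y => (∫⁻ t in Set.Ioc 0 y, ENNReal.ofReal (t ^ a))
      * ∫⁻ q, ENNReal.ofReal (f q ^ 2 / q.2 ^ a) ∂slab n 0) boundaryFilter (𝓝 0) := by
  have h1 := ENNReal.Tendsto.mul_const (b := ∫⁻ q, ENNReal.ofReal (f q ^ 2 / q.2 ^ a) ∂slab n 0)
    (tendsto_lintegral_Ioc_rpow (r := a) hD.neg_one_lt) (Or.inr hD.lintegral_sq_rhs_ne_top)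
  rwa [zero_mul] at h1

/-- The weighted conormal derivatives on the slices are Cauchy in `L²` as the height tends to
zero. -/
theorem exists_tendsto_lintegral_sq_conormal (hs' : s < 1) (hτ : 0 ≤ τ) : ∃ L : ℝ≥0,
    Tendsto (fun y => ∫⁻ x, ENNReal.ofReal (expWeight τ s x 0 ^ 2 * (y ^ a * gy (x, y)) ^ 2))
      boundaryFilter (𝓝 (L : ℝ≥0∞)) := by
  have hE0 : Continuous fun x : EuclideanSpace ℝ (Fin n) => expWeight τ s x 0 :=
    (contDiff_expWeight 0).continuous
  have hE1 : ∀ x : EuclideanSpace ℝ (Fin n), ‖expWeight τ s x 0‖ ≤ 1 := fun x => by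
    rw [expWeight_zero hs', Real.norm_eq_abs, abs_of_pos (Real.exp_pos _), Real.exp_le_one_iff]
    nlinarith [mul_nonneg hτ (sq_nonneg ‖x‖)]
  set V : ℝ → EuclideanSpace ℝ (Fin n) → ℝ := fun y x =>
    expWeight τ s x 0 * (y ^ a * gy (x, y)) with hV
  have hVm : ∀ y, MemLp (V y) 2 := fun y =>
    ((hD.isLocalized_normal.memLp y).const_mul (y ^ a)).of_le
      (hE0.aestronglyMeasurable.mul
        ((hD.isLocalized_normal.memLp y).const_mul (y ^ a)).aestronglyMeasurable)
      (Eventually.of_forall fun x => by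
        rw [hV]
        simp only [norm_mul (expWeight τ s x 0)]
        exact mul_le_of_le_one_left (norm_nonneg _) (hE1 x))
  have hdist : ∀ ε : ℝ, 0 < ε → ∀ b c, 0 ≤ b → b ≤ c → c ≤ 1 / 2 →
      (∀ᵐ x : EuclideanSpace ℝ (Fin n), Tendsto
        (fun k => mollConormal a w f (approxId n k) x b) atTop (𝓝 (b ^ a * gy (x, b)))) →
      (∀ᵐ x : EuclideanSpace ℝ (Fin n), Tendsto
        (fun k => mollConormal a w f (approxId n k) x c) atTop (𝓝 (c ^ a * gy (x, c)))) →
      ((∫⁻ t in Set.Ioc 0 c, ENNReal.ofReal (t ^ a))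
        * ∫⁻ q, ENNReal.ofReal (f q ^ 2 / q.2 ^ a) ∂slab n 0) < ENNReal.ofReal ε ^ 2 →
      dist ‖(hVm b).toLp‖ ‖(hVm c).toLp‖ < ε := fun ε hε b c hb hbc hc h1 h2 h3 => by
    have e1 : eLpNorm (V c - V b) 2 volume ^ 2 < ENNReal.ofReal ε ^ 2 := by
      rw [eLpNorm_two_sq]
      refine lt_of_le_of_lt ?_ h3
      refine le_trans (lintegral_mono fun x => ENNReal.ofReal_le_ofReal ?_)
        ((hD.lintegral_sq_sub_conormal_le hb hbc hc h1 h2).trans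
          (mul_le_mul_left (lintegral_mono_set (Set.Ioc_subset_Ioc_left hb)) _))
      have e2 : V c x - V b x
          = expWeight τ s x 0 * (c ^ a * gy (x, c) - b ^ a * gy (x, b)) := by
        rw [hV]
        ring
      rw [Pi.sub_apply, e2, norm_mul, mul_pow, Real.norm_eq_abs (_ - _), sq_abs]
      exact mul_le_of_le_one_left (sq_nonneg _) (pow_le_one₀ (norm_nonneg _) (hE1 x))
    have e3 : eLpNorm (V c - V b) 2 volume < ENNReal.ofReal ε := by
      by_contra hn
      exact absurd e1 (not_lt.2 (pow_le_pow_left' (not_lt.1 hn) 2))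
    rw [dist_comm, Real.dist_eq]
    refine (abs_norm_sub_norm_le _ _).trans_lt ?_
    rw [← MemLp.toLp_sub, Lp.norm_toLp]
    exact (ENNReal.lt_ofReal_iff_toReal_lt e3.ne_top).1 e3
  have hcauchy : Cauchy (map (fun y => ‖(hVm y).toLp‖) boundaryFilter) := by
    rw [Metric.cauchy_iff]
    refine ⟨inferInstance, fun ε hε => ?_⟩
    have hev : ∀ᶠ y in boundaryFilter, y ∈ Set.Ioc (0 : ℝ) (1 / 2) ∧
        (∀ᵐ x : EuclideanSpace ℝ (Fin n), Tendsto
          (fun k => mollConormal a w f (approxId n k) x y) atTop (𝓝 (y ^ a * gy (x, y)))) ∧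
        ((∫⁻ t in Set.Ioc 0 y, ENNReal.ofReal (t ^ a))
          * ∫⁻ q, ENNReal.ofReal (f q ^ 2 / q.2 ^ a) ∂slab n 0) < ENNReal.ofReal ε ^ 2 := by
      filter_upwards [eventually_boundaryFilter_mem_Ioc, hD.eventually_ae_tendsto_mollConormal,
        hD.tendsto_lintegral_Ioc_mul.eventually_lt_const
          (pos_iff_ne_zero.2 (pow_ne_zero 2 (ENNReal.ofReal_pos.2 hε).ne'))] with y h1 h2 h3
      exact ⟨h1, h2, h3⟩
    refine ⟨_, image_mem_map hev, ?_⟩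
    rintro _ ⟨b, ⟨hb1, hb2, hb3⟩, rfl⟩ _ ⟨c, ⟨hc1, hc2, hc3⟩, rfl⟩
    rcases le_total b c with h | h
    · exact hdist ε hε b c hb1.1.le h hc1.2 hb2 hc2 hc3
    · rw [dist_comm]
      exact hdist ε hε c b hc1.1.le h hb1.2 hc2 hb2 hb3
  obtain ⟨l, hl⟩ := cauchy_map_iff_exists_tendsto.1 hcauchy
  refine ⟨l.toNNReal ^ 2, ?_⟩
  have h1 := ENNReal.Tendsto.pow (n := 2) (ENNReal.tendsto_ofReal hl)
  rw [ENNReal.coe_pow]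
  refine h1.congr fun y => ?_
  rw [Lp.norm_toLp, ENNReal.ofReal_toReal (hVm y).2.ne, eLpNorm_two_sq]
  refine lintegral_congr fun x => ?_
  rw [hV, Real.norm_eq_abs, sq_abs, mul_pow]

lemma tendsto_lintegral_weight_sq_conormal {L : ℝ≥0} (hs' : s < 1)
    (hL : Tendsto (fun y => ∫⁻ x, ENNReal.ofReal (expWeight τ s x 0 ^ 2
      * (y ^ a * gy (x, y)) ^ 2)) boundaryFilter (𝓝 (L : ℝ≥0∞))) :
    Tendsto (fun y => ∫⁻ x, ENNReal.ofReal (expWeight τ s x y ^ 2 * (y ^ a * gy (x, y)) ^ 2))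
      boundaryFilter (𝓝 (L : ℝ≥0∞)) := by
  have hE0 : Continuous fun x : EuclideanSpace ℝ (Fin n) => expWeight τ s x 0 :=
    (contDiff_expWeight 0).continuous
  have h1 : Tendsto (fun y : ℝ => ENNReal.ofReal (Real.exp (τ * (2 * (-(1 / (2 - 2 * s))
      * y ^ (2 - 2 * s) + 1 / 2 * y ^ 2))) ^ 2)) (𝓝 0) (𝓝 1) := by
    have h2 : ContinuousAt (fun y : ℝ => y ^ (2 - 2 * s)) 0 :=
      Real.continuousAt_rpow_const 0 (2 - 2 * s) (Or.inr (by linarith))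
    have h3 : ContinuousAt (fun y : ℝ => Real.exp (τ * (2 * (-(1 / (2 - 2 * s))
      * y ^ (2 - 2 * s) + 1 / 2 * y ^ 2))) ^ 2) 0 := by fun_prop
    have h4 := ENNReal.tendsto_ofReal h3.tendsto
    rw [Real.zero_rpow (by linarith)] at h4
    simpa using h4
  have h2 := ENNReal.Tendsto.mul (h1.mono_left boundaryFilter_le) (Or.inl one_ne_zero) hL
    (Or.inr ENNReal.one_ne_top)
  rw [one_mul] at h2
  refine h2.congr fun y => ?_
  rw [← lintegral_const_mul]
  · refine lintegral_congr fun x => ?_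
    rw [← ENNReal.ofReal_mul (sq_nonneg _), expWeight_zero hs', expWeight_eq_mul x y]
    ring_nf
  · exact ((hE0.measurable.pow_const 2).mul (((hD.isLocalized_normal.measurable.comp
      measurable_prodMk_right).const_mul _).pow_const 2)).ennreal_ofReal

end IsWeakData

/-- The Carleman estimate for weak solutions, where `L` is the squared norm of the weighted Neumann
data. -/
theorem IsWeakData.carleman {L : ℝ≥0} (hD : IsWeakData (1 - 2 * s) w gx gy f) (hs : 1 / 2 ≤ s)
    (hs' : s < 1) (hτ : 4 ≤ τ)
    (hL : Tendsto (fun y => ∫⁻ x, ENNReal.ofReal (expWeight τ s x 0 ^ 2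
      * (y ^ (1 - 2 * s) * gy (x, y)) ^ 2)) boundaryFilter (𝓝 (L : ℝ≥0∞))) :
    ∫⁻ q : EuclideanSpace ℝ (Fin n) × ℝ, ENNReal.ofReal (q.2 ^ (1 - 2 * s)
        * expWeight τ s q.1 q.2 ^ 2 * (τ ^ 3 * w q ^ 2 + τ * (∑ i, gx i q ^ 2 + gy q ^ 2)))
        ∂slab n 0
      ≤ 3 * (∫⁻ q : EuclideanSpace ℝ (Fin n) × ℝ, ENNReal.ofReal
          (expWeight τ s q.1 q.2 ^ 2 * (f q ^ 2 / q.2 ^ (1 - 2 * s))) ∂slab n 0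
        + ENNReal.ofReal (8 * τ) * L) := by
  set M := ∫⁻ q, ENNReal.ofReal (f q ^ 2 / q.2 ^ (1 - 2 * s)) ∂slab n 0 with hM
  set W := ∫⁻ q : EuclideanSpace ℝ (Fin n) × ℝ, ENNReal.ofReal
    (expWeight τ s q.1 q.2 ^ 2 * (f q ^ 2 / q.2 ^ (1 - 2 * s))) ∂slab n 0 with hW
  have hE0 : Continuous fun x : EuclideanSpace ℝ (Fin n) => expWeight τ s x 0 :=
    (contDiff_expWeight 0).continuous
  have hE := (continuous_expWeight (n := n) (τ := τ) hs').measurable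
  have hY : Measurable fun q : EuclideanSpace ℝ (Fin n) × ℝ => q.2 ^ (1 - 2 * s) :=
    measurable_snd.pow_const (1 - 2 * s)
  have hη := fun k => isMollifier_approxId (n := n) k
  have hslab : ∀ {P : EuclideanSpace ℝ (Fin n) × ℝ → Prop}, (∀ᵐ q, P q) → ∀ᵐ q ∂slab n 0, P q :=
    fun h => by
      rw [slab_eq_restrict]
      exact ae_restrict_of_ae h
  set e : ℕ → ℝ≥0∞ := fun k => ENNReal.ofReal (Real.exp (τ * (1 / (8 * ((k : ℝ) + 1))))) with he
  have he1 : Tendsto e atTop (𝓝 1) := by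
    have h1 := (Real.continuous_exp.tendsto _).comp (tendsto_approxRadius.const_mul τ)
    have h2 := ENNReal.tendsto_ofReal h1
    rw [mul_zero, Real.exp_zero, ENNReal.ofReal_one] at h2
    exact h2
  set I : ℝ → ℝ≥0∞ := fun y => ∫⁻ x, ENNReal.ofReal (expWeight τ s x 0 ^ 2
    * (y ^ (1 - 2 * s) * gy (x, y)) ^ 2) with hI
  set κ : ℝ → ℝ≥0∞ := fun y => ∫⁻ t in Set.Ioc 0 y, ENNReal.ofReal (t ^ (1 - 2 * s)) with hκ
  -- the mollification is removed first, at a fixed height `c` at which the conormal derivative of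
  -- the mollified solution is the mollification of `c^a ∂_y w(·, c)`
  have key : ∀ c, 0 ≤ c → c ≤ 1 / 2 → (∀ᵐ x : EuclideanSpace ℝ (Fin n), ∀ k,
      c ^ (1 - 2 * s) * moll (approxId n k) (fun x => gy (x, c)) x
        = mollConormal (1 - 2 * s) w f (approxId n k) x c) →
      ∫⁻ q : EuclideanSpace ℝ (Fin n) × ℝ, ENNReal.ofReal (q.2 ^ (1 - 2 * s)
        * expWeight τ s q.1 q.2 ^ 2 * (τ ^ 3 * w q ^ 2 + τ * (∑ i, gx i q ^ 2 + gy q ^ 2)))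
        ∂slab n 0 ≤ 3 * (W + ENNReal.ofReal (8 * τ) * (I c + κ c * M)) := fun c hc hc' hgood => by
    have hp : ∀ k, ∫⁻ z, ENNReal.ofReal (expWeight τ s z 0 ^ 2
        * mollConormal (1 - 2 * s) w f (approxId n k) z c ^ 2) ≤ e k * I c := fun k => by
      have hg : Measurable fun x => c ^ (1 - 2 * s) * gy (x, c) :=
        (hD.isLocalized_normal.measurable.comp measurable_prodMk_right).const_mul _
      have hB := (hE0.measurable.pow_const 2).ennreal_ofReal
      have h := lintegral_mul_moll_approxId_sq_le hg (k := k)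
        (A := fun z => ENNReal.ofReal (expWeight τ s z 0 ^ 2))
        (B := fun x => e k * ENNReal.ofReal (expWeight τ s x 0 ^ 2))
        (hB.const_mul _) fun z x hzx hx => by
          have hx' : ‖x‖ ≤ 1 / 2 := by
            by_contra hn
            exact hx (by rw [hD.isLocalized_normal.eq_zero_of_lt (x, c) (not_le.1 hn), mul_zero])
          rw [he, ← ENNReal.ofReal_mul (Real.exp_pos _).le]
          exact ENNReal.ofReal_le_ofReal (expWeight_sq_le (by linarith) hzx hx')
      calc ∫⁻ z, ENNReal.ofReal (expWeight τ s z 0 ^ 2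
            * mollConormal (1 - 2 * s) w f (approxId n k) z c ^ 2)
          = ∫⁻ z, ENNReal.ofReal (expWeight τ s z 0 ^ 2) * ENNReal.ofReal
            (moll (approxId n k) (fun x => c ^ (1 - 2 * s) * gy (x, c)) z ^ 2) := by
            refine lintegral_congr_ae ?_
            filter_upwards [hgood] with z hz
            rw [← hz k, moll_const_mul, ENNReal.ofReal_mul (sq_nonneg _)]
        _ ≤ _ := h
        _ = e k * I c := by
            simp only [mul_assoc, hI]
            rw [lintegral_const_mul _ (hB.fun_mul (hg.pow_const 2).ennreal_ofReal)]
            congr 1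
            exact lintegral_congr fun x => (ENNReal.ofReal_mul (sq_nonneg _)).symm
    refine lintegral_le_of_ae_tendsto (F := fun k q => energy τ s
      (mollSolution (1 - 2 * s) w f (approxId n k)) (mollConormal (1 - 2 * s) w f (approxId n k))
      q.1 q.2) (C := fun k => 3 * (e k * W + ENNReal.ofReal (8 * τ) * (e k * I c + κ c * M)))
      (fun k => Measurable.aemeasurable ?_) ?_ (fun k => ?_) ?_
    · simp only [energy, hD.pd_mollSolution (hη k)]
      have h1 := (hD.continuous_mollSolution (hη k)).measurable
      have h2 := (hD.continuous_mollConormal (hη k)).measurable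
      have h3 := fun i => (hD.continuous_mollSolution ((hη k).pd i)).measurable
      exact (hY.mul (hE.pow_const 2)).mul (((h1.pow_const 2).const_mul _).add
        (((Finset.measurable_fun_sum _ fun i _ => (h3 i).pow_const 2).add
          ((h2.div hY).pow_const 2)).const_mul _))
    · filter_upwards [hslab hD.ae_tendsto_mollSolution, hslab hD.ae_tendsto_mollConormal,
        hslab (ae_all_iff.2 hD.ae_tendsto_pd_mollSolution), ae_slab_mem 0] with q h1 h2 h3 hq
      have hp : q.2 ^ (1 - 2 * s) ≠ 0 := (Real.rpow_pos_of_pos hq.1 _).ne'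
      have h4 := (h2 hq.1).div_const (q.2 ^ (1 - 2 * s))
      rw [mul_div_cancel_left₀ _ hp] at h4
      exact (((h1 hq.1).pow 2).const_mul _ |>.add ((tendsto_finsetSum _ fun i _ =>
        (h3 i hq.1).pow 2).add (h4.pow 2) |>.const_mul τ)).const_mul _
    · obtain ⟨_, h⟩ := hD.exists_isTangentiallySmooth (hη k)
      refine (h.carleman_of_height hs hs' hτ hc hc').trans ?_
      gcongr
      · exact hD.lintegral_weight_sq_moll_rhs_le hs' (by linarith) k
      · exact hp k
      · exact hD.lintegral_sq_moll_rhs_le k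
    · have h1 := ENNReal.Tendsto.mul_const (b := W) he1 (Or.inl one_ne_zero)
      have h2 := ENNReal.Tendsto.mul_const (b := I c) he1 (Or.inl one_ne_zero)
      rw [one_mul] at h1 h2
      exact ENNReal.Tendsto.const_mul (h1.add (ENNReal.Tendsto.const_mul (h2.add
        tendsto_const_nhds) (Or.inr ENNReal.ofReal_ne_top))) (Or.inr (by simp))
  -- then the height tends to zero
  have hlim : Tendsto (fun c => 3 * (W + ENNReal.ofReal (8 * τ) * (I c + κ c * M)))
      boundaryFilter (𝓝 (3 * (W + ENNReal.ofReal (8 * τ) * L))) := by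
    have h1 := hL.add hD.tendsto_lintegral_Ioc_mul
    rw [add_zero] at h1
    exact ENNReal.Tendsto.const_mul (tendsto_const_nhds.add (ENNReal.Tendsto.const_mul h1
      (Or.inr ENNReal.ofReal_ne_top))) (Or.inr (by simp))
  refine ge_of_tendsto hlim ?_
  have h2 := ae_ae_of_ae_volume hD.ae_rpow_mul_moll_eq
  filter_upwards [eventually_boundaryFilter_of_ae (h2.mono fun y hy _ => hy),
    eventually_boundaryFilter_mem_Ioc] with y hy hy'
  exact key y hy'.1.le hy'.2 (hy.mono fun x hx => hx hy'.1)

end WeakSolutions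

/-! ### Localized representatives of the data -/

section Localization

variable {n : ℕ} {b : ℝ}

lemma isOpen_upperHalfSpace : IsOpen (upperHalfSpace n) :=
  isOpen_lt continuous_const continuous_snd

instance : IsLocallyFiniteMeasure (halfSpaceMeasure n) :=
  inferInstanceAs (IsLocallyFiniteMeasure (volume.restrict _))

lemma ae_halfSpaceMeasure {P : Pt n → Prop} :
    (∀ᵐ p ∂halfSpaceMeasure n, P p) ↔ ∀ᵐ p : Pt n, 0 < p.2 → P p :=
  ae_restrict_iff' isOpen_upperHalfSpace.measurableSet

lemma ae_halfSpaceMeasure_pos : ∀ᵐ p ∂halfSpaceMeasure n, 0 < p.2 :=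
  ae_halfSpaceMeasure.2 (Eventually.of_forall fun _ h => h)

/-- A function on the half-space that vanishes off the half-ball and has a finite weighted
integral agrees almost everywhere with a localized function. The exceptional slices, on which it is
not square integrable, form a null set and are removed. -/
lemma exists_isLocalized {g : Pt n → ℝ} (hg : AEStronglyMeasurable g (halfSpaceMeasure n))
    (h0 : ∀ᵐ p ∂halfSpaceMeasure n, p ∉ halfBall n (1 / 2) → g p = 0)
    (hfin : ∫⁻ p, ENNReal.ofReal (p.2 ^ b * g p ^ 2) ∂halfSpaceMeasure n ≠ ⊤) :
    ∃ g', IsLocalized b g' ∧ g' =ᵐ[halfSpaceMeasure n] g := by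
  set D : Set (Pt n) := {p | ‖p.1‖ ≤ 1 / 2 ∧ p.2 ∈ Set.Ioc (0 : ℝ) (1 / 2)} with hDdef
  have hDm : MeasurableSet D := (measurableSet_le measurable_fst.norm measurable_const).inter
    (measurable_snd measurableSet_Ioc)
  set g₁ : Pt n → ℝ := D.indicator (hg.mk g) with hg₁
  have hm₁ : Measurable g₁ := hg.stronglyMeasurable_mk.measurable.indicator hDm
  have hz₁ : ∀ p, p ∉ D → g₁ p = 0 := fun p hp => Set.indicator_of_notMem hp _
  have he₁ : g₁ =ᵐ[halfSpaceMeasure n] g := by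
    filter_upwards [h0, hg.ae_eq_mk, ae_halfSpaceMeasure_pos] with p hp hp' hpos
    by_cases hD : p ∈ D
    · rw [hg₁, Set.indicator_of_mem hD, hp']
    · rw [hz₁ p hD]
      refine (hp fun hb => hD ⟨?_, hpos, ?_⟩).symm
      · exact (Real.le_sqrt_of_sq_le (by nlinarith [sq_nonneg p.2])).trans hb.2
      · exact (Real.le_sqrt_of_sq_le (by nlinarith [sq_nonneg ‖p.1‖])).trans hb.2
  have hfin₁ : ∫⁻ p : Pt n, ENNReal.ofReal (p.2 ^ b * g₁ p ^ 2) ≠ ⊤ := by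
    have e : ∫⁻ p : Pt n, ENNReal.ofReal (p.2 ^ b * g₁ p ^ 2)
        = ∫⁻ p, ENNReal.ofReal (p.2 ^ b * g₁ p ^ 2) ∂halfSpaceMeasure n := by
      rw [halfSpaceMeasure, setLIntegral_eq_of_support_subset]
      intro p hp
      by_contra hn
      exact hp (by simp [hz₁ p fun hD => hn hD.2.1])
    rw [e, lintegral_congr_ae (he₁.mono fun p hp => by rw [hp])]
    exact hfin
  set I : ℝ → ℝ≥0∞ := fun y => ∫⁻ x : EuclideanSpace ℝ (Fin n), ENNReal.ofReal (g₁ (x, y) ^ 2)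
    with hI
  have hmy : ∀ y, Measurable fun x => ENNReal.ofReal (g₁ (x, y) ^ 2) := fun y =>
    ((hm₁.comp measurable_prodMk_right).pow_const 2).ennreal_ofReal
  have hIm : Measurable I := Measurable.lintegral_prod_left' (hm₁.pow_const 2).ennreal_ofReal
  have hIfin : ∀ᵐ y, I y ≠ ⊤ := by
    have hm2 : Measurable fun p : Pt n => ENNReal.ofReal (p.2 ^ b * g₁ p ^ 2) :=
      ((measurable_snd.pow_const b).mul (hm₁.pow_const 2)).ennreal_ofReal
    have h1 := hfin₁
    rw [Measure.volume_eq_prod, lintegral_prod_symm _ hm2.aemeasurable] at h1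
    filter_upwards [ae_lt_top hm2.lintegral_prod_left' h1] with y hy hI'
    by_cases hy0 : 0 < y
    · have hp := Real.rpow_pos_of_pos hy0 b
      have e : ∫⁻ x : EuclideanSpace ℝ (Fin n), ENNReal.ofReal (y ^ b * g₁ (x, y) ^ 2)
          = ENNReal.ofReal (y ^ b) * I y := by
        rw [hI, ← lintegral_const_mul _ (hmy y)]
        exact lintegral_congr fun x => ENNReal.ofReal_mul hp.le
      rw [e, hI', ENNReal.mul_top (ENNReal.ofReal_pos.2 hp).ne'] at hy
      exact lt_irrefl _ hy
    · have : I y = 0 := by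
        simp only [hI]
        rw [lintegral_eq_zero_iff (hmy y)]
        exact Eventually.of_forall fun x => by simp [hz₁ (x, y) fun hD => hy0 hD.2.1]
      rw [this] at hI'
      exact ENNReal.zero_ne_top hI'
  set B : Set (Pt n) := {p | I p.2 ≠ ⊤} with hB
  have hBm : MeasurableSet B :=
    (hIm.comp measurable_snd) (measurableSet_singleton ⊤).compl
  have hle : ∀ p, B.indicator g₁ p ^ 2 ≤ g₁ p ^ 2 := fun p => by
    by_cases hp : p ∈ B
    · rw [Set.indicator_of_mem hp]
    · rw [Set.indicator_of_notMem hp, zero_pow two_ne_zero]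
      exact sq_nonneg _
  have hz : ∀ p, p ∉ D → B.indicator g₁ p = 0 := fun p hp => by
    rw [Set.indicator_apply_eq_zero]
    exact fun _ => hz₁ p hp
  refine ⟨B.indicator g₁, ⟨hm₁.indicator hBm, fun q hq => hz q fun hD => absurd hD.1 (not_le.2 hq),
    fun q hq => hz q fun hD => hq hD.2, fun y => ?_, ?_⟩, ?_⟩
  · have hmy : Measurable fun x => B.indicator g₁ (x, y) :=
      (hm₁.indicator hBm).comp measurable_prodMk_right
    rw [memLp_two_iff_integrable_sq hmy.aestronglyMeasurable,
      ← lintegral_ofReal_ne_top_iff_integrable (hmy.pow_const 2).aestronglyMeasurable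
        (Eventually.of_forall fun x => sq_nonneg _)]
    by_cases hy : I y = ⊤
    · have : ∀ x, B.indicator g₁ (x, y) = 0 := fun x =>
        Set.indicator_of_notMem (fun hn => (show I y ≠ ⊤ from hn) hy) _
      simp [this]
    · exact ne_top_of_le_ne_top hy (lintegral_mono fun x => ENNReal.ofReal_le_ofReal (hle _))
  · refine ne_top_of_le_ne_top hfin₁ (lintegral_mono fun p => ?_)
    by_cases hp : p ∈ D
    · have := Real.rpow_pos_of_pos hp.2.1 b
      exact ENNReal.ofReal_le_ofReal (mul_le_mul_of_nonneg_left (hle p) this.le)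
    · simp [hz p hp]
  · have hBae : ∀ᵐ p : Pt n, p ∈ B := by
      rw [Measure.volume_eq_prod]
      exact Measure.quasiMeasurePreserving_snd.ae hIfin
    filter_upwards [he₁, ae_restrict_of_ae hBae] with p hp hp'
    rw [Set.indicator_of_mem hp', hp]

end Localization

/-! ### Test functions -/

section TestFunctions

variable {n : ℕ} {F : Type*} [NormedAddCommGroup F] [NormedSpace ℝ F] {g : Pt n → F}
  {ρ : Pt n → ℝ} {ψ : Pt n → ℝ} {θ : EuclideanSpace ℝ (Fin n) → ℝ} {χ : ℝ → ℝ}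

lemma integrable_smul_of_tsupport_subset (hg : LocallyIntegrableOn g (upperHalfSpace n))
    (hρ : Continuous ρ) (hc : HasCompactSupport ρ) (hs : tsupport ρ ⊆ upperHalfSpace n) :
    Integrable (fun p => ρ p • g p) (halfSpaceMeasure n) := by
  have h1 : IntegrableOn (fun p => ρ p • g p) (tsupport ρ) :=
    (hg.integrableOn_compact_subset hs hc).continuousOn_smul hρ.continuousOn hc
  refine Integrable.restrict ((integrableOn_iff_integrable_of_support_subset fun p hp => ?_).1 h1)
  exact subset_tsupport ρ fun h => hp (by simp [h])

lemma locallyIntegrableOn_rpow_smul (hg : LocallyIntegrableOn g (upperHalfSpace n)) (a : ℝ) :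
    LocallyIntegrableOn (fun p => p.2 ^ a • g p) (upperHalfSpace n) :=
  hg.continuousOn_smul isOpen_upperHalfSpace.isLocallyClosed fun p hp =>
    ((Real.continuousAt_rpow_const p.2 a (Or.inl (ne_of_gt hp))).comp
      continuous_snd.continuousAt).continuousWithinAt

/-- Square integrability with a power weight implies local integrability in the open
half-space. -/
lemma locallyIntegrableOn_of_memLp {a : ℝ}
    (hg : MemLp (fun p => p.2 ^ a • g p) 2 (halfSpaceMeasure n)) :
    LocallyIntegrableOn g (upperHalfSpace n) := by
  have h1 : LocallyIntegrableOn (fun p => p.2 ^ a • g p) (upperHalfSpace n) := by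
    refine (locallyIntegrableOn_iff isOpen_upperHalfSpace.isLocallyClosed).2 fun K hK hKc => ?_
    have h2 := (hg.locallyIntegrable one_le_two).integrableOn_isCompact hKc
    rwa [IntegrableOn, halfSpaceMeasure, Measure.restrict_restrict hKc.measurableSet,
      Set.inter_eq_left.2 hK] at h2
  refine (locallyIntegrableOn_rpow_smul h1 (-a)).congr ?_
  filter_upwards [ae_restrict_mem isOpen_upperHalfSpace.measurableSet] with p hp
  rw [smul_smul, ← Real.rpow_add hp, neg_add_cancel, Real.rpow_zero, one_smul]

namespace IsTestFunction

lemma fderiv_apply (hψ : IsTestFunction ψ) (v : Pt n) :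
    Continuous (fun p => fderiv ℝ ψ p v) ∧ HasCompactSupport (fun p => fderiv ℝ ψ p v)
      ∧ tsupport (fun p => fderiv ℝ ψ p v) ⊆ tsupport ψ :=
  ⟨(hψ.smooth.continuous_fderiv (by simp)).clm_apply continuous_const,
    hψ.compact.fderiv_apply ℝ v, tsupport_fderiv_apply_subset ℝ v⟩

lemma integrable_smul (hψ : IsTestFunction ψ) (hg : LocallyIntegrableOn g (upperHalfSpace n)) :
    Integrable (fun p => ψ p • g p) (halfSpaceMeasure n) :=
  integrable_smul_of_tsupport_subset hg hψ.smooth.continuous hψ.compact hψ.support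

lemma integrable_fderiv_smul (hψ : IsTestFunction ψ)
    (hg : LocallyIntegrableOn g (upperHalfSpace n)) (v : Pt n) :
    Integrable (fun p => fderiv ℝ ψ p v • g p) (halfSpaceMeasure n) :=
  integrable_smul_of_tsupport_subset hg (hψ.fderiv_apply v).1 (hψ.fderiv_apply v).2.1
    ((hψ.fderiv_apply v).2.2.trans hψ.support)

lemma mul (hθ : ContDiff ℝ ∞ θ) (hθc : HasCompactSupport θ) (hχ : IsNormalTest χ) :
    IsTestFunction fun p : Pt n => θ p.1 * χ p.2 := by
  have hs : Function.support (fun p : Pt n => θ p.1 * χ p.2) ⊆ tsupport θ ×ˢ tsupport χ :=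
    fun p hp => ⟨subset_tsupport θ (left_ne_zero_of_mul hp),
      subset_tsupport χ (right_ne_zero_of_mul hp)⟩
  have ht : tsupport (fun p : Pt n => θ p.1 * χ p.2) ⊆ tsupport θ ×ˢ tsupport χ :=
    closure_minimal hs ((isClosed_tsupport θ).prod (isClosed_tsupport χ))
  exact ⟨(hθ.comp contDiff_fst).mul (hχ.contDiff.comp contDiff_snd),
    (hθc.isCompact.prod hχ.hasCompactSupport.isCompact).of_isClosed_subset
      (isClosed_tsupport _) ht, ht.trans fun p hp => hχ.tsupport_subset hp.2⟩

end IsTestFunction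

lemma hasFDerivAt_mul_test (hθ : ContDiff ℝ ∞ θ) (hχ : IsNormalTest χ) (p : Pt n) :
    HasFDerivAt (fun p : Pt n => θ p.1 * χ p.2)
      (θ p.1 • (fderiv ℝ χ p.2).comp (ContinuousLinearMap.snd ℝ _ _)
        + χ p.2 • (fderiv ℝ θ p.1).comp (ContinuousLinearMap.fst ℝ _ _)) p := by
  have h1 : HasFDerivAt (fun p : Pt n => θ p.1)
      ((fderiv ℝ θ p.1).comp (ContinuousLinearMap.fst ℝ _ _)) p :=
    ((hθ.differentiable (by simp)).differentiableAt.hasFDerivAt (x := p.1)).comp p hasFDerivAt_fst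
  have h2 : HasFDerivAt (fun p : Pt n => χ p.2)
      ((fderiv ℝ χ p.2).comp (ContinuousLinearMap.snd ℝ _ _)) p :=
    ((hχ.contDiff.differentiable (by simp)).differentiableAt.hasFDerivAt (x := p.2)).comp p
      hasFDerivAt_snd
  exact h1.fun_mul h2

lemma tangentialDeriv_mul (hθ : ContDiff ℝ ∞ θ) (hχ : IsNormalTest χ) (i : Fin n) (p : Pt n) :
    tangentialDeriv (fun p : Pt n => θ p.1 * χ p.2) i p = pd i θ p.1 * χ p.2 := by
  rw [tangentialDeriv, (hasFDerivAt_mul_test hθ hχ p).fderiv]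
  simp [pd, mul_comm]

lemma normalDeriv_mul (hθ : ContDiff ℝ ∞ θ) (hχ : IsNormalTest χ) (p : Pt n) :
    normalDeriv (fun p : Pt n => θ p.1 * χ p.2) p = θ p.1 * deriv χ p.2 := by
  rw [normalDeriv, (hasFDerivAt_mul_test hθ hχ p).fderiv]
  simp

end TestFunctions

/-! ### Real components of weak solutions -/

section Components

variable {𝕜 : Type*} [RCLike 𝕜] {n : ℕ} {s b : ℝ} {w gy f g : Pt n → 𝕜}
  {gx : Pt n → EuclideanSpace 𝕜 (Fin n)}

lemma IsWeakGradient.locallyIntegrable_component (h : IsWeakGradient w gx gy) (i : Fin n) :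
    LocallyIntegrableOn (fun p => gx p i) (upperHalfSpace n) :=
  (EuclideanSpace.proj (𝕜 := 𝕜) i).locallyIntegrableOn_comp h.locallyIntegrable_tangential

lemma integral_fderiv_smul_eq_zero
    (hw : ∀ᵐ p ∂halfSpaceMeasure n, p ∉ halfBall n (1 / 2) → w p = 0) {ψ : Pt n → ℝ}
    (hψ : IsTestFunction ψ) (hs : tsupport ψ ⊆ (halfBall n (1 / 2))ᶜ) (v : Pt n) :
    ∫ p, fderiv ℝ ψ p v • w p ∂halfSpaceMeasure n = 0 := by
  refine integral_eq_zero_of_ae ?_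
  filter_upwards [hw] with p hp
  by_cases h : p ∈ tsupport ψ
  · simp [hp (hs h)]
  · have : fderiv ℝ ψ p v = 0 := by
      by_contra hn
      exact h ((hψ.fderiv_apply v).2.2 (subset_tsupport _ hn))
    simp [this]

/-- A locally integrable function vanishes almost everywhere off the half-ball if it annihilates
the test functions supported there. -/
lemma ae_eq_zero_of_notMem_halfBall (hg : LocallyIntegrableOn g (upperHalfSpace n))
    (h : ∀ ψ : Pt n → ℝ, IsTestFunction ψ → tsupport ψ ⊆ (halfBall n (1 / 2))ᶜ →
      ∫ p, ψ p • g p ∂halfSpaceMeasure n = 0) :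
    ∀ᵐ p ∂halfSpaceMeasure n, p ∉ halfBall n (1 / 2) → g p = 0 := by
  have hcl : IsClosed (halfBall n (1 / 2)) :=
    (isClosed_le continuous_const continuous_snd).inter
      (isClosed_le ((continuous_fst.norm.pow 2).add (continuous_snd.pow 2)).sqrt continuous_const)
  have ho : IsOpen (upperHalfSpace n ∩ (halfBall n (1 / 2))ᶜ) :=
    isOpen_upperHalfSpace.inter hcl.isOpen_compl
  have h1 := ho.ae_eq_zero_of_integral_contDiff_smul_eq_zero (μ := volume)
    (hg.mono_set Set.inter_subset_left) fun ψ hψ hψc hψs => by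
      have ht : IsTestFunction ψ := ⟨hψ, hψc, hψs.trans Set.inter_subset_left⟩
      rw [← h ψ ht (hψs.trans Set.inter_subset_right), halfSpaceMeasure]
      refine (setIntegral_eq_integral_of_forall_compl_eq_zero fun p hp => ?_).symm
      have : ψ p = 0 := by
        by_contra hn
        exact hp (ht.support (subset_tsupport ψ hn))
      rw [this, zero_smul]
  rw [ae_halfSpaceMeasure]
  filter_upwards [h1] with p hp h0 hn
  exact hp ⟨h0, hn⟩

variable (hH : MemWeightedH1 s w gx gy)
  (hw : ∀ᵐ p ∂halfSpaceMeasure n, p ∉ halfBall n (1 / 2) → w p = 0)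
  (hsol : IsWeakSolution s gx gy f)
  (hf : MemLp (fun p => p.2 ^ ((2 * s - 1) / 2) • f p) 2 (halfSpaceMeasure n))

include hH hw in
lemma ae_tangential_eq_zero (i : Fin n) :
    ∀ᵐ p ∂halfSpaceMeasure n, p ∉ halfBall n (1 / 2) → gx p i = 0 :=
  ae_eq_zero_of_notMem_halfBall (hH.weakGradient.locallyIntegrable_component i) fun ψ hψ hs => by
    rw [← neg_eq_zero, ← hH.weakGradient.tangential ψ hψ i]
    exact integral_fderiv_smul_eq_zero hw hψ hs _

include hH hw in
lemma ae_normal_eq_zero : ∀ᵐ p ∂halfSpaceMeasure n, p ∉ halfBall n (1 / 2) → gy p = 0 :=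
  ae_eq_zero_of_notMem_halfBall hH.weakGradient.locallyIntegrable_normal fun ψ hψ hs => by
    rw [← neg_eq_zero, ← hH.weakGradient.normal ψ hψ]
    exact integral_fderiv_smul_eq_zero hw hψ hs _

include hH hw hsol hf in
lemma ae_rhs_eq_zero : ∀ᵐ p ∂halfSpaceMeasure n, p ∉ halfBall n (1 / 2) → f p = 0 :=
  ae_eq_zero_of_notMem_halfBall (locallyIntegrableOn_of_memLp hf) fun ψ hψ hs => by
    rw [← neg_eq_zero, ← hsol ψ hψ]
    refine integral_eq_zero_of_ae ?_
    filter_upwards [ae_all_iff.2 (ae_tangential_eq_zero hH hw), ae_normal_eq_zero hH hw]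
      with p hp hp'
    by_cases h : p ∈ tsupport ψ
    · simp [hp _ (hs h), hp' (hs h)]
    · have : ∀ v, fderiv ℝ ψ p v = 0 := fun v => by
        by_contra hn
        exact h ((hψ.fderiv_apply v).2.2 (subset_tsupport _ hn))
      simp [tangentialDeriv, normalDeriv, this]

/-- The localized representative of a real component `ℓ ∘ g`. -/
lemma exists_isLocalized_component (ℓ : 𝕜 →L[ℝ] ℝ) (hℓ : ∀ z, |ℓ z| ≤ ‖z‖)
    (hg : LocallyIntegrableOn g (upperHalfSpace n))
    (h0 : ∀ᵐ p ∂halfSpaceMeasure n, p ∉ halfBall n (1 / 2) → g p = 0)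
    (hfin : MemLp (fun p => p.2 ^ (b / 2) • g p) 2 (halfSpaceMeasure n)) :
    ∃ g', IsLocalized b g' ∧ g' =ᵐ[halfSpaceMeasure n] fun p => ℓ (g p) := by
  refine exists_isLocalized (ℓ.continuous.comp_aestronglyMeasurable hg.aestronglyMeasurable) ?_ ?_
  · filter_upwards [h0] with p hp hn
    rw [hp hn, map_zero]
  · have h1 := eLpNorm_two_sq (μ := halfSpaceMeasure n) (fun p : Pt n => p.2 ^ (b / 2) • g p)
    refine ne_top_of_le_ne_top (ENNReal.pow_ne_top (n := 2) hfin.2.ne) ?_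
    rw [h1]
    refine lintegral_mono_ae ?_
    filter_upwards [ae_halfSpaceMeasure_pos] with p hp
    have e : p.2 ^ b = (p.2 ^ (b / 2)) ^ 2 := by
      rw [← Real.rpow_natCast, ← Real.rpow_mul hp.le]
      norm_num
    rw [norm_smul, mul_pow, Real.norm_eq_abs, sq_abs, e]
    refine ENNReal.ofReal_le_ofReal (mul_le_mul_of_nonneg_left ?_ (sq_nonneg _))
    rw [← sq_abs]
    exact pow_le_pow_left₀ (abs_nonneg _) (hℓ _) 2

lemma integral_mul_component {ℓ : 𝕜 →L[ℝ] ℝ} {g' ρ : Pt n → ℝ} (hg : ∀ p, p.2 ≤ 0 → g' p = 0)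
    (he : g' =ᵐ[halfSpaceMeasure n] fun p => ℓ (g p))
    (hi : Integrable (fun p => ρ p • g p) (halfSpaceMeasure n)) :
    ∫ p, ρ p * g' p = ℓ (∫ p, ρ p • g p ∂halfSpaceMeasure n) := by
  rw [← ℓ.integral_comp_comm hi]
  have e : ∫ p, ρ p * g' p = ∫ p, ρ p * g' p ∂halfSpaceMeasure n :=
    (setIntegral_eq_integral_of_forall_compl_eq_zero fun p hp => by
      rw [hg p (not_lt.1 hp), mul_zero]).symm
  rw [e]
  refine integral_congr_ae ?_
  filter_upwards [he] with p hp
  rw [hp, map_smul, smul_eq_mul]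

include hH hw hsol hf in
/-- Real components of a weak solution are weak solutions. -/
theorem exists_isWeakData (hs : 1 / 2 ≤ s) (hs' : s < 1) (htr : HasZeroTrace w)
    (ℓ : 𝕜 →L[ℝ] ℝ) (hℓ : ∀ z, |ℓ z| ≤ ‖z‖) :
    ∃ w' gx' gy' f', IsWeakData (1 - 2 * s) w' gx' gy' f'
      ∧ (w' =ᵐ[halfSpaceMeasure n] fun p => ℓ (w p))
      ∧ (∀ i, gx' i =ᵐ[halfSpaceMeasure n] fun p => ℓ (gx p i))
      ∧ (gy' =ᵐ[halfSpaceMeasure n] fun p => ℓ (gy p))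
      ∧ (f' =ᵐ[halfSpaceMeasure n] fun p => ℓ (f p)) := by
  have hG := hH.weakGradient
  have hgxl := hG.locallyIntegrable_component
  have hgx : ∀ i, MemLp (fun p => p.2 ^ ((1 - 2 * s) / 2) • gx p i) 2 (halfSpaceMeasure n) :=
    fun i => (EuclideanSpace.proj (𝕜 := 𝕜) i).comp_memLp' hH.memLp_tangential
  obtain ⟨w', hw1, hw2⟩ :=
    exists_isLocalized_component ℓ hℓ hG.locallyIntegrable hw hH.memLp
  choose gx' hgx1 hgx2 using fun i => exists_isLocalized_component ℓ hℓ (hgxl i)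
    (ae_tangential_eq_zero hH hw i) (hgx i)
  obtain ⟨gy', hgy1, hgy2⟩ := exists_isLocalized_component ℓ hℓ hG.locallyIntegrable_normal
    (ae_normal_eq_zero hH hw) hH.memLp_normal
  obtain ⟨f', hf1, hf2⟩ := exists_isLocalized_component (b := -(1 - 2 * s)) ℓ hℓ
    (locallyIntegrableOn_of_memLp hf) (ae_rhs_eq_zero hH hw hsol hf) (by rwa [neg_sub])
  have hz : ∀ {b} {g' : Pt n → ℝ}, IsLocalized b g' → ∀ p, p.2 ≤ 0 → g' p = 0 :=
    fun h p hp => h.eq_zero p fun h' => absurd h'.1 (not_lt.2 hp)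
  refine ⟨w', gx', gy', f', ⟨by linarith, by linarith, hw1, hgx1, hgy1, hf1, ?_, ?_, ?_, ?_⟩,
    hw2, hgx2, hgy2, hf2⟩
  · intro θ χ hθ hθc hχ i
    have ht := IsTestFunction.mul hθ hθc hχ
    have h := hG.tangential _ ht i
    have hi := ht.integrable_fderiv_smul hG.locallyIntegrable (EuclideanSpace.single i 1, 0)
    have hi' := ht.integrable_smul (hgxl i)
    change Integrable (fun p => tangentialDeriv _ i p • w p) _ at hi
    simp only [tangentialDeriv_mul hθ hχ] at h hi
    rw [integral_mul_component (hz hw1) hw2 hi, integral_mul_component (hz (hgx1 i)) (hgx2 i) hi',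
      h, map_neg]
  · intro θ χ hθ hθc hχ
    have ht := IsTestFunction.mul hθ hθc hχ
    have h := hG.normal _ ht
    have hi := ht.integrable_fderiv_smul hG.locallyIntegrable (0, 1)
    have hi' := ht.integrable_smul hG.locallyIntegrable_normal
    change Integrable (fun p => normalDeriv _ p • w p) _ at hi
    simp only [normalDeriv_mul hθ hχ] at h hi
    rw [integral_mul_component (hz hw1) hw2 hi, integral_mul_component (hz hgy1) hgy2 hi',
      h, map_neg]
  · intro θ χ hθ hθc hχ
    have ht := IsTestFunction.mul hθ hθc hχ
    have h := hsol _ ht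
    have hi : Integrable (fun p : Pt n => p.2 ^ (1 - 2 * s) •
        ((∑ i, tangentialDeriv (fun p : Pt n => θ p.1 * χ p.2) i p • gx p i)
          + normalDeriv (fun p : Pt n => θ p.1 * χ p.2) p • gy p)) (halfSpaceMeasure n) := by
      simp only [smul_add, Finset.smul_sum]
      refine (integrable_finsetSum _ fun i _ => ?_).add ?_
      · refine (ht.integrable_fderiv_smul (locallyIntegrableOn_rpow_smul (hgxl i) (1 - 2 * s))
          (EuclideanSpace.single i 1, 0)).congr (Eventually.of_forall fun p => smul_comm _ _ _)
      · refine (ht.integrable_fderiv_smul (locallyIntegrableOn_rpow_smul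
          hG.locallyIntegrable_normal (1 - 2 * s))
          (0, 1)).congr (Eventually.of_forall fun p => smul_comm _ _ _)
    have hi' := ht.integrable_smul (locallyIntegrableOn_of_memLp hf)
    simp only [tangentialDeriv_mul hθ hχ, normalDeriv_mul hθ hχ] at h hi
    rw [integral_mul_component (hz hf1) hf2 hi', ← map_neg, ← h]
    refine integral_mul_component (fun p hp => ?_) ?_ hi
    · simp [hz hgy1 p hp, fun i => hz (hgx1 i) p hp]
    · filter_upwards [ae_all_iff.2 hgx2, hgy2] with p h1 h2
      simp [h1, h2]
  · have h1 := ENNReal.Tendsto.pow (n := 2) htr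
    rw [zero_pow two_ne_zero] at h1
    refine tendsto_of_tendsto_of_tendsto_of_le_of_le' tendsto_const_nhds h1
      (Eventually.of_forall fun _ => zero_le) ?_
    have h2 := ae_ae_of_ae_volume (ae_halfSpaceMeasure.1 hw2)
    filter_upwards [eventually_boundaryFilter_of_ae (h2.mono fun y hy _ => hy),
      eventually_boundaryFilter_mem_Ioc] with y hy hy'
    rw [sliceNorm, eLpNorm_two_sq]
    refine lintegral_mono_ae ?_
    filter_upwards [hy] with x hx
    rw [hx hy'.1, ← sq_abs]
    exact ENNReal.ofReal_le_ofReal (pow_le_pow_left₀ (abs_nonneg _) (hℓ _) 2)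

end Components

/-! ### The estimate for real and complex data -/

section Assembly

variable {𝕜 : Type*} [RCLike 𝕜] {n : ℕ} {s τ : ℝ} {w gy f : Pt n → 𝕜}
  {gx : Pt n → EuclideanSpace 𝕜 (Fin n)} {w₁ gy₁ f₁ w₂ gy₂ f₂ : Pt n → ℝ}
  {gx₁ gx₂ : Fin n → Pt n → ℝ}

lemma lintegral_halfSpace_eq_slab {g : Pt n → ℝ≥0∞} (h : ∀ p, 1 / 2 < p.2 → g p = 0) :
    ∫⁻ p, g p ∂halfSpaceMeasure n = ∫⁻ p, g p ∂slab n 0 := by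
  have hs : (Set.univ ×ˢ Set.Ioc (0 : ℝ) (1 / 2) : Set (Pt n)) ⊆ upperHalfSpace n :=
    fun p hp => hp.2.1
  have hm : MeasurableSet (Set.univ ×ˢ Set.Ioc (0 : ℝ) (1 / 2) : Set (Pt n)) :=
    MeasurableSet.univ.prod measurableSet_Ioc
  rw [slab_eq_restrict, halfSpaceMeasure, ← lintegral_indicator isOpen_upperHalfSpace.measurableSet,
    ← lintegral_indicator hm]
  refine lintegral_congr fun p => ?_
  by_cases hp : p ∈ (Set.univ ×ˢ Set.Ioc (0 : ℝ) (1 / 2) : Set (Pt n))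
  · rw [Set.indicator_of_mem hp, Set.indicator_of_mem (hs hp)]
  · rw [Set.indicator_of_notMem hp]
    by_cases hp' : p ∈ upperHalfSpace n
    · rw [Set.indicator_of_mem hp', h p]
      by_contra hn
      exact hp ⟨trivial, hp', not_lt.1 hn⟩
    · rw [Set.indicator_of_notMem hp']

lemma norm_sq_eq_re_add_im (z : 𝕜) :
    ‖z‖ ^ 2 = RCLike.reCLM z ^ 2 + RCLike.imCLM z ^ 2 := by
  rw [RCLike.norm_sq_eq_def, RCLike.reCLM_apply, RCLike.imCLM_apply]
  ring

lemma rpow_half_sq {y : ℝ} (hy : 0 < y) (a : ℝ) : (y ^ (a / 2)) ^ 2 = y ^ a := by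
  rw [← Real.rpow_natCast, ← Real.rpow_mul hy.le]
  norm_num

lemma ofReal_rpow_sq (hτ : 0 < τ) (m : ℕ) :
    ENNReal.ofReal (τ ^ ((m : ℝ) / 2)) ^ 2 = ENNReal.ofReal (τ ^ m) := by
  rw [← ENNReal.ofReal_pow (by positivity), rpow_half_sq hτ, Real.rpow_natCast]

lemma expWeight_le_exp (hs' : s < 1) (hτ : 0 ≤ τ) (x : EuclideanSpace ℝ (Fin n)) {y : ℝ}
    (hy : y ∈ Set.Ioc (0 : ℝ) (1 / 2)) : expWeight τ s x y ≤ Real.exp τ := by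
  rw [expWeight, Real.exp_le_exp]
  refine mul_le_of_le_one_right hτ ?_
  have h1 : 0 ≤ 1 / (2 - 2 * s) * y ^ (2 - 2 * s) :=
    mul_nonneg (one_div_nonneg.2 (by linarith)) (Real.rpow_nonneg hy.1.le _)
  have h2 : y ^ 2 ≤ 1 := pow_le_one₀ hy.1.le (hy.2.trans (by norm_num))
  simp only [weight]
  nlinarith [sq_nonneg ‖x‖]

lemma norm_radialDeriv_sq_le (p : Pt n) (hp : ‖p.1‖ ≤ 1 / 2 ∨ ∀ i, gx p i = 0) :
    ‖radialDeriv gx p‖ ^ 2 ≤ ∑ i, ‖gx p i‖ ^ 2 := by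
  rcases hp with hp | hp
  · have h1 : ‖radialDeriv gx p‖ ≤ ∑ i, |p.1 i| * ‖gx p i‖ :=
      (norm_sum_le _ _).trans (Finset.sum_le_sum fun i _ => by rw [norm_smul, Real.norm_eq_abs])
    have h2 : ∑ i, |p.1 i| ^ 2 ≤ 1 := by
      have h3 := EuclideanSpace.norm_sq_eq p.1
      simp only [Real.norm_eq_abs] at h3
      rw [← h3]
      exact pow_le_one₀ (norm_nonneg _) (hp.trans (by norm_num))
    calc ‖radialDeriv gx p‖ ^ 2 ≤ (∑ i, |p.1 i| * ‖gx p i‖) ^ 2 :=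
          pow_le_pow_left₀ (norm_nonneg _) h1 2
      _ ≤ (∑ i, |p.1 i| ^ 2) * ∑ i, ‖gx p i‖ ^ 2 := Finset.sum_mul_sq_le_sq_mul_sq _ _ _
      _ ≤ ∑ i, ‖gx p i‖ ^ 2 :=
          mul_le_of_le_one_left (Finset.sum_nonneg fun i _ => sq_nonneg _) h2
  · simp [radialDeriv, hp]

/-- Squares of slice norms along the boundary filter determine the limits of the slice norms. -/
lemma tendsto_of_tendsto_sq {g : ℝ → ℝ≥0∞} {L : ℝ≥0}
    (h : Tendsto (fun y => g y ^ 2) boundaryFilter (𝓝 (L : ℝ≥0∞))) :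
    Tendsto g boundaryFilter (𝓝 ((NNReal.sqrt L : ℝ≥0) : ℝ≥0∞)) := by
  have h1 := (ENNReal.continuous_rpow_const (y := 1 / 2)).tendsto (L : ℝ≥0∞) |>.comp h
  rw [← ENNReal.coe_rpow_of_nonneg _ (by norm_num), ← NNReal.sqrt_eq_rpow] at h1
  refine h1.congr fun y => ?_
  rw [Function.comp_apply, ← ENNReal.rpow_natCast, ← ENNReal.rpow_mul]
  norm_num

/-- The limit of the weighted conormal derivative, from those of its real and imaginary part. -/
lemma tendsto_sliceNorm_conormal {L₁ L₂ : ℝ≥0}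
    (hm : ∀ y, Measurable fun x : EuclideanSpace ℝ (Fin n) => gy₁ (x, y))
    (h₁ : gy₁ =ᵐ[halfSpaceMeasure n] fun p => RCLike.reCLM (gy p))
    (h₂ : gy₂ =ᵐ[halfSpaceMeasure n] fun p => RCLike.imCLM (gy p))
    (hL₁ : Tendsto (fun y => ∫⁻ x, ENNReal.ofReal (expWeight τ s x y ^ 2
      * (y ^ (1 - 2 * s) * gy₁ (x, y)) ^ 2)) boundaryFilter (𝓝 (L₁ : ℝ≥0∞)))
    (hL₂ : Tendsto (fun y => ∫⁻ x, ENNReal.ofReal (expWeight τ s x y ^ 2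
      * (y ^ (1 - 2 * s) * gy₂ (x, y)) ^ 2)) boundaryFilter (𝓝 (L₂ : ℝ≥0∞))) :
    Tendsto (sliceNorm fun p => (Real.exp (τ * weight s p) * p.2 ^ (1 - 2 * s)) • gy p)
      boundaryFilter (𝓝 ((NNReal.sqrt (L₁ + L₂) : ℝ≥0) : ℝ≥0∞)) := by
  refine tendsto_of_tendsto_sq ?_
  rw [ENNReal.coe_add]
  refine (hL₁.add hL₂).congr' ?_
  have h3 := ae_ae_of_ae_volume (ae_halfSpaceMeasure.1 (h₁.and h₂))
  filter_upwards [eventually_boundaryFilter_of_ae (h3.mono fun y hy _ => hy),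
    eventually_boundaryFilter_mem_Ioc] with y hy hy'
  have hE : Measurable fun x : EuclideanSpace ℝ (Fin n) => expWeight τ s x y :=
    (contDiff_expWeight y).continuous.measurable
  rw [sliceNorm, eLpNorm_two_sq, ← lintegral_add_left]
  · refine lintegral_congr_ae ?_
    filter_upwards [hy] with x hx
    obtain ⟨hx1, hx2⟩ := hx hy'.1
    rw [← ENNReal.ofReal_add (by positivity) (by positivity), norm_smul, mul_pow ‖_‖,
      norm_sq_eq_re_add_im (gy _), ← hx1, ← hx2, Real.norm_eq_abs, sq_abs, expWeight]
    ring_nf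
  · exact ((hE.pow_const 2).mul (((hm y).const_mul _).pow_const 2)).ennreal_ofReal

/-- The radial derivative tends to zero at the boundary, because the tangential gradient does. -/
lemma tendsto_sliceNorm_radialDeriv (hs' : s < 1) (hτ : 0 ≤ τ)
    (hl₁ : ∀ i, IsLocalized (1 - 2 * s) (gx₁ i)) (hl₂ : ∀ i, IsLocalized (1 - 2 * s) (gx₂ i))
    (h₁ : ∀ i, gx₁ i =ᵐ[halfSpaceMeasure n] fun p => RCLike.reCLM (gx p i))
    (h₂ : ∀ i, gx₂ i =ᵐ[halfSpaceMeasure n] fun p => RCLike.imCLM (gx p i))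
    (hL₁ : ∀ i, Tendsto (fun y => ∫⁻ x, ENNReal.ofReal (gx₁ i (x, y) ^ 2)) boundaryFilter (𝓝 0))
    (hL₂ : ∀ i, Tendsto (fun y => ∫⁻ x, ENNReal.ofReal (gx₂ i (x, y) ^ 2)) boundaryFilter (𝓝 0)) :
    Tendsto (sliceNorm fun p => Real.exp (τ * weight s p) • radialDeriv gx p)
      boundaryFilter (𝓝 ((0 : ℝ≥0) : ℝ≥0∞)) := by
  have h0 : Tendsto (fun y => ENNReal.ofReal (Real.exp τ ^ 2)
      * ∑ i, ((∫⁻ x, ENNReal.ofReal (gx₁ i (x, y) ^ 2))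
        + ∫⁻ x, ENNReal.ofReal (gx₂ i (x, y) ^ 2))) boundaryFilter (𝓝 0) := by
    have := ENNReal.Tendsto.const_mul (a := ENNReal.ofReal (Real.exp τ ^ 2))
      (tendsto_finsetSum Finset.univ fun i _ => (hL₁ i).add (hL₂ i))
      (Or.inr ENNReal.ofReal_ne_top)
    simpa using this
  have hm : ∀ i y, Measurable fun x : EuclideanSpace ℝ (Fin n) =>
      ENNReal.ofReal (gx₁ i (x, y) ^ 2) := fun i y =>
    (((hl₁ i).measurable.comp measurable_prodMk_right).pow_const 2).ennreal_ofReal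
  have hm' : ∀ i y, Measurable fun x : EuclideanSpace ℝ (Fin n) =>
      ENNReal.ofReal (gx₂ i (x, y) ^ 2) := fun i y =>
    (((hl₂ i).measurable.comp measurable_prodMk_right).pow_const 2).ennreal_ofReal
  rw [← NNReal.sqrt_zero]
  refine tendsto_of_tendsto_sq ?_
  rw [ENNReal.coe_zero]
  refine tendsto_of_tendsto_of_tendsto_of_le_of_le' tendsto_const_nhds h0
    (Eventually.of_forall fun _ => zero_le) ?_
  have h3 := ae_ae_of_ae_volume (ae_halfSpaceMeasure.1
    ((ae_all_iff.2 h₁).and (ae_all_iff.2 h₂)))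
  filter_upwards [eventually_boundaryFilter_of_ae (h3.mono fun y hy _ => hy),
    eventually_boundaryFilter_mem_Ioc] with y hy hy'
  have hadd : ∀ i, (∫⁻ x, ENNReal.ofReal (gx₁ i (x, y) ^ 2))
      + ∫⁻ x, ENNReal.ofReal (gx₂ i (x, y) ^ 2)
      = ∫⁻ x, (ENNReal.ofReal (gx₁ i (x, y) ^ 2) + ENNReal.ofReal (gx₂ i (x, y) ^ 2)) := fun i =>
    (lintegral_add_left (hm i y) _).symm
  simp only [hadd]
  rw [sliceNorm, eLpNorm_two_sq, ← lintegral_finsetSum _ fun i _ => (hm i y).fun_add (hm' i y),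
    ← lintegral_const_mul _ (Finset.measurable_fun_sum _ fun i _ => (hm i y).fun_add (hm' i y))]
  refine lintegral_mono_ae ?_
  filter_upwards [hy] with x hx
  obtain ⟨hx1, hx2⟩ := hx hy'.1
  have hn : ∀ i, ‖gx (x, y) i‖ ^ 2 = gx₁ i (x, y) ^ 2 + gx₂ i (x, y) ^ 2 := fun i => by
    rw [norm_sq_eq_re_add_im, hx1, hx2]
  have hle := norm_radialDeriv_sq_le (gx := gx) (x, y) (by
    by_cases hx : ‖x‖ ≤ 1 / 2
    · exact Or.inl hx
    · refine Or.inr fun i => ?_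
      have h := hn i
      rw [(hl₁ i).eq_zero_of_lt (x, y) (not_le.1 hx), (hl₂ i).eq_zero_of_lt (x, y) (not_le.1 hx)]
        at h
      simpa using h)
  simp only [← ENNReal.ofReal_add (sq_nonneg _) (sq_nonneg _)]
  rw [← ENNReal.ofReal_sum_of_nonneg fun i _ => by positivity,
    ← ENNReal.ofReal_mul (sq_nonneg _), norm_smul, mul_pow]
  simp only [← hn]
  refine ENNReal.ofReal_le_ofReal (mul_le_mul ?_ hle (sq_nonneg _) (sq_nonneg _))
  rw [Real.norm_eq_abs, abs_of_pos (Real.exp_pos _)]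
  exact pow_le_pow_left₀ (Real.exp_pos _).le (expWeight_le_exp hs' hτ x hy') 2

/-- The squared norm of the right-hand side splits over the real and imaginary part. -/
lemma bulkNorm_rhs_sq (hs' : s < 1) (hl₁ : IsLocalized (-(1 - 2 * s)) f₁)
    (hl₂ : IsLocalized (-(1 - 2 * s)) f₂)
    (h₁ : f₁ =ᵐ[halfSpaceMeasure n] fun p => RCLike.reCLM (f p))
    (h₂ : f₂ =ᵐ[halfSpaceMeasure n] fun p => RCLike.imCLM (f p)) :
    (∫⁻ q : Pt n, ENNReal.ofReal
        (expWeight τ s q.1 q.2 ^ 2 * (f₁ q ^ 2 / q.2 ^ (1 - 2 * s))) ∂slab n 0)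
      + (∫⁻ q : Pt n, ENNReal.ofReal
        (expWeight τ s q.1 q.2 ^ 2 * (f₂ q ^ 2 / q.2 ^ (1 - 2 * s))) ∂slab n 0)
      = bulkNorm (fun p => (Real.exp (τ * weight s p) * p.2 ^ ((2 * s - 1) / 2)) • f p) ^ 2 := by
  have hE := (continuous_expWeight (n := n) (τ := τ) hs').measurable
  have hY : Measurable fun q : Pt n => q.2 ^ (1 - 2 * s) := measurable_snd.pow_const _
  have hz : ∀ {g : Pt n → ℝ}, IsLocalized (-(1 - 2 * s)) g → ∀ p : Pt n, 1 / 2 < p.2 →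
      ENNReal.ofReal (expWeight τ s p.1 p.2 ^ 2 * (g p ^ 2 / p.2 ^ (1 - 2 * s))) = 0 :=
    fun h p hp => by simp [h.eq_zero p fun h' => absurd h'.2 (not_le.2 hp)]
  have hm : Measurable fun q : Pt n => ENNReal.ofReal
      (expWeight τ s q.1 q.2 ^ 2 * (f₁ q ^ 2 / q.2 ^ (1 - 2 * s))) :=
    ((hE.pow_const 2).mul ((hl₁.measurable.pow_const 2).div hY)).ennreal_ofReal
  rw [← lintegral_halfSpace_eq_slab (hz hl₁), ← lintegral_halfSpace_eq_slab (hz hl₂),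
    ← lintegral_add_left hm, bulkNorm, eLpNorm_two_sq]
  refine lintegral_congr_ae ?_
  filter_upwards [h₁, h₂, ae_halfSpaceMeasure_pos] with p hp1 hp2 hp
  have hp' := Real.rpow_pos_of_pos hp (1 - 2 * s)
  have e : p.2 ^ (2 * s - 1) = (p.2 ^ (1 - 2 * s))⁻¹ := by
    rw [← Real.rpow_neg hp.le, neg_sub]
  rw [← ENNReal.ofReal_add (by positivity) (by positivity), norm_smul, mul_pow,
    norm_sq_eq_re_add_im (f p), ← hp1, ← hp2, Real.norm_eq_abs, sq_abs, mul_pow, rpow_half_sq hp, e,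
    expWeight]
  ring_nf

/-- The squared norms on the left-hand side split over the real and imaginary part. -/
lemma bulkNorm_sq_add_bulkNorm_gradient_sq (hs' : s < 1) (hτ : 0 < τ)
    (hw₁ : IsLocalized (1 - 2 * s) w₁) (hw₂ : IsLocalized (1 - 2 * s) w₂)
    (hx₁ : ∀ i, IsLocalized (1 - 2 * s) (gx₁ i)) (hx₂ : ∀ i, IsLocalized (1 - 2 * s) (gx₂ i))
    (hy₁ : IsLocalized (1 - 2 * s) gy₁) (hy₂ : IsLocalized (1 - 2 * s) gy₂)
    (ew₁ : w₁ =ᵐ[halfSpaceMeasure n] fun p => RCLike.reCLM (w p))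
    (ew₂ : w₂ =ᵐ[halfSpaceMeasure n] fun p => RCLike.imCLM (w p))
    (ex₁ : ∀ i, gx₁ i =ᵐ[halfSpaceMeasure n] fun p => RCLike.reCLM (gx p i))
    (ex₂ : ∀ i, gx₂ i =ᵐ[halfSpaceMeasure n] fun p => RCLike.imCLM (gx p i))
    (ey₁ : gy₁ =ᵐ[halfSpaceMeasure n] fun p => RCLike.reCLM (gy p))
    (ey₂ : gy₂ =ᵐ[halfSpaceMeasure n] fun p => RCLike.imCLM (gy p)) :
    (ENNReal.ofReal (τ ^ (3 / 2 : ℝ)) * bulkNorm (fun p =>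
        (Real.exp (τ * weight s p) * p.2 ^ ((1 - 2 * s) / 2)) • w p)) ^ 2
      + (ENNReal.ofReal (τ ^ (1 / 2 : ℝ)) * bulkNorm (fun p =>
        Real.exp (τ * weight s p) * p.2 ^ ((1 - 2 * s) / 2) * gradLength gx gy p)) ^ 2
      = (∫⁻ q : Pt n, ENNReal.ofReal (q.2 ^ (1 - 2 * s) * expWeight τ s q.1 q.2 ^ 2
          * (τ ^ 3 * w₁ q ^ 2 + τ * (∑ i, gx₁ i q ^ 2 + gy₁ q ^ 2))) ∂slab n 0)
        + (∫⁻ q : Pt n, ENNReal.ofReal (q.2 ^ (1 - 2 * s) * expWeight τ s q.1 q.2 ^ 2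
          * (τ ^ 3 * w₂ q ^ 2 + τ * (∑ i, gx₂ i q ^ 2 + gy₂ q ^ 2))) ∂slab n 0) := by
  have hE := (continuous_expWeight (n := n) (τ := τ) hs').measurable
  have hY : Measurable fun q : Pt n => q.2 ^ (1 - 2 * s) := measurable_snd.pow_const _
  have hz : ∀ {g : Pt n → ℝ}, IsLocalized (1 - 2 * s) g → ∀ p : Pt n, 1 / 2 < p.2 → g p = 0 :=
    fun h p hp => h.eq_zero p fun h' => absurd h'.2 (not_le.2 hp)
  have hm : Measurable fun q : Pt n => ENNReal.ofReal (q.2 ^ (1 - 2 * s)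
      * expWeight τ s q.1 q.2 ^ 2 * (τ ^ 3 * w₁ q ^ 2 + τ * (∑ i, gx₁ i q ^ 2 + gy₁ q ^ 2))) :=
    ((hY.mul (hE.pow_const 2)).mul (((hw₁.measurable.pow_const 2).const_mul _).add
      (((Finset.measurable_fun_sum _ fun i _ => (hx₁ i).measurable.pow_const 2).add
        (hy₁.measurable.pow_const 2)).const_mul _))).ennreal_ofReal
  rw [← lintegral_halfSpace_eq_slab (fun p hp => by simp [hz hw₁ p hp, hz hy₁ p hp,
      fun i => hz (hx₁ i) p hp]),
    ← lintegral_halfSpace_eq_slab (fun p hp => by simp [hz hw₂ p hp, hz hy₂ p hp,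
      fun i => hz (hx₂ i) p hp]),
    ← lintegral_add_left hm, mul_pow, mul_pow, bulkNorm, bulkNorm, eLpNorm_two_sq, eLpNorm_two_sq]
  have e3 := ofReal_rpow_sq hτ 3
  have e1 := ofReal_rpow_sq hτ 1
  push_cast at e3 e1
  have hmw : Measurable fun q : Pt n => ENNReal.ofReal (τ ^ 3 * (q.2 ^ (1 - 2 * s)
      * expWeight τ s q.1 q.2 ^ 2 * (w₁ q ^ 2 + w₂ q ^ 2))) :=
    (((hY.mul (hE.pow_const 2)).mul ((hw₁.measurable.pow_const 2).add
      (hw₂.measurable.pow_const 2))).const_mul _).ennreal_ofReal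
  have hA : ∫⁻ p, ENNReal.ofReal (τ ^ 3 * (p.2 ^ (1 - 2 * s)
      * expWeight τ s p.1 p.2 ^ 2 * (w₁ p ^ 2 + w₂ p ^ 2))) ∂halfSpaceMeasure n
      = ENNReal.ofReal (τ ^ 3) * ∫⁻ p, ENNReal.ofReal (‖(Real.exp (τ * weight s p)
        * p.2 ^ ((1 - 2 * s) / 2)) • w p‖ ^ 2) ∂halfSpaceMeasure n := by
    rw [← lintegral_const_mul' _ _ ENNReal.ofReal_ne_top]
    refine lintegral_congr_ae ?_
    filter_upwards [ew₁, ew₂, ae_halfSpaceMeasure_pos] with p hp1 hp2 hp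
    rw [← ENNReal.ofReal_mul (by positivity), norm_smul, mul_pow, norm_sq_eq_re_add_im (w p), ← hp1,
      ← hp2, Real.norm_eq_abs, sq_abs, mul_pow, rpow_half_sq hp, expWeight]
    ring_nf
  rw [e3, e1, ← hA, ← lintegral_const_mul' _ _ ENNReal.ofReal_ne_top, ← lintegral_add_left hmw]
  refine lintegral_congr_ae ?_
  filter_upwards [ae_all_iff.2 ex₁, ae_all_iff.2 ex₂, ey₁, ey₂, ae_halfSpaceMeasure_pos]
    with p hx1 hx2 hy1 hy2 hp
  have hp' := Real.rpow_pos_of_pos hp (1 - 2 * s)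
  have hg : gradLength gx gy p ^ 2
      = ∑ i, gx₁ i p ^ 2 + ∑ i, gx₂ i p ^ 2 + (gy₁ p ^ 2 + gy₂ p ^ 2) := by
    rw [gradLength, Real.sq_sqrt (by positivity), EuclideanSpace.norm_sq_eq, norm_sq_eq_re_add_im,
      ← hy1, ← hy2, ← Finset.sum_add_distrib]
    congr 1
    exact Finset.sum_congr rfl fun i _ => by rw [norm_sq_eq_re_add_im, ← hx1, ← hx2]
  rw [← ENNReal.ofReal_mul (by positivity), ← ENNReal.ofReal_add (by positivity) (by positivity),
    ← ENNReal.ofReal_add (by positivity) (by positivity), Real.norm_eq_abs, sq_abs, mul_pow,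
    mul_pow, rpow_half_sq hp, hg, pow_one, expWeight]
  ring_nf

end Assembly

/-- From the sum of the squared estimates of two components to the estimate of the norms. -/
lemma add_le_of_sq_add_sq_le {τ : ℝ} (hτ : 1 ≤ τ) {X Y R N : ℝ≥0∞}
    (h : X ^ 2 + Y ^ 2 ≤ 3 * (R ^ 2 + ENNReal.ofReal (8 * τ) * N ^ 2)) :
    X + Y ≤ 10 * (R + ENNReal.ofReal τ * N) := by
  have hle : 3 * (R ^ 2 + ENNReal.ofReal (8 * τ) * N ^ 2)
      ≤ (5 * (R + ENNReal.ofReal τ * N)) ^ 2 := by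
    have h1 : ENNReal.ofReal (8 * τ) ≤ 8 * ENNReal.ofReal τ ^ 2 := by
      rw [← ENNReal.ofReal_pow (by linarith), ← ENNReal.ofReal_ofNat 8,
        ← ENNReal.ofReal_mul (by norm_num)]
      exact ENNReal.ofReal_le_ofReal (by nlinarith)
    calc 3 * (R ^ 2 + ENNReal.ofReal (8 * τ) * N ^ 2)
        ≤ 3 * (R ^ 2 + 8 * ENNReal.ofReal τ ^ 2 * N ^ 2) := by gcongr
      _ = 3 * R ^ 2 + 24 * (ENNReal.ofReal τ * N) ^ 2 := by ring
      _ ≤ 3 * R ^ 2 + 24 * (ENNReal.ofReal τ * N) ^ 2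
          + (22 * R ^ 2 + (ENNReal.ofReal τ * N) ^ 2 + 50 * (R * (ENNReal.ofReal τ * N))) :=
        le_self_add
      _ = (5 * (R + ENNReal.ofReal τ * N)) ^ 2 := by ring
  have hX : X ≤ 5 * (R + ENNReal.ofReal τ * N) :=
    (ENNReal.pow_le_pow_left_iff two_ne_zero).1 ((le_self_add.trans h).trans hle)
  have hY : Y ≤ 5 * (R + ENNReal.ofReal τ * N) :=
    (ENNReal.pow_le_pow_left_iff two_ne_zero).1 ((le_add_self.trans h).trans hle)
  calc X + Y ≤ 5 * (R + ENNReal.ofReal τ * N) + 5 * (R + ENNReal.ofReal τ * N) := add_le_add hX hY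
    _ = 10 * (R + ENNReal.ofReal τ * N) := by ring

end Carleman

theorem mainTheorem6 (𝕜 : Type*) [RCLike 𝕜] (n : ℕ) (hn : 1 ≤ n) (s : ℝ)
    (hs : 1 / 2 ≤ s) (hs' : s < 1) :
    ∃ C : ℝ≥0, ∀ (w : Carleman.Pt n → 𝕜) (gx : Carleman.Pt n → EuclideanSpace 𝕜 (Fin n))
      (gy f : Carleman.Pt n → 𝕜),
      Carleman.MemWeightedH1 s w gx gy →
      (∀ᵐ p ∂Carleman.halfSpaceMeasure n, p ∉ Carleman.halfBall n (1 / 2) → w p = 0) →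
      Carleman.IsWeakSolution s gx gy f →
      Carleman.HasZeroTrace w →
      MemLp (fun p => p.2 ^ ((2 * s - 1) / 2) • f p) 2 (Carleman.halfSpaceMeasure n) →
      limsup (Carleman.sliceNorm fun p => p.2 ^ (1 - 2 * s) • gy p)
        Carleman.boundaryFilter < ⊤ →
      limsup (Carleman.sliceNorm gx) Carleman.boundaryFilter < ⊤ →
      ∀ τ : ℝ, 4 ≤ τ →
        ∃ N T : ℝ≥0,
          Tendsto (Carleman.sliceNorm fun p =>
              (Real.exp (τ * Carleman.weight s p) * p.2 ^ (1 - 2 * s)) • gy p)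
            Carleman.boundaryFilter (𝓝 (N : ℝ≥0∞)) ∧
          Tendsto (Carleman.sliceNorm fun p =>
              Real.exp (τ * Carleman.weight s p) • Carleman.radialDeriv gx p)
            Carleman.boundaryFilter (𝓝 (T : ℝ≥0∞)) ∧
          ENNReal.ofReal (τ ^ (3 / 2 : ℝ)) *
              Carleman.bulkNorm (fun p =>
                (Real.exp (τ * Carleman.weight s p) * p.2 ^ ((1 - 2 * s) / 2)) • w p)
            + ENNReal.ofReal (τ ^ (1 / 2 : ℝ)) *
              Carleman.bulkNorm (fun p =>
                Real.exp (τ * Carleman.weight s p) * p.2 ^ ((1 - 2 * s) / 2) *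
                  Carleman.gradLength gx gy p)
          ≤ C * (Carleman.bulkNorm (fun p =>
                (Real.exp (τ * Carleman.weight s p) * p.2 ^ ((2 * s - 1) / 2)) • f p)
              + ENNReal.ofReal τ * N + ENNReal.ofReal τ * T) := by
  refine ⟨10, fun w gx gy f hH hw hsol htr hf _ _ τ hτ => ?_⟩
  obtain ⟨w₁, gx₁, gy₁, f₁, hD₁, ew₁, ex₁, ey₁, ef₁⟩ := Carleman.exists_isWeakData hH hw hsol hf
    hs hs' htr RCLike.reCLM fun z => by simpa using RCLike.abs_re_le_norm z
  obtain ⟨w₂, gx₂, gy₂, f₂, hD₂, ew₂, ex₂, ey₂, ef₂⟩ := Carleman.exists_isWeakData hH hw hsol hf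
    hs hs' htr RCLike.imCLM fun z => by simpa using RCLike.abs_im_le_norm z
  have hτ0 : 0 < τ := by linarith
  obtain ⟨L₁, hL₁⟩ := hD₁.exists_tendsto_lintegral_sq_conormal hs' hτ0.le
  obtain ⟨L₂, hL₂⟩ := hD₂.exists_tendsto_lintegral_sq_conormal hs' hτ0.le
  -- the tangential limit is zero, since the tangential gradient vanishes at the boundary
  refine ⟨NNReal.sqrt (L₁ + L₂), 0, ?_, ?_, ?_⟩
  · exact Carleman.tendsto_sliceNorm_conormal
      (fun y => hD₁.isLocalized_normal.measurable.comp measurable_prodMk_right) ey₁ ey₂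
      (hD₁.tendsto_lintegral_weight_sq_conormal hs' hL₁)
      (hD₂.tendsto_lintegral_weight_sq_conormal hs' hL₂)
  · exact Carleman.tendsto_sliceNorm_radialDeriv hs' hτ0.le hD₁.isLocalized_tangential
      hD₂.isLocalized_tangential ex₁ ex₂ hD₁.tendsto_lintegral_sq_tangential
      hD₂.tendsto_lintegral_sq_tangential
  · rw [ENNReal.coe_zero, mul_zero, add_zero]
    refine Carleman.add_le_of_sq_add_sq_le (by linarith) ?_
    rw [Carleman.bulkNorm_sq_add_bulkNorm_gradient_sq hs' hτ0 hD₁.isLocalized hD₂.isLocalized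
      hD₁.isLocalized_tangential hD₂.isLocalized_tangential hD₁.isLocalized_normal
      hD₂.isLocalized_normal ew₁ ew₂ ex₁ ex₂ ey₁ ey₂,
      ← Carleman.bulkNorm_rhs_sq hs' hD₁.isLocalized_rhs hD₂.isLocalized_rhs ef₁ ef₂,
      ← ENNReal.coe_pow, NNReal.sq_sqrt, ENNReal.coe_add]
    refine (add_le_add (hD₁.carleman hs hs' hτ hL₁) (hD₂.carleman hs hs' hτ hL₂)).trans
      (le_of_eq ?_)
    ring
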